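/- **Setting.** Let $d,p,k\ge 1$ be integers, $D\subset\mathbb R^p$ open, and $f_j:D\to\mathbb R^p$, $g_j:D\to\mathbb R$ ($1\le j\le d$), $U:D\to\mathbb R$ of class $C^1$, with $U$ convex and $\nabla U\cdot\nabla f_j=\nabla g_j$. Assume that the entropy variable $V=\nabla U(u)$ is a one-to-one function of $u\in D$, and put $W=\nabla U(D)$. Let $\hat f_n,\hat g_n$ be numerical fluxes, functions of two states in $W$, that are locally Lipschitz uniformly in the unit vector $n$ and consistent: $\hat f_n(V,V)=\sum_j n_jf_j(u(V))$, $\hat g_n(V,V)=\sum_j n_jg_j(u(V))$. Let $\Omega\subset\mathbb R^d$ be an open set with a family of triangulations by simplices $K$ of diameter $h_K$, $h=\max_K h_K$. Their skeletons consist of facets; $\partial K$ is a union of facets, an internal facet belongs to exactly two elements, a boundary facet belongs to one element and is a full face of it, and the boundary facets cover $\partial\Omega$. Let $V_h$ be the space of piecewise polynomials of degree $k$, either discontinuous, or continuous with conformal meshes, with local basis functions $\varphi_\sigma$ (for example Lagrange or Bézier) obtained from one fixed symmetric basis in barycentric coordinates, with $\sum_{\sigma\in K}\varphi_\sigma=1$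 on $K$. For $V^h=\sum_\sigma V_\sigma\varphi_\sigma\in (V_h)^p$ with values in $W$ put $u^h=u(V^h)$. The integrals $\oint_{\partial K}$ are sums over the facets $f\subset\partial K$ of quadrature formulas $\oint_f\psi\,d\gamma=|f|\sum_q\omega^f_q\psi(x^f_q)$, $x_q^f\in f$, which depend only on $f$. On a facet of $K$, $V^h_{|K^-}$ denotes the restriction of $V^h$ to the element on the other side, and $V^h_{|K^-}=V^h_{|K}$ on $\partial\Omega$. A residual scheme consists of element residuals $\Phi^K_\sigma(V^h)\in\mathbb R^p$ and boundary residuals $\Phi^\Gamma_\sigma(V^h)\in\mathbb R^p$ ($\Gamma$ a boundary facet, $\sigma\in\Gamma$) such that, for all $V^h\in (V_h)^p$ with values in $W$, $$\sum_{\sigma\in K}\Phi_\sigma^K=\oint_{\partial K}\hat f_n(V^h_{|K},V^h_{|K^-})\,d\gamma,\qquad \sum_{\sigma\in\Gamma}\Phi_\sigma^\Gamma=\oint_\Gamma\big(\hat f_n(V^h,V(u_b))-f(u^h)\cdot n\big)\,d\gamma,$$ where $u_b$ is given with values in $D$ on $\partial\Omega$. On each $K$, with $\#K$ degrees of freedom,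 the modified scheme has the residuals $\Phi'_\sigma=\Phi_\sigma+r_\sigma$ with $$r_\sigma=\alpha(V_\sigma-\bar V),\quad \bar V=\frac1{\#K}\sum_{\sigma\in K}V_\sigma,\quad \alpha=\frac{\mathcal E}{\sum_{\sigma\in K}|V_\sigma-\bar V|^2},\quad \mathcal E=\oint_{\partial K}\hat g_n(V^h_{|K},V^h_{|K^-})\,d\gamma-\sum_{\sigma\in K}\langle V_\sigma,\Phi_\sigma\rangle ,$$ and unchanged boundary residuals. **Proposition.** (1) The modified scheme is conservative: for all $V^h\in (V_h)^p$ with values in $W$ and all $K$, $\sum_{\sigma\in K}\Phi'_\sigma=\oint_{\partial K}\hat f_n(V^h_{|K},V^h_{|K^-})\,d\gamma$ (with $r_\sigma=0$ where all $V_\sigma$, $\sigma\in K$, are equal). (2) It is locally entropy conservative: for all such $V^h$ and all $K$ on which the $V_\sigma$ are not all equal, $\sum_{\sigma\in K}\langle V_\sigma,\Phi'_\sigma\rangle=\oint_{\partial K}\hat g_n(V^h_{|K},V^h_{|K^-})\,d\gamma$. (3) Assume that the family of meshes is shape regular, with a bounded number of facets per element and with comparable diameters of elements that share a facet; that $\sum_q|\omega_q^f|$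 is bounded and, for each $\psi$ of class $C^{k+1}$ near $\overline\Omega$, $\int_f\psi\,d\gamma=\oint_f\psi\,d\gamma+O(h_K^{d+k})$ for the facets $f$ of $K$. Let $u:\overline\Omega\to D$ be a smooth steady solution: $u$, $V=\nabla U(u)$, $f_j(u)$, $g_j(u)$ are of class $C^{k+1}$ near $\overline\Omega$ and $\sum_j\partial_jf_j(u)=0$ in $\Omega$. Let $\pi_hV\in (V_h)^p$ be approximations of $V$ of order $k+1$: $\|\pi_hV-V\|_{L^\infty(K)}=O(h_K^{k+1})$, with values in $W$ for small $h$. Assume that the residuals computed with $\pi_hV$ satisfy $\Phi_\sigma^K=O(h_K^{k+d})$ and $\Phi^\Gamma_\sigma=O(h_K^{k+d-1})$ for $\Gamma\subset\partial K$. Then, computed with $\pi_hV$, $\mathcal E=O(h_K^{k+d})$. If moreover $\nabla V(x)\neq0$ for all $x\in\overline\Omega$, then, for some $c>0$ and all sufficiently fine meshes, $\sum_{\sigma\in K}|V_\sigma-\bar V|^2\ge c\,h_K^2$ on every element, and $$\alpha=O(h_K^{k+d-2}),\qquad r_\sigma=O(h_K^{k+d-1}),\qquad \Phi'_\sigma=O(h_K^{k+d-1}),$$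 and the modified scheme is of order at least $k$ at steady state: there is a constant $C$ such that for all sufficiently fine meshes of the family and all scalar functions $\varphi\in V_h\cap C^0(\Omega)$, with coefficients $\varphi_\sigma$ in the basis of $V_h$, $$\Big|\sum_{\sigma}\varphi_\sigma\Big[\sum_{K\ni\sigma}\Phi'^{K}_\sigma+\sum_{\Gamma\ni\sigma}\Phi_\sigma^\Gamma\Big]\Big|\le C\,\|\varphi\|_{H^1(\Omega)}\,h^k .$$ All constants in the $O(\cdot)$ are independent of the mesh and of the element, and the bounds hold for all sufficiently fine meshes. -/

import Mathlib

open MeasureTheory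

noncomputable section

namespace ResidualDistribution

/-- Physical space `ℝ^d` and state space `ℝ^p` are Euclidean spaces. -/
abbrev Eu (n : ℕ) := EuclideanSpace ℝ (Fin n)

/-! ### The conservation law and its entropy -/

/-- A system of conservation laws `∑ⱼ ∂ⱼ fⱼ(u) = 0` with states in the open set `D ⊆ ℝ^p`, with an
entropy pair `(U, g)` whose entropy variable `∇U` is one-to-one on `D`. -/
structure EntropySystem (d p : ℕ) where
  D : Set (Eu p)
  isOpen_D : IsOpen D
  f : Fin d → Eu p → Eu p
  contDiffOn_f : ∀ j, ContDiffOn ℝ 1 (f j) D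
  U : Eu p → ℝ
  contDiffOn_U : ContDiffOn ℝ 1 U D
  convexOn_U : ∀ C ⊆ D, Convex ℝ C → ConvexOn ℝ C U
  g : Fin d → Eu p → ℝ
  contDiffOn_g : ∀ j, ContDiffOn ℝ 1 (g j) D
  /-- `∇U · ∇fⱼ = ∇gⱼ`. -/
  compatible : ∀ j, ∀ u ∈ D, (fderiv ℝ U u).comp (fderiv ℝ (f j) u) = fderiv ℝ (g j) u
  injOn_gradient : Set.InjOn (gradient U) D

namespace EntropySystem

variable {d p : ℕ} (sys : EntropySystem d p)

/-- The entropy variable `V(u) = ∇U(u)`. -/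
def entropyVar (u : Eu p) : Eu p := gradient sys.U u

/-- The admissible values of the entropy variable. -/
def W : Set (Eu p) := sys.entropyVar '' sys.D

/-- The inverse map `V ↦ u(V)`, from `W` to `D`. -/
def stateOf : Eu p → Eu p := Function.invFunOn sys.entropyVar sys.D

/-- `f(u) · n`. -/
def normalFlux (n : Eu d) (u : Eu p) : Eu p := ∑ j, n j • sys.f j u

/-- `g(u) · n`. -/
def normalEntropyFlux (n : Eu d) (u : Eu p) : ℝ := ∑ j, n j * sys.g j u

end EntropySystem

/-- A numerical flux `n, V, V⁻ ↦ F̂_n(V, V⁻)`, written in entropy variables. -/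
abbrev NumFlux (d p : ℕ) (Y : Type) := Eu d → Eu p → Eu p → Y

/-- `F̂_n(V(u), V(u)) = F(u) · n` for all unit vectors `n`, where `F n u` stands for `F(u) · n`. -/
def IsConsistent {d p : ℕ} {Y : Type} (sys : EntropySystem d p) (F : Eu d → Eu p → Y)
    (Fhat : NumFlux d p Y) : Prop :=
  ∀ n : Eu d, ‖n‖ = 1 → ∀ u ∈ sys.D, Fhat n (sys.entropyVar u) (sys.entropyVar u) = F n u

/-- The numerical flux is locally Lipschitz in its two states, uniformly in the unit normal. -/
def IsLipschitzFlux {d p : ℕ} {Y : Type} [NormedAddCommGroup Y] (sys : EntropySystem d p)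
    (Fhat : NumFlux d p Y) : Prop :=
  ∀ a₀ ∈ sys.W, ∀ b₀ ∈ sys.W, ∃ ε > 0, ∃ L : ℝ, ∀ n : Eu d, ‖n‖ = 1 →
    ∀ a ∈ sys.W ∩ Metric.ball a₀ ε, ∀ a' ∈ sys.W ∩ Metric.ball a₀ ε,
    ∀ b ∈ sys.W ∩ Metric.ball b₀ ε, ∀ b' ∈ sys.W ∩ Metric.ball b₀ ε,
      ‖Fhat n a b - Fhat n a' b'‖ ≤ L * (‖a - a'‖ + ‖b - b'‖)

/-- `ψ` is of class `C^m` on a neighbourhood of the closure of `Ω`. -/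
def SmoothNear {d : ℕ} {Y : Type} [NormedAddCommGroup Y] [NormedSpace ℝ Y] (Ω : Set (Eu d))
    (m : ℕ) (ψ : Eu d → Y) : Prop :=
  ∃ O : Set (Eu d), IsOpen O ∧ closure Ω ⊆ O ∧ ContDiffOn ℝ m ψ O

/-- A smooth steady solution: a field with values in `D` such that `u`, its entropy variable and
its fluxes are of class `C^m` up to the boundary, and `div f(u) = 0` pointwise in `Ω`. -/
structure IsSmoothSteadySolution {d p : ℕ} (sys : EntropySystem d p) (Ω : Set (Eu d)) (m : ℕ)
    (u : Eu d → Eu p) : Prop where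
  mem_D : ∀ x ∈ closure Ω, u x ∈ sys.D
  smooth : SmoothNear Ω m u
  smooth_entropyVar : SmoothNear Ω m (fun x => sys.entropyVar (u x))
  smooth_f : ∀ j, SmoothNear Ω m (fun x => sys.f j (u x))
  smooth_g : ∀ j, SmoothNear Ω m (fun x => sys.g j (u x))
  div_eq_zero : ∀ x ∈ Ω,
    ∑ j, fderiv ℝ (fun y => sys.f j (u y)) x (EuclideanSpace.single j 1) = 0

/-! ### Meshes -/

/-- The vertices of a nondegenerate simplex of `ℝ^d`. -/
abbrev Simp (d : ℕ) := AffineBasis (Fin (d + 1)) ℝ (Eu d)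

/-- The closed simplex. -/
def Simp.carrier {d : ℕ} (b : Simp d) : Set (Eu d) := convexHull ℝ (Set.range b)

/-- The face opposite to the vertex `i`. -/
def Simp.face {d : ℕ} (b : Simp d) (i : Fin (d + 1)) : Set (Eu d) := convexHull ℝ (b '' {i}ᶜ)

/-- The outward unit normal on the face opposite to the vertex `i`, which is `-∇λᵢ / |∇λᵢ|` with
`λᵢ` the barycentric coordinate (an affine function). -/
def Simp.normal {d : ℕ} (b : Simp d) (i : Fin (d + 1)) : Eu d :=
  -(‖gradient (fun x => b.coord i x) 0‖⁻¹ • gradient (fun x => b.coord i x) 0)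

/-- A triangulation of `Ω` by simplices together with its skeleton.  The facets of the skeleton
are pieces of the faces of the elements; they are pairwise disjoint up to surface measure `0`, and
each of them belongs either to two elements (internal facet) or to one (boundary facet).  The
boundary facets are faces of elements and they cover `∂Ω`.  Hanging nodes are allowed. -/
structure Mesh (d : ℕ) (Ω : Set (Eu d)) where
  nElem : ℕ
  elem : Fin nElem → Simp d
  nFacet : ℕ
  facet : Fin nFacet → Set (Eu d)
  /-- The facets which make up `∂K`. -/
  facets : Fin nElem → Finset (Fin nFacet)
  /-- The face of `K` on which a facet of `K` lies. -/
  side : Fin nElem → Fin nFacet → Fin (d + 1)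
  disjoint_interior : ∀ K K', K ≠ K' →
    Disjoint (interior (elem K).carrier) (interior (elem K').carrier)
  iUnion_elem : ⋃ K, (elem K).carrier = closure Ω
  isClosed_facet : ∀ f, IsClosed (facet f)
  area_pos : ∀ f, 0 < μHE[d - 1] (facet f)
  area_inter : ∀ f f', f ≠ f' → μHE[d - 1] (facet f ∩ facet f') = 0
  face_eq : ∀ K i, (elem K).face i = ⋃ f ∈ (facets K).filter (fun f => side K f = i), facet f
  card_owners : ∀ f, (Finset.univ.filter fun K => f ∈ facets K).card = 1 ∨
    (Finset.univ.filter fun K => f ∈ facets K).card = 2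
  facet_eq_face : ∀ K, ∀ f ∈ facets K, (Finset.univ.filter fun K' => f ∈ facets K').card = 1 →
    facet f = (elem K).face (side K f)
  frontier_eq : frontier Ω =
    ⋃ f ∈ Finset.univ.filter
      (fun f => (Finset.univ.filter fun K => f ∈ facets K).card = 1), facet f

namespace Mesh

variable {d : ℕ} {Ω : Set (Eu d)} (T : Mesh d Ω)

/-- The facet lies on `∂Ω`, that is, it belongs to exactly one element. -/
def IsBoundary (f : Fin T.nFacet) : Prop := (Finset.univ.filter fun K => f ∈ T.facets K).card = 1

/-- The facets of `K` on `∂Ω`. -/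
def boundaryFacets (K : Fin T.nElem) : Finset (Fin T.nFacet) :=
  (T.facets K).filter fun f => (Finset.univ.filter fun K' => f ∈ T.facets K').card = 1

/-- The surface measure of a facet. -/
def area (f : Fin T.nFacet) : ℝ := (μHE[d - 1]).real (T.facet f)

/-- The outward unit normal of `K` on its facet `f`. -/
def normal (K : Fin T.nElem) (f : Fin T.nFacet) : Eu d := (T.elem K).normal (T.side K f)

open Classical in
/-- The element on the other side of the facet `f` of `K`; on `∂Ω` this is `K` itself. -/
def opposite (K : Fin T.nElem) (f : Fin T.nFacet) : Fin T.nElem :=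
  if h : ∃ K', K' ≠ K ∧ f ∈ T.facets K' then h.choose else K

/-- The diameter `h_K`. -/
def diam (K : Fin T.nElem) : ℝ := Metric.diam (T.elem K).carrier

/-- The mesh size `h = max_K h_K`. -/
def size : ℝ := ⨆ K, T.diam K

/-- A conformal mesh: two elements meet in a common (possibly empty) subsimplex, and the facets
are the faces of the elements. -/
def IsConformal : Prop :=
  (∀ K K', (T.elem K).carrier ∩ (T.elem K').carrier =
    convexHull ℝ (Set.range (T.elem K) ∩ Set.range (T.elem K'))) ∧
  ∀ K, ∀ f ∈ T.facets K, T.facet f = (T.elem K).face (T.side K f)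

end Mesh

/-- A regular family of meshes: the elements are shape regular, the number of facets of an element
is bounded, and elements with a common facet have comparable diameters. -/
def IsRegularFamily {d : ℕ} {Ω : Set (Eu d)} {ι : Type} (T : ι → Mesh d Ω) : Prop :=
  ∃ κ : ℝ, 0 < κ ∧ ∀ i,
    (∀ K, ∃ x, Metric.closedBall x ((T i).diam K / κ) ⊆ ((T i).elem K).carrier) ∧
    (∀ K, (((T i).facets K).card : ℝ) ≤ κ) ∧
    ∀ K K', ∀ f ∈ (T i).facets K, f ∈ (T i).facets K' → (T i).diam K' ≤ κ * (T i).diam K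

/-! ### Quadrature on the skeleton -/

/-- Quadrature points and weights on each facet; they depend on the facet only, not on the element
from which it is seen. -/
structure FacetQuadrature {d : ℕ} {Ω : Set (Eu d)} (T : Mesh d Ω) where
  nNode : Fin T.nFacet → ℕ
  node : ∀ f, Fin (nNode f) → Eu d
  weight : ∀ f, Fin (nNode f) → ℝ
  node_mem : ∀ f q, node f q ∈ T.facet f

/-- `∮_f ψ dγ = |f| ∑_q ω_q ψ(x_q)`. -/
def FacetQuadrature.integral {d : ℕ} {Ω : Set (Eu d)} {T : Mesh d Ω} (Q : FacetQuadrature T)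
    {Y : Type} [AddCommGroup Y] [Module ℝ Y] (f : Fin T.nFacet) (ψ : Eu d → Y) : Y :=
  T.area f • ∑ q, Q.weight f q • ψ (Q.node f q)

/-! ### Finite element spaces -/

/-- Degrees of freedom of an element: multi-indices `α = (α₀, …, α_d)` with `∑ αₗ = k`. -/
abbrev Idx (d k : ℕ) := ↥(Finset.Nat.antidiagonalTuple (d + 1) k)

/-- Shape functions of degree `k`, as polynomials in the barycentric coordinates: a basis of `ℙ^k`
made of functions that sum to one, are permuted by the symmetries of the simplex, and such that
`φ_α` vanishes on the faces that do not contain the Lagrange point of index `α`.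
The Lagrange and the Bézier (Bernstein) bases are the standard examples. -/
structure ShapeFunctions (d k : ℕ) where
  poly : Idx d k → MvPolynomial (Fin (d + 1)) ℝ
  totalDegree_le : ∀ α, (poly α).totalDegree ≤ k
  independent : ∀ c : Idx d k → ℝ,
    (∀ l : Fin (d + 1) → ℝ, ∑ i, l i = 1 → ∑ α, c α * (poly α).eval l = 0) → c = 0
  sum_eq_one : ∀ l : Fin (d + 1) → ℝ, ∑ i, l i = 1 → ∑ α, (poly α).eval l = 1
  symmetric : ∀ (τ : Equiv.Perm (Fin (d + 1))) (α β : Idx d k), β.1 = α.1 ∘ τ →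
    ∀ l : Fin (d + 1) → ℝ, ∑ i, l i = 1 → (poly β).eval (l ∘ τ) = (poly α).eval l
  vanish : ∀ (α : Idx d k) (i : Fin (d + 1)), α.1 i ≠ 0 →
    ∀ l : Fin (d + 1) → ℝ, ∑ j, l j = 1 → l i = 0 → (poly α).eval l = 0

/-- The two choices of `V_h`: continuous, or fully discontinuous, piecewise polynomials. -/
inductive SpaceKind
  | continuous
  | discontinuous

/-- The Lagrange point `L_α = ∑ₗ (αₗ / k) Aₗ`. -/
def lagrangePoint {d k : ℕ} (b : Simp d) (α : Idx d k) : Eu d :=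
  ∑ l, ((α.1 l : ℝ) / k) • b l

namespace Mesh

variable {d : ℕ} {Ω : Set (Eu d)} (T : Mesh d Ω)

/-- The label of a local degree of freedom: its Lagrange point (shared by the elements that contain
it) in the continuous case, its element and its Lagrange point in the discontinuous case. -/
def dofLabel {k : ℕ} (s : SpaceKind) (K : Fin T.nElem) (α : Idx d k) :
    Option (Fin T.nElem) × Eu d :=
  match s with
  | .continuous => (none, lagrangePoint (T.elem K) α)
  | .discontinuous => (some K, lagrangePoint (T.elem K) α)

open Classical in
/-- The set `𝒮` of all degrees of freedom. -/
def dofs (s : SpaceKind) (k : ℕ) : Finset (Option (Fin T.nElem) × Eu d) :=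
  Finset.univ.image fun q : Fin T.nElem × Idx d k => T.dofLabel s q.1 q.2

/-- The global degree of freedom with local index `α` in `K`. -/
def dof (s : SpaceKind) {k : ℕ} (K : Fin T.nElem) (α : Idx d k) : ↥(T.dofs s k) :=
  ⟨T.dofLabel s K α, by
    rw [dofs]
    exact Finset.mem_image.2 ⟨(K, α), Finset.mem_univ _, rfl⟩⟩

end Mesh

/-- An element of `V_h` with values in `Y`, given by its coefficients. -/
abbrev DiscreteField {d : ℕ} {Ω : Set (Eu d)} (T : Mesh d Ω) (s : SpaceKind) (k : ℕ) (Y : Type) :=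
  ↥(T.dofs s k) → Y

section Fields

variable {d k : ℕ} {Ω : Set (Eu d)} {T : Mesh d Ω} {s : SpaceKind} {Y : Type}

/-- The value at `x` of the restriction to `K` of `v^h = ∑_σ v_σ φ_σ`. -/
def evalOn [AddCommGroup Y] [Module ℝ Y] (B : ShapeFunctions d k) (v : DiscreteField T s k Y)
    (K : Fin T.nElem) (x : Eu d) : Y :=
  ∑ α, (B.poly α).eval (fun l => (T.elem K).coord l x) • v (T.dof s K α)

/-- `V^h` takes its values in the admissible set of the entropy variable, so that
`u^h = u(V^h)` makes sense. -/
def IsAdmissible {p : ℕ} (sys : EntropySystem d p) (B : ShapeFunctions d k)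
    (V : DiscreteField T s k (Eu p)) : Prop :=
  ∀ K, ∀ x ∈ (T.elem K).carrier, evalOn B V K x ∈ sys.W

/-- `v^h` is continuous on `Ω`: it is single-valued there. (For `s = .continuous` on a conformal
mesh this holds for every `v^h`.) -/
def IsContinuousField [AddCommGroup Y] [Module ℝ Y] (B : ShapeFunctions d k)
    (v : DiscreteField T s k Y) : Prop :=
  ∀ K K', ∀ x ∈ Ω, x ∈ (T.elem K).carrier → x ∈ (T.elem K').carrier →
    evalOn B v K x = evalOn B v K' x

/-- The `H¹(Ω)` norm of a continuous piecewise polynomial function. -/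
def h1Norm (B : ShapeFunctions d k) (v : DiscreteField T s k ℝ) : ℝ :=
  √(∑ K, ∫ x in (T.elem K).carrier, ((evalOn B v K x) ^ 2 + ‖gradient (evalOn B v K) x‖ ^ 2))

/-- `∮_{∂K} F̂_n(V^h_{|K}, V^h_{|K⁻}) dγ`, with `V^h_{|K⁻} = V^h_{|K}` on `∂Ω`. -/
def boundaryIntegral {p : ℕ} [AddCommGroup Y] [Module ℝ Y] (B : ShapeFunctions d k)
    (Q : FacetQuadrature T) (Fhat : NumFlux d p Y) (V : DiscreteField T s k (Eu p))
    (K : Fin T.nElem) : Y :=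
  ∑ f ∈ T.facets K, Q.integral f fun x =>
    Fhat (T.normal K f) (evalOn B V K x) (evalOn B V (T.opposite K f) x)

/-- The mean `V̄` of the degrees of freedom of `K`. -/
def mean {p : ℕ} (V : DiscreteField T s k (Eu p)) (K : Fin T.nElem) : Eu p :=
  (Fintype.card (Idx d k) : ℝ)⁻¹ • ∑ α : Idx d k, V (T.dof s K α)

/-- `∑_{σ ∈ K} (V_σ - V̄)²`. -/
def spread {p : ℕ} (V : DiscreteField T s k (Eu p)) (K : Fin T.nElem) : ℝ :=
  ∑ α : Idx d k, ‖V (T.dof s K α) - mean V K‖ ^ 2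

/-- The weak truncation error `∑_σ φ_σ [∑_{K ∋ σ} Φ_σ^K + ∑_{Γ ∋ σ} Φ_σ^Γ]` of given residuals
against the test function with coefficients `φ_σ`. The degrees of freedom of a boundary facet `Γ` of
`K` are those of `K` on the face `Γ`. -/
def truncationError {p : ℕ} (Φ : Fin T.nElem → Idx d k → Eu p) (Φb : Fin T.nFacet → Idx d k → Eu p)
    (φ : DiscreteField T s k ℝ) : Eu p :=
  open Classical in
  ∑ σ, φ σ •
    ((∑ K, ∑ α ∈ Finset.univ.filter (fun α => T.dof s K α = σ), Φ K α) +
      ∑ K, ∑ f ∈ T.boundaryFacets K,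
        ∑ α ∈ Finset.univ.filter (fun α => T.dof s K α = σ ∧ α.1 (T.side K f) = 0), Φb f α)

end Fields

/-! ### Residual schemes and the entropy correction -/

/-- A residual scheme on the mesh `T`: element residuals `Φ_σ^K(V^h)` and boundary residuals
`Φ_σ^Γ(V^h)` which satisfy the conservation relations. The boundary data is `u_b`. -/
structure ResidualScheme {d p k : ℕ} (sys : EntropySystem d p) {Ω : Set (Eu d)} (T : Mesh d Ω)
    (s : SpaceKind) (B : ShapeFunctions d k) (Q : FacetQuadrature T)
    (fhat : NumFlux d p (Eu p)) (ub : Eu d → Eu p) where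
  res : DiscreteField T s k (Eu p) → Fin T.nElem → Idx d k → Eu p
  bdryRes : DiscreteField T s k (Eu p) → Fin T.nFacet → Idx d k → Eu p
  conservation : ∀ V, IsAdmissible sys B V → ∀ K,
    ∑ α, res V K α = boundaryIntegral B Q fhat V K
  bdry_conservation : ∀ V, IsAdmissible sys B V → ∀ K, ∀ f ∈ T.boundaryFacets K,
    ∑ α ∈ Finset.univ.filter (fun α : Idx d k => α.1 (T.side K f) = 0), bdryRes V f α =
      Q.integral f fun x =>
        fhat (T.normal K f) (evalOn B V K x) (sys.entropyVar (ub x)) -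
          sys.normalFlux (T.normal K f) (sys.stateOf (evalOn B V K x))

namespace ResidualScheme

variable {d p k : ℕ} {sys : EntropySystem d p} {Ω : Set (Eu d)} {T : Mesh d Ω}
  {s : SpaceKind} {B : ShapeFunctions d k} {Q : FacetQuadrature T}
  {fhat : NumFlux d p (Eu p)} {ub : Eu d → Eu p}
  (S : ResidualScheme sys T s B Q fhat ub) (ghat : NumFlux d p ℝ)
  (V : DiscreteField T s k (Eu p)) (K : Fin T.nElem)

/-- `𝓔 = ∮_{∂K} ĝ_n(V^h_{|K}, V^h_{|K⁻}) dγ - ∑_{σ ∈ K} ⟨V_σ, Φ_σ⟩`. -/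
def entropyDefect : ℝ :=
  boundaryIntegral B Q ghat V K - ∑ α, inner ℝ (V (T.dof s K α)) (S.res V K α)

/-- `α = 𝓔 / ∑_{σ ∈ K} (V_σ - V̄)²`. -/
def coeff : ℝ := S.entropyDefect ghat V K / spread V K

/-- `r_σ = α (V_σ - V̄)`. -/
def correction (α : Idx d k) : Eu p := S.coeff ghat V K • (V (T.dof s K α) - mean V K)

/-- `Φ'_σ = Φ_σ + r_σ`. -/
def correctedRes (α : Idx d k) : Eu p := S.res V K α + S.correction ghat V K α

end ResidualScheme

/-! ### Orders of magnitude along a family of meshes -/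

section Orders

variable {d : ℕ} {Ω : Set (Eu d)} {ι : Type} (T : ι → Mesh d Ω)

/-- `q_K = O(h_K^m)`: for sufficiently fine meshes, `|q_K| ≤ C h_K^m` for all elements `K`, with a
constant independent of the mesh and of the element. -/
def ElementO (m : ℕ) (q : ∀ i, Fin (T i).nElem → ℝ) : Prop :=
  ∃ C h₀ : ℝ, 0 < h₀ ∧ ∀ i, (T i).size ≤ h₀ → ∀ K, |q i K| ≤ C * (T i).diam K ^ m

/-- `q_{K,f} = O(h_K^m)` for all facets `f` of elements `K`. -/
def FacetO (m : ℕ) (q : ∀ i, Fin (T i).nElem → Fin (T i).nFacet → ℝ) : Prop :=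
  ∃ C h₀ : ℝ, 0 < h₀ ∧ ∀ i, (T i).size ≤ h₀ → ∀ K, ∀ f ∈ (T i).facets K,
    |q i K f| ≤ C * (T i).diam K ^ m

/-- `q_{K,f} = O(h_K^m)` for all boundary facets `f` of elements `K`. -/
def BoundaryFacetO (m : ℕ) (q : ∀ i, Fin (T i).nElem → Fin (T i).nFacet → ℝ) : Prop :=
  ∃ C h₀ : ℝ, 0 < h₀ ∧ ∀ i, (T i).size ≤ h₀ → ∀ K, ∀ f ∈ (T i).boundaryFacets K,
    |q i K f| ≤ C * (T i).diam K ^ m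

/-- The facet quadratures have uniformly bounded weights, and for every `ψ` of class `C^{k+1}` one
has `∫_f ψ dγ = ∮_f ψ dγ + O(h_K^{d+k})` on the facets `f` of `K`. -/
def IsQuadratureOfOrder (Q : ∀ i, FacetQuadrature (T i)) (k : ℕ) : Prop :=
  (∃ M : ℝ, ∀ i f, ∑ q, |(Q i).weight f q| ≤ M) ∧
  ∀ ψ : Eu d → ℝ, SmoothNear Ω (k + 1) ψ →
    FacetO T (d + k) fun i _ f => (∫ x in (T i).facet f, ψ x ∂μHE[d - 1]) - (Q i).integral f ψ

/-- `v^h - v = O(h_K^m)` in the maximum norm of each element `K`. -/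
def IsApproximation {k : ℕ} {s : SpaceKind} {Y : Type} [NormedAddCommGroup Y] [NormedSpace ℝ Y]
    (B : ShapeFunctions d k) (m : ℕ) (v : Eu d → Y)
    (vh : ∀ i, DiscreteField (T i) s k Y) : Prop :=
  ∃ C h₀ : ℝ, 0 < h₀ ∧ ∀ i, (T i).size ≤ h₀ → ∀ K, ∀ x ∈ ((T i).elem K).carrier,
    ‖evalOn B (vh i) K x - v x‖ ≤ C * (T i).diam K ^ m

/-- Residuals of order `m`: the weak truncation error against `φ` is at most
`C ‖φ‖_{H¹(Ω)} h^m` for all `φ ∈ V_h ∩ C⁰(Ω)`. -/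
def IsOfOrder {p k : ℕ} {s : SpaceKind} (B : ShapeFunctions d k) (m : ℕ)
    (Φ : ∀ i, Fin (T i).nElem → Idx d k → Eu p)
    (Φb : ∀ i, Fin (T i).nFacet → Idx d k → Eu p) : Prop :=
  ∃ C h₀ : ℝ, 0 < h₀ ∧ ∀ i, (T i).size ≤ h₀ →
    ∀ φ : DiscreteField (T i) s k ℝ, IsContinuousField B φ →
      ‖truncationError (Φ i) (Φb i) φ‖ ≤ C * h1Norm B φ * (T i).size ^ m

end Orders

end ResidualDistribution

end

open ResidualDistribution

/-!
# An entropy correction of residual schemes: conservation and accuracy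

The correction adds `r_σ = α (V_σ - V̄)` to the residuals of an element. Since `∑ (V_σ - V̄) = 0`,
the total residual does not change, and since `∑ ⟨V_σ, V_σ - V̄⟩ = ∑ |V_σ - V̄|²`, the coefficient
`α` is the one for which the entropy balance is exact.

*Size of the correction.* For a smooth steady solution `div f(u) = 0`, and the chain rule gives
`div g(u) = 0`. The exact fluxes of `f(u)` and `g(u)` through `∂K` therefore vanish, by the
divergence theorem on a simplex with its surface measures (`Simp.sum_integral_face_eq_zero`, which
follows from Fubini along the edges of the simplex). The numerical fluxes of the approximation
differ from them by the approximation error and the quadrature error, so that both flux integrals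
are `O(h^{k+d})` (`boundaryIntegral_elementO`); with the size of the residuals, the entropy defect
is `O(h^{k+d})`. Where `∇V ≠ 0`, the ball inscribed in `K` contains a segment along which `V`,
hence also its approximation, varies by at least a multiple of `h`; since the shape functions sum
to one, this variation is at most a multiple of `(∑ |V_σ - V̄|²)^{1/2}`, which is thus bounded
below by a multiple of `h` (`IsApproximation.exists_spread_ge`). The bounds on `α`, `r_σ` and
`Φ'_σ` follow by division.

*Order of the scheme.* In an element, `∑ φ_σ Φ'_σ = ∑ (φ_σ - φ_τ) Φ'_σ + φ_τ ∑ Φ'_σ` for a fixed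
`τ`. The last sum is a flux integral, of order `k + d`, and the differences of coefficients are
controlled by `h ∫_K |∇φ|`, by a Poincaré inequality transported from a reference simplex. Both
parts are at most `C h^k ∫_K (|φ| + |∇φ|)` (`exists_element_sum_le`). The boundary residuals are
only `O(h^{k+d-1})` and do not cancel; they are tested against coefficients that are controlled by
the trace of `φ` (`exists_boundary_sum_le`). The sum over the boundary facets is then estimated by
the trace inequality `∫_{∂Ω} |φ| ≤ C ∫_Ω (|φ| + |∇φ|)` (`Mesh.exists_trace_le`). Its constant has
to be independent of the mesh on which `φ` is piecewise polynomial, so one triangulation of the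
family is kept fixed: each of its boundary faces is the base of a simplex contained in the closure
of `Ω`, and `φ` is integrated along segments that enter this simplex. The Cauchy–Schwarz
inequality concludes.
-/

namespace ResidualDistribution

/-! ### Slicing the Lebesgue measure by hyperplanes -/

section Slicing

variable {d : ℕ}

lemma finrank_orthogonal_span_singleton_eq {g : Eu d} (hg : g ≠ 0) :
    Module.finrank ℝ (ℝ ∙ g)ᗮ = d - 1 := by
  have h := (ℝ ∙ g).finrank_add_finrank_orthogonal
  rw [finrank_span_singleton hg, finrank_euclideanSpace, Fintype.card_fin] at h
  omega

/-- The Hausdorff measure of a hyperplane is the Lebesgue measure of its direction, translated. -/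
lemma map_vadd_volume_eq_restrict_hyperplane {A : Eu d → ℝ} {g : Eu d}
    (hA : ∀ x y, A x - A y = inner ℝ g (x - y)) (hg : g ≠ 0) {x₀ : Eu d} (hx₀ : A x₀ = 0) :
    (volume : Measure (ℝ ∙ g)ᗮ).map (fun y : (ℝ ∙ g)ᗮ => (y : Eu d) + x₀) =
      (μHE[d - 1] : Measure (Eu d)).restrict {x | A x = 0} := by
  have hiso : Isometry (fun y : (ℝ ∙ g)ᗮ => (y : Eu d) + x₀) := by
    refine Isometry.of_dist_eq fun a b => ?_
    simp [Subtype.dist_eq]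
  have hrange : Set.range (fun y : (ℝ ∙ g)ᗮ => (y : Eu d) + x₀) = {x | A x = 0} := by
    ext x
    simp only [Set.mem_range, Set.mem_ofPred_eq]
    have h := hA x x₀
    rw [hx₀, sub_zero] at h
    constructor
    · rintro ⟨y, rfl⟩
      rw [h, add_sub_cancel_right]
      exact Submodule.mem_orthogonal_singleton_iff_inner_right.1 y.2
    · intro hx
      refine ⟨⟨x - x₀, Submodule.mem_orthogonal_singleton_iff_inner_right.2 (by rw [← h, hx])⟩, ?_⟩
      simp
  rw [← hrange, ← hiso.map_euclideanHausdorffMeasure, ← finrank_orthogonal_span_singleton_eq hg,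
    InnerProductSpace.euclideanHausdorffMeasure_eq_volume]

lemma exists_eq_zero_of_affine {A : Eu d → ℝ} {g : Eu d}
    (hA : ∀ x y, A x - A y = inner ℝ g (x - y)) (hg : g ≠ 0) : ∃ x₀, A x₀ = 0 := by
  refine ⟨-((A 0 / ‖g‖ ^ 2) • g), ?_⟩
  have h := hA (-((A 0 / ‖g‖ ^ 2) • g)) 0
  rw [sub_zero, inner_neg_right, inner_smul_right, real_inner_self_eq_norm_sq] at h
  have : ‖g‖ ^ 2 ≠ 0 := by positivity
  field_simp at h
  linarith

lemma sFinite_restrict_hyperplane {A : Eu d → ℝ} {g : Eu d}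
    (hA : ∀ x y, A x - A y = inner ℝ g (x - y)) (hg : g ≠ 0) :
    SFinite ((μHE[d - 1] : Measure (Eu d)).restrict {x | A x = 0}) := by
  obtain ⟨x₀, hx₀⟩ := exists_eq_zero_of_affine hA hg
  rw [← map_vadd_volume_eq_restrict_hyperplane hA hg hx₀]
  infer_instance

/-- The surface measure of the hyperplane `A = 0`, where `A` is affine with gradient `g`, divided by
`‖g‖`. With this normalization the Lebesgue measure is the product of the measure of the hyperplane
and of `dt` along every direction `v` with `⟪g, v⟫ = 1`. -/
noncomputable def conormalMeasure (A : Eu d → ℝ) (g : Eu d) : Measure (Eu d) :=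
  ENNReal.ofReal ‖g‖⁻¹ • (μHE[d - 1]).restrict {x | A x = 0}

lemma sFinite_conormalMeasure {A : Eu d → ℝ} {g : Eu d}
    (hA : ∀ x y, A x - A y = inner ℝ g (x - y)) (hg : g ≠ 0) :
    SFinite (conormalMeasure A g) := by
  have := sFinite_restrict_hyperplane hA hg
  unfold conormalMeasure
  infer_instance

lemma continuous_of_affine {A : Eu d → ℝ} {g : Eu d}
    (hA : ∀ x y, A x - A y = inner ℝ g (x - y)) : Continuous A := by
  have h : A = fun x => inner ℝ g (x - 0) + A 0 := by
    funext x
    rw [← hA]; ring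
  rw [h]
  fun_prop

/-- Fubini's theorem for the hyperplanes parallel to `A = 0`, along a direction `v` that need not be
orthogonal to them. -/
theorem map_conormalMeasure_prod_volume {A : Eu d → ℝ} {g v : Eu d}
    (hA : ∀ x y, A x - A y = inner ℝ g (x - y)) (hv : inner ℝ g v = 1) :
    ((conormalMeasure A g).prod volume).map (fun q : Eu d × ℝ => q.1 + q.2 • v) =
      (volume : Measure (Eu d)) := by
  have hg : g ≠ 0 := by
    rintro rfl
    simp at hv
  have := sFinite_conormalMeasure hA hg
  have := sFinite_restrict_hyperplane hA hg
  have hcont := continuous_of_affine hA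
  have hH : MeasurableSet {x | A x = 0} := (isClosed_eq hcont continuous_const).measurableSet
  have hg0 : ‖g‖ ≠ 0 := by simpa using hg
  obtain ⟨x₀, hx₀⟩ := exists_eq_zero_of_affine hA hg
  have hn0 : (‖g‖ ^ 2)⁻¹ • g ≠ 0 := by
    simp [hg]
  have hspan : (ℝ ∙ ((‖g‖ ^ 2)⁻¹ • g)) = ℝ ∙ g :=
    Submodule.span_singleton_smul_eq (IsUnit.mk0 _ (by positivity)) g
  have hnorm : ‖(‖g‖ ^ 2)⁻¹ • g‖ₑ = ENNReal.ofReal ‖g‖⁻¹ := by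
    rw [← ofReal_norm, norm_smul]
    congr 1
    simp
    field_simp
  ext t ht
  have hm : Measurable fun q : Eu d × ℝ => q.1 + q.2 • v := by fun_prop
  rw [Measure.map_apply hm ht, Measure.prod_apply_symm (hm ht), conormalMeasure,
    show (volume : Measure (Eu d)) t = μHE[Module.finrank ℝ (Eu d)] t by
      rw [InnerProductSpace.euclideanHausdorffMeasure_eq_volume],
    EuclideanGeometry.euclideanHausdorffMeasure_eq_lintegral x₀ hn0 ht, hnorm,
    ← lintegral_const_mul' _ _ ENNReal.ofReal_ne_top]
  refine lintegral_congr fun x => ?_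
  rw [Measure.smul_apply, smul_eq_mul, Measure.restrict_apply' hH, finrank_euclideanSpace,
    Fintype.card_fin]
  congr 1
  -- the hyperplane `A = x` is the translate by `x • v` of the hyperplane `A = 0`
  have hset : t ∩ (AffineSubspace.mk' (x • ((‖g‖ ^ 2)⁻¹ • g) +ᵥ x₀)
      (ℝ ∙ ((‖g‖ ^ 2)⁻¹ • g))ᗮ : Set (Eu d)) =
      (fun y => y + x • v) '' ((fun y => y + x • v) ⁻¹' t ∩ {y | A y = 0}) := by
    rw [hspan]
    have hmem : ∀ z : Eu d, z ∈ (AffineSubspace.mk' (x • ((‖g‖ ^ 2)⁻¹ • g) +ᵥ x₀)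
      (ℝ ∙ g)ᗮ : Set (Eu d)) ↔ A z = x := by
      intro z
      have h := hA z x₀
      rw [hx₀, sub_zero] at h
      rw [SetLike.mem_coe, AffineSubspace.mem_mk',
        Submodule.mem_orthogonal_singleton_iff_inner_right,
        vsub_eq_sub, vadd_eq_add, ← sub_sub, sub_right_comm, inner_sub_right, ← h, inner_smul_right,
        inner_smul_right, real_inner_self_eq_norm_sq, inv_mul_cancel₀ (by positivity), mul_one,
        sub_eq_zero]
    have hadd : ∀ y, A (y + x • v) = A y + x := by
      intro y
      have h := hA (y + x • v) y
      rw [add_sub_cancel_left, inner_smul_right, hv, mul_one] at h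
      linarith
    ext z
    simp only [Set.mem_inter_iff, hmem, Set.mem_image, Set.mem_preimage, Set.mem_ofPred_eq]
    constructor
    · rintro ⟨hz, hz'⟩
      refine ⟨z - x • v, ⟨by simpa using hz, ?_⟩, by simp⟩
      have := hadd (z - x • v)
      rw [sub_add_cancel, hz'] at this
      linarith
    · rintro ⟨y, ⟨hy, hy'⟩, rfl⟩
      exact ⟨hy, by rw [hadd, hy', zero_add]⟩
  have hiso : Isometry fun y : Eu d => y + x • v := isometry_add_right _
  rw [hset, hiso.euclideanHausdorffMeasure_image]
  rfl

end Slicing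

/-! ### Barycentric coordinates and faces of a simplex -/

section Simplices

variable {d : ℕ}

/-- The gradient of the barycentric coordinate of index `i`. -/
noncomputable def Simp.grad (b : Simp d) (i : Fin (d + 1)) : Eu d :=
  gradient (fun x => b.coord i x) 0

lemma Simp.coord_sub (b : Simp d) (i : Fin (d + 1)) (x y : Eu d) :
    b.coord i x - b.coord i y = inner ℝ (b.grad i) (x - y) := by
  let L : Eu d →L[ℝ] ℝ := LinearMap.toContinuousLinearMap (b.coord i).linear
  have hL : ∀ z, HasFDerivAt (fun x => b.coord i x) L z := by
    intro z
    have h : (fun x => b.coord i x) = fun x => L x + b.coord i 0 := by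
      funext x
      have := (b.coord i).map_vadd 0 x
      rw [vadd_eq_add, add_zero] at this
      exact this
    rw [h]
    exact L.hasFDerivAt.add_const _
  rw [Simp.grad, inner_gradient_left, (hL 0).fderiv]
  exact ((b.coord i).linearMap_vsub x y).symm

lemma Simp.inner_grad_vertex_sub (b : Simp d) (i j l : Fin (d + 1)) :
    inner ℝ (b.grad i) (b j - b l) = (if i = j then 1 else 0) - (if i = l then 1 else 0) := by
  rw [← b.coord_sub, b.coord_apply, b.coord_apply]

lemma Simp.inner_grad_vertex_sub_of_ne (b : Simp d) {i j : Fin (d + 1)} (h : i ≠ j) :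
    inner ℝ (b.grad i) (b i - b j) = 1 := by
  simp [b.inner_grad_vertex_sub, h]

lemma Simp.grad_ne_zero (hd : 1 ≤ d) (b : Simp d) (i : Fin (d + 1)) : b.grad i ≠ 0 := by
  have : Nontrivial (Fin (d + 1)) := Fin.nontrivial_iff_two_le.2 (by omega)
  obtain ⟨j, hj⟩ := exists_ne i
  intro h
  have := b.inner_grad_vertex_sub_of_ne hj.symm
  simp [h] at this

lemma Simp.sum_grad_inner (b : Simp d) (w : Eu d) : ∑ i, inner ℝ (b.grad i) w = 0 := by
  have h : ∀ i, inner ℝ (b.grad i) w = b.coord i w - b.coord i 0 := by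
    intro i
    rw [b.coord_sub, sub_zero]
  simp only [h, Finset.sum_sub_distrib, b.sum_coord_apply_eq_one, sub_self]

lemma Simp.norm_normal (hd : 1 ≤ d) (b : Simp d) (i : Fin (d + 1)) : ‖b.normal i‖ = 1 := by
  have h := b.grad_ne_zero hd i
  have h' : ‖b.grad i‖ ≠ 0 := by simpa using h
  change ‖-(‖b.grad i‖⁻¹ • b.grad i)‖ = 1
  rw [norm_neg, norm_smul, norm_inv, norm_norm, inv_mul_cancel₀ h']

lemma Simp.continuous_coord (b : Simp d) (i : Fin (d + 1)) : Continuous fun x => b.coord i x :=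
  continuous_of_affine (b.coord_sub i)

lemma Simp.coord_add_smul_edge (b : Simp d) (l i j : Fin (d + 1)) (y : Eu d) (t : ℝ) :
    b.coord l (y + t • (b i - b j)) =
      b.coord l y + t * ((if l = i then 1 else 0) - (if l = j then 1 else 0)) := by
  have h := b.coord_sub l (y + t • (b i - b j)) y
  rw [add_sub_cancel_left, inner_smul_right, b.inner_grad_vertex_sub] at h
  linarith

lemma Simp.mem_carrier_iff (b : Simp d) {x : Eu d} : x ∈ b.carrier ↔ ∀ i, 0 ≤ b.coord i x := by
  rw [Simp.carrier, b.convexHull_eq_nonneg_coord]; rfl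

lemma Simp.mem_interior_iff (b : Simp d) {x : Eu d} :
    x ∈ interior b.carrier ↔ ∀ i, 0 < b.coord i x := by
  rw [Simp.carrier, b.interior_convexHull]; rfl

lemma Simp.mem_face_iff (b : Simp d) (i : Fin (d + 1)) {x : Eu d} :
    x ∈ b.face i ↔ x ∈ b.carrier ∧ b.coord i x = 0 := by
  constructor
  · intro hx
    refine ⟨convexHull_mono (Set.image_subset_range _ _) hx, ?_⟩
    have hsub : b.face i ⊆ {x | b.coord i x = 0} := by
      refine convexHull_min ?_ ?_
      · rintro _ ⟨j, hj, rfl⟩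
        exact b.coord_apply_ne fun h => hj h.symm
      · exact (convex_singleton (0 : ℝ)).affine_preimage (b.coord i)
    exact hsub hx
  · rintro ⟨hx, hi⟩
    rw [b.mem_carrier_iff] at hx
    have hsum := b.sum_coord_apply_eq_one x
    rw [← Finset.add_sum_erase _ _ (Finset.mem_univ i), hi, zero_add] at hsum
    have hx' := b.linear_combination_coord_eq_self x
    rw [← Finset.add_sum_erase _ _ (Finset.mem_univ i), hi, zero_smul, zero_add] at hx'
    rw [← hx']
    refine (convex_convexHull ℝ _).sum_mem (fun j _ => hx j) hsum fun j hj => ?_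
    exact subset_convexHull ℝ _ ⟨j, Finset.ne_of_mem_erase hj, rfl⟩

lemma Simp.face_subset_carrier (b : Simp d) (i : Fin (d + 1)) : b.face i ⊆ b.carrier :=
  fun _ hx => ((b.mem_face_iff i).1 hx).1

lemma Simp.convex_carrier (b : Simp d) : Convex ℝ b.carrier := convex_convexHull ℝ _

lemma Simp.isCompact_carrier (b : Simp d) : IsCompact b.carrier :=
  (Set.finite_range b).isCompact_convexHull ℝ

lemma Simp.isCompact_face (b : Simp d) (i : Fin (d + 1)) : IsCompact (b.face i) :=
  ((Set.finite_range b).subset (Set.image_subset_range _ _)).isCompact_convexHull ℝ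

lemma Simp.vertex_mem_carrier (b : Simp d) (i : Fin (d + 1)) : b i ∈ b.carrier :=
  subset_convexHull ℝ _ (Set.mem_range_self i)

lemma Simp.dist_le_diam (b : Simp d) {x y : Eu d} (hx : x ∈ b.carrier) (hy : y ∈ b.carrier) :
    dist x y ≤ Metric.diam b.carrier :=
  Metric.dist_le_diam_of_mem b.isCompact_carrier.isBounded hx hy

lemma Simp.diam_pos (hd : 1 ≤ d) (b : Simp d) : 0 < Metric.diam b.carrier := by
  have : Nontrivial (Fin (d + 1)) := Fin.nontrivial_iff_two_le.2 (by omega)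
  obtain ⟨i, j, hij⟩ := exists_pair_ne (Fin (d + 1))
  exact (dist_pos.2 (b.ind.injective.ne hij)).trans_le
    (b.dist_le_diam (b.vertex_mem_carrier i) (b.vertex_mem_carrier j))

lemma Simp.nonempty_interior_carrier (b : Simp d) : (interior b.carrier).Nonempty :=
  ⟨_, b.centroid_mem_interior_convexHull⟩

lemma Simp.closure_interior_carrier (b : Simp d) : closure (interior b.carrier) = b.carrier := by
  rw [b.convex_carrier.closure_interior_eq_closure_of_nonempty_interior
    b.nonempty_interior_carrier, b.isCompact_carrier.isClosed.closure_eq]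

lemma Simp.measurableSet_face (b : Simp d) (i : Fin (d + 1)) : MeasurableSet (b.face i) :=
  (b.isCompact_face i).isClosed.measurableSet

lemma Simp.measurableSet_carrier (b : Simp d) : MeasurableSet b.carrier :=
  b.isCompact_carrier.isClosed.measurableSet

/-- The surface measure on the hyperplane of the face `i`, normalized by the length of the gradient
of the barycentric coordinate. -/
noncomputable def Simp.faceMeasure (b : Simp d) (i : Fin (d + 1)) : Measure (Eu d) :=
  conormalMeasure (fun x => b.coord i x) (b.grad i)

lemma Simp.sFinite_faceMeasure (hd : 1 ≤ d) (b : Simp d) (i : Fin (d + 1)) :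
    SFinite (b.faceMeasure i) :=
  sFinite_conormalMeasure (b.coord_sub i) (b.grad_ne_zero hd i)

lemma Simp.measurePreserving_slice (b : Simp d) {i : Fin (d + 1)} {v : Eu d}
    (hv : inner ℝ (b.grad i) v = 1) :
    MeasurePreserving (fun q : Eu d × ℝ => q.1 + q.2 • v)
      ((b.faceMeasure i).prod volume) volume :=
  ⟨by fun_prop, map_conormalMeasure_prod_volume (b.coord_sub i) hv⟩

lemma Simp.ae_faceMeasure (b : Simp d) (i : Fin (d + 1)) :
    ∀ᵐ y ∂b.faceMeasure i, b.coord i y = 0 := by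
  refine Measure.ae_smul_measure ?_ _
  exact ae_restrict_mem (isClosed_eq (b.continuous_coord i) continuous_const).measurableSet

/-- The surface measure bounds below the volume swept by translation along `v`. -/
lemma Simp.faceMeasure_mul_le (hd : 1 ≤ d) (b : Simp d) {i : Fin (d + 1)} {v : Eu d}
    (hv : inner ℝ (b.grad i) v = 1) {S X : Set (Eu d)} {τ : ℝ}
    (hX : MeasurableSet X) (hSX : ∀ y ∈ S, ∀ t ∈ Set.Icc 0 τ, y + t • v ∈ X) :
    b.faceMeasure i S * ENNReal.ofReal τ ≤ volume X := by
  have := b.sFinite_faceMeasure hd i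
  rw [← (b.measurePreserving_slice hv).measure_preimage hX.nullMeasurableSet]
  have h : S ×ˢ Set.Icc 0 τ ⊆ (fun q : Eu d × ℝ => q.1 + q.2 • v) ⁻¹' X :=
    fun q hq => hSX q.1 hq.1 q.2 hq.2
  have h2 := measure_mono (μ := (b.faceMeasure i).prod volume) h
  rw [Measure.prod_prod, Real.volume_Icc, sub_zero] at h2
  exact h2

lemma Simp.faceMeasure_lt_top (hd : 1 ≤ d) (b : Simp d) (i : Fin (d + 1)) {S : Set (Eu d)}
    (hS : Bornology.IsBounded S) : b.faceMeasure i S < ⊤ := by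
  have : Nontrivial (Fin (d + 1)) := Fin.nontrivial_iff_two_le.2 (by omega)
  obtain ⟨j, hj⟩ := exists_ne i
  obtain ⟨r, hr⟩ := hS.subset_closedBall 0
  have h := b.faceMeasure_mul_le hd (b.inner_grad_vertex_sub_of_ne hj.symm) (S := S) (τ := 1)
    (X := Metric.closedBall 0 (r + ‖b i - b j‖)) Metric.isClosed_closedBall.measurableSet ?_
  · rw [ENNReal.ofReal_one, mul_one] at h
    exact h.trans_lt measure_closedBall_lt_top
  · intro y hy t ht
    have hy' := hr hy
    rw [mem_closedBall_zero_iff] at hy' ⊢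
    refine (norm_add_le _ _).trans (add_le_add hy' ?_)
    rw [norm_smul, Real.norm_of_nonneg ht.1]
    exact mul_le_of_le_one_left (norm_nonneg _) ht.2

/-- Two faces of a simplex correspond to each other by projection along their common edge
direction, and this projection carries one normalized surface measure to the other. -/
lemma Simp.measurePreserving_project (hd : 1 ≤ d) (b : Simp d) {i j : Fin (d + 1)} (hij : i ≠ j) :
    MeasurePreserving (fun y => y + b.coord j y • (b i - b j))
      (b.faceMeasure i) (b.faceMeasure j) := by
  have := b.sFinite_faceMeasure hd i
  have := b.sFinite_faceMeasure hd j
  have hci := b.continuous_coord i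
  have hcj := b.continuous_coord j
  have hcont : Continuous fun y => y + b.coord j y • (b i - b j) := by fun_prop
  refine ⟨hcont.measurable, ?_⟩
  ext S hS
  rw [Measure.map_apply hcont.measurable hS]
  -- both sides are the volume of the part of the cylinder over `S` where `0 ≤ λᵢ ≤ 1`
  set X : Set (Eu d) := (fun y => y + b.coord j y • (b i - b j)) ⁻¹' S ∩
    (fun x => b.coord i x) ⁻¹' Set.Icc 0 1 with hXdef
  have hX : MeasurableSet X :=
    (hcont.measurable hS).inter (hci.measurable measurableSet_Icc)
  have hvi : inner ℝ (b.grad i) (b i - b j) = 1 := b.inner_grad_vertex_sub_of_ne hij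
  have hvj : inner ℝ (b.grad j) (b j - b i) = 1 := b.inner_grad_vertex_sub_of_ne hij.symm
  have h1 := (b.measurePreserving_slice hvi).measure_preimage hX.nullMeasurableSet
  have h2 := (b.measurePreserving_slice hvj).measure_preimage hX.nullMeasurableSet
  have hm : ∀ v : Eu d, MeasurableSet ((fun q : Eu d × ℝ => q.1 + q.2 • v) ⁻¹' X) := fun v =>
    (show Measurable fun q : Eu d × ℝ => q.1 + q.2 • v by fun_prop) hX
  rw [Measure.prod_apply (hm _)] at h1 h2
  have e1 : ∫⁻ y, volume (Prod.mk y ⁻¹' ((fun q : Eu d × ℝ => q.1 + q.2 • (b i - b j)) ⁻¹' X))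
      ∂b.faceMeasure i = b.faceMeasure i ((fun y => y + b.coord j y • (b i - b j)) ⁻¹' S) := by
    rw [← lintegral_indicator_one (hcont.measurable hS)]
    refine lintegral_congr_ae ?_
    filter_upwards [b.ae_faceMeasure i] with y hy
    have hp : ∀ t : ℝ, y + t • (b i - b j) + b.coord j (y + t • (b i - b j)) • (b i - b j) =
        y + b.coord j y • (b i - b j) := by
      intro t
      rw [b.coord_add_smul_edge]
      simp only [hij.symm, if_false, if_true]
      module
    have hq : ∀ t : ℝ, b.coord i (y + t • (b i - b j)) = t := by
      intro t
      rw [b.coord_add_smul_edge, hy]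
      simp [hij]
    by_cases hyS : y + b.coord j y • (b i - b j) ∈ S
    · have : Prod.mk y ⁻¹' ((fun q : Eu d × ℝ => q.1 + q.2 • (b i - b j)) ⁻¹' X) =
          Set.Icc 0 1 := by
        ext t
        simp only [hXdef, Set.mem_preimage, Set.mem_inter_iff, hp, hq, hyS, true_and]
      rw [this]
      simp [Set.indicator_of_mem, hyS]
    · have : Prod.mk y ⁻¹' ((fun q : Eu d × ℝ => q.1 + q.2 • (b i - b j)) ⁻¹' X) = ∅ := by
        ext t
        simp only [hXdef, Set.mem_preimage, Set.mem_inter_iff, hp, hyS, false_and,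
          Set.mem_empty_iff_false]
      rw [this]
      simp [hyS]
  have e2 : ∫⁻ y, volume (Prod.mk y ⁻¹' ((fun q : Eu d × ℝ => q.1 + q.2 • (b j - b i)) ⁻¹' X))
      ∂b.faceMeasure j = b.faceMeasure j S := by
    rw [← lintegral_indicator_one hS]
    refine lintegral_congr_ae ?_
    filter_upwards [b.ae_faceMeasure j] with y hy
    have hp : ∀ t : ℝ, y + t • (b j - b i) + b.coord j (y + t • (b j - b i)) • (b i - b j) =
        y := by
      intro t
      rw [b.coord_add_smul_edge, hy]
      simp only [hij.symm, if_false, if_true]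
      module
    have hq : ∀ t : ℝ, b.coord i (y + t • (b j - b i)) = b.coord i y - t := by
      intro t
      rw [b.coord_add_smul_edge]
      simp [hij, sub_eq_add_neg]
    by_cases hyS : y ∈ S
    · have : Prod.mk y ⁻¹' ((fun q : Eu d × ℝ => q.1 + q.2 • (b j - b i)) ⁻¹' X) =
          Set.Icc (b.coord i y - 1) (b.coord i y) := by
        ext t
        simp only [hXdef, Set.mem_preimage, Set.mem_inter_iff, hp, hq, hyS, true_and, Set.mem_Icc]
        constructor <;> rintro ⟨h, h'⟩ <;> constructor <;> linarith
      rw [this]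
      simp [Set.indicator_of_mem, hyS]
    · have : Prod.mk y ⁻¹' ((fun q : Eu d × ℝ => q.1 + q.2 • (b j - b i)) ⁻¹' X) = ∅ := by
        ext t
        simp only [hXdef, Set.mem_preimage, Set.mem_inter_iff, hp, hyS, false_and,
          Set.mem_empty_iff_false]
      rw [this]
      simp [hyS]
  rw [← e1, ← e2, h1, h2]

end Simplices

/-! ### The divergence theorem on a simplex -/

section Divergence

variable {d : ℕ}

lemma Simp.integrableOn_face (hd : 1 ≤ d) (b : Simp d) (i : Fin (d + 1)) {ψ : Eu d → ℝ}
    (hψ : ContinuousOn ψ (b.face i)) : IntegrableOn ψ (b.face i) (b.faceMeasure i) := by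
  have : IsFiniteMeasure ((b.faceMeasure i).restrict (b.face i)) :=
    ⟨by
      rw [Measure.restrict_apply_univ]
      exact b.faceMeasure_lt_top hd i (b.isCompact_face i).isBounded⟩
  obtain ⟨C, hC⟩ := (b.isCompact_face i).exists_bound_of_continuousOn hψ
  refine Integrable.of_bound (hψ.aestronglyMeasurable (b.measurableSet_face i)) C ?_
  filter_upwards [ae_restrict_mem (b.measurableSet_face i)] with x hx using hC x hx

lemma Simp.add_smul_edge_mem_carrier_iff (b : Simp d) {i j : Fin (d + 1)} (hij : i ≠ j)
    {y : Eu d} (hy : b.coord i y = 0) (t : ℝ) :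
    y + t • (b i - b j) ∈ b.carrier ↔ y ∈ b.face i ∧ t ∈ Set.Icc 0 (b.coord j y) := by
  rw [b.mem_face_iff, b.mem_carrier_iff, b.mem_carrier_iff]
  have hl : ∀ l, b.coord l (y + t • (b i - b j)) = _ := fun l => b.coord_add_smul_edge l i j y t
  constructor
  · intro h
    have hi := h i
    have hj := h j
    rw [hl] at hi hj
    simp only [hij, hij.symm, if_true, if_false, hy] at hi hj
    have ht : 0 ≤ t := by linarith
    refine ⟨⟨fun l => ?_, hy⟩, ht, by linarith⟩
    by_cases hli : l = i
    · rw [hli, hy]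
    by_cases hlj : l = j
    · rw [hlj]; linarith
    · have := h l
      rw [hl] at this
      simpa [hli, hlj] using this
  · rintro ⟨⟨h, -⟩, ht0, ht1⟩ l
    rw [hl]
    by_cases hli : l = i
    · subst hli
      simp [hij, hy, ht0]
    by_cases hlj : l = j
    · subst hlj
      simp only [hli, if_true, if_false]
      linarith
    · simpa [hli, hlj] using h l

/-- The fundamental theorem of calculus along the edge from `j` to `i`, integrated over the
simplex. -/
theorem Simp.integral_fderiv_edge (hd : 1 ≤ d) (b : Simp d) {i j : Fin (d + 1)} (hij : i ≠ j)
    {O : Set (Eu d)} (hO : IsOpen O) (hbO : b.carrier ⊆ O) {ψ : Eu d → ℝ}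
    (hψ : ContDiffOn ℝ 1 ψ O) :
    ∫ x in b.carrier, fderiv ℝ ψ x (b i - b j) =
      (∫ y in b.face j, ψ y ∂b.faceMeasure j) - ∫ y in b.face i, ψ y ∂b.faceMeasure i := by
  have := b.sFinite_faceMeasure hd i
  set v : Eu d := b i - b j with hv
  have hvi : inner ℝ (b.grad i) v = 1 := b.inner_grad_vertex_sub_of_ne hij
  have hcont : ContinuousOn (fun x => fderiv ℝ ψ x v) O :=
    (hψ.continuousOn_fderiv_of_isOpen hO le_rfl).clm_apply continuousOn_const
  have hint : IntegrableOn (fun x => fderiv ℝ ψ x v) b.carrier :=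
    (hcont.mono hbO).integrableOn_compact b.isCompact_carrier
  have hint' : Integrable (b.carrier.indicator fun x => fderiv ℝ ψ x v) :=
    hint.integrable_indicator b.measurableSet_carrier
  have hmp := b.measurePreserving_slice hvi
  have hproj := b.measurePreserving_project hd hij
  have hψO : ContinuousOn ψ O := hψ.continuousOn
  -- along the line through a point of the hyperplane of the face `i`
  have hline : ∀ y, b.coord i y = 0 →
      ∫ t : ℝ, b.carrier.indicator (fun x => fderiv ℝ ψ x v) (y + t • v) =
        (b.face i).indicator (fun y => ψ (y + b.coord j y • v) - ψ y) y := by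
    intro y hy
    have hmem := b.add_smul_edge_mem_carrier_iff hij hy
    by_cases hyf : y ∈ b.face i
    · rw [Set.indicator_of_mem hyf]
      have hle : 0 ≤ b.coord j y := (b.mem_carrier_iff.1 ((b.mem_face_iff i).1 hyf).1) j
      have hind : (fun t : ℝ => b.carrier.indicator (fun x => fderiv ℝ ψ x v) (y + t • v)) =
          (Set.Icc 0 (b.coord j y)).indicator fun t => fderiv ℝ ψ (y + t • v) v := by
        funext t
        by_cases ht : t ∈ Set.Icc 0 (b.coord j y)
        · rw [Set.indicator_of_mem ht, Set.indicator_of_mem ((hmem t).2 ⟨hyf, ht⟩)]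
        · rw [Set.indicator_of_notMem ht, Set.indicator_of_notMem fun h => ht ((hmem t).1 h).2]
      rw [hind, integral_indicator measurableSet_Icc, integral_Icc_eq_integral_Ioc,
        ← intervalIntegral.integral_of_le hle]
      have hder : ∀ t ∈ Set.uIcc 0 (b.coord j y),
          HasDerivAt (fun t : ℝ => ψ (y + t • v)) (fderiv ℝ ψ (y + t • v) v) t := by
        intro t ht
        rw [Set.uIcc_of_le hle] at ht
        have hO' : y + t • v ∈ O := hbO ((hmem t).2 ⟨hyf, ht⟩)
        have h1 : HasFDerivAt ψ (fderiv ℝ ψ (y + t • v)) (y + t • v) :=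
          ((hψ.contDiffAt (hO.mem_nhds hO')).differentiableAt (by simp)).hasFDerivAt
        have h2 : HasDerivAt (fun t : ℝ => y + t • v) v t := by
          simpa using ((hasDerivAt_id t).smul_const v).const_add y
        exact h1.comp_hasDerivAt t h2
      have hci : ContinuousOn (fun t : ℝ => fderiv ℝ ψ (y + t • v) v)
          (Set.uIcc 0 (b.coord j y)) := by
        refine hcont.comp (by fun_prop) fun t ht => ?_
        rw [Set.uIcc_of_le hle] at ht
        exact hbO ((hmem t).2 ⟨hyf, ht⟩)
      rw [intervalIntegral.integral_eq_sub_of_hasDerivAt hder hci.intervalIntegrable]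
      simp
    · rw [Set.indicator_of_notMem hyf]
      have hz : (fun t : ℝ => b.carrier.indicator (fun x => fderiv ℝ ψ x v) (y + t • v)) = 0 := by
        funext t
        exact Set.indicator_of_notMem (fun h => hyf ((hmem t).1 h).1) _
      rw [hz]
      simp
  -- the projection exchanges the two faces
  have hface : ∀ y, b.coord i y = 0 →
      (y + b.coord j y • v ∈ b.face j ↔ y ∈ b.face i) := by
    intro y hy
    rw [b.mem_face_iff, b.mem_face_iff, b.mem_carrier_iff, b.mem_carrier_iff]
    have hl : ∀ l, b.coord l (y + b.coord j y • v) = _ :=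
      fun l => b.coord_add_smul_edge l i j y (b.coord j y)
    constructor
    · rintro ⟨h, -⟩
      refine ⟨fun l => ?_, hy⟩
      by_cases hli : l = i
      · rw [hli, hy]
      by_cases hlj : l = j
      · have := h i
        rw [hl] at this
        simp only [hij, hy, if_true, if_false] at this
        rw [hlj]; linarith
      · have := h l
        rw [hl] at this
        simpa [hli, hlj] using this
    · rintro ⟨h, -⟩
      refine ⟨fun l => ?_, ?_⟩
      · rw [hl]
        by_cases hli : l = i
        · subst hli
          simpa [hij, hy] using h j
        by_cases hlj : l = j
        · subst hlj
          simp [hli]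
        · simpa [hli, hlj] using h l
      · rw [hl]
        simp [hij.symm]
  have hψj := b.integrableOn_face hd j (hψO.mono ((b.face_subset_carrier j).trans hbO))
  have hψi := b.integrableOn_face hd i (hψO.mono ((b.face_subset_carrier i).trans hbO))
  have hψj' : Integrable ((b.face j).indicator ψ) (b.faceMeasure j) :=
    hψj.integrable_indicator (b.measurableSet_face j)
  have hψi' : Integrable ((b.face i).indicator ψ) (b.faceMeasure i) :=
    hψi.integrable_indicator (b.measurableSet_face i)
  have hcompint := hproj.integrable_comp_of_integrable hψj'
  calc ∫ x in b.carrier, fderiv ℝ ψ x v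
      = ∫ x, b.carrier.indicator (fun x => fderiv ℝ ψ x v) x :=
        (integral_indicator b.measurableSet_carrier).symm
    _ = ∫ q : Eu d × ℝ, b.carrier.indicator (fun x => fderiv ℝ ψ x v) (q.1 + q.2 • v)
          ∂(b.faceMeasure i).prod volume := by
        conv_lhs => rw [← hmp.map_eq]
        refine integral_map hmp.measurable.aemeasurable ?_
        rw [hmp.map_eq]
        exact hint'.aestronglyMeasurable
    _ = ∫ y, (∫ t : ℝ, b.carrier.indicator (fun x => fderiv ℝ ψ x v) (y + t • v))
          ∂b.faceMeasure i :=
        integral_prod _ (hmp.integrable_comp_of_integrable hint')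
    _ = ∫ y, ((b.face j).indicator ψ (y + b.coord j y • v) - (b.face i).indicator ψ y)
          ∂b.faceMeasure i := by
        refine integral_congr_ae ?_
        filter_upwards [b.ae_faceMeasure i] with y hy
        rw [hline y hy]
        by_cases hyf : y ∈ b.face i
        · rw [Set.indicator_of_mem hyf, Set.indicator_of_mem hyf,
            Set.indicator_of_mem ((hface y hy).2 hyf)]
        · rw [Set.indicator_of_notMem hyf, Set.indicator_of_notMem hyf,
            Set.indicator_of_notMem fun h => hyf ((hface y hy).1 h), sub_zero]
    _ = (∫ y, (b.face j).indicator ψ (y + b.coord j y • v) ∂b.faceMeasure i) -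
          ∫ y, (b.face i).indicator ψ y ∂b.faceMeasure i :=
        integral_sub hcompint hψi'
    _ = _ := by
        rw [integral_indicator (b.measurableSet_face i),
          ← integral_indicator (b.measurableSet_face j)]
        congr 1
        conv_rhs => rw [← hproj.map_eq]
        refine (integral_map hproj.measurable.aemeasurable ?_).symm
        rw [hproj.map_eq]
        exact hψj'.aestronglyMeasurable

/-- The divergence theorem on a simplex, for a field of vanishing divergence. -/
theorem Simp.sum_integral_face_eq_zero (hd : 1 ≤ d) (b : Simp d) {O : Set (Eu d)} (hO : IsOpen O)
    (hbO : b.carrier ⊆ O) {q : Fin d → Eu d → ℝ} (hq : ∀ j, ContDiffOn ℝ 1 (q j) O)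
    (hdiv : ∀ x ∈ b.carrier, ∑ j, fderiv ℝ (q j) x (EuclideanSpace.single j 1) = 0) :
    ∑ i, ∑ j, b.normal i j * ∫ y in b.face i, q j y ∂μHE[d - 1] = 0 := by
  -- the component of the field along the gradient of each barycentric coordinate
  set ψ : Fin (d + 1) → Eu d → ℝ := fun i x => ∑ j, b.grad i j * q j x with hψdef
  have hψ : ∀ i, ContDiffOn ℝ 1 (ψ i) O := fun i =>
    ContDiffOn.sum fun j _ => contDiffOn_const.mul (hq j)
  have hface : ∀ i, ∑ j, b.normal i j * ∫ y in b.face i, q j y ∂μHE[d - 1] =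
      -∫ y in b.face i, ψ i y ∂b.faceMeasure i := by
    intro i
    have hr : (b.faceMeasure i).restrict (b.face i) =
        ENNReal.ofReal ‖b.grad i‖⁻¹ • (μHE[d - 1]).restrict (b.face i) := by
      rw [Simp.faceMeasure, conormalMeasure, Measure.restrict_smul,
        Measure.restrict_restrict (b.measurableSet_face i)]
      congr 2
      exact Set.inter_eq_left.2 fun y hy => ((b.mem_face_iff i).1 hy).2
    have hint : ∀ j, Integrable (fun y => b.grad i j * q j y)
        ((b.faceMeasure i).restrict (b.face i)) := fun j =>
      (b.integrableOn_face hd i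
        ((hq j).continuousOn.mono ((b.face_subset_carrier i).trans hbO))).const_mul _
    rw [hψdef]
    simp only
    rw [integral_finsetSum _ fun j _ => hint j, hr, ← Finset.sum_neg_distrib]
    refine Finset.sum_congr rfl fun j _ => ?_
    rw [integral_smul_measure, integral_const_mul, ENNReal.toReal_ofReal (by positivity)]
    change (-(‖b.grad i‖⁻¹ • b.grad i)).ofLp j * _ = _
    simp only [PiLp.neg_apply, PiLp.smul_apply, smul_eq_mul]
    ring
  simp only [hface, Finset.sum_neg_distrib, neg_eq_zero]
  have hdiff : ∀ j, ∀ x ∈ b.carrier, DifferentiableAt ℝ (q j) x := fun j x hx =>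
    ((hq j).contDiffAt (hO.mem_nhds (hbO hx))).differentiableAt (by simp)
  -- the divergence is the sum of the derivatives of the components along the edges
  have hedge : ∀ x ∈ b.carrier, ∑ i, fderiv ℝ (ψ i) x (b i - b 0) = 0 := by
    intro x hx
    have hf : ∀ i w, fderiv ℝ (ψ i) x w = ∑ j, b.grad i j * fderiv ℝ (q j) x w := by
      intro i w
      have : HasFDerivAt (ψ i) (∑ j, b.grad i j • fderiv ℝ (q j) x) x :=
        HasFDerivAt.fun_sum fun j _ => (hdiff j x hx).hasFDerivAt.const_mul _
      rw [this.fderiv]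
      simp
    simp only [hf]
    rw [Finset.sum_comm, ← hdiv x hx]
    refine Finset.sum_congr rfl fun j _ => ?_
    have hw : ∑ i, b.grad i j • (b i - b 0) = EuclideanSpace.single j (1 : ℝ) := by
      have hgj : ∀ i, b.grad i j = b.coord i (EuclideanSpace.single j 1) - b.coord i 0 := by
        intro i
        rw [b.coord_sub, sub_zero, EuclideanSpace.inner_single_right]
        simp
      have hs : ∑ i, b.grad i j = 0 := by
        simp only [hgj, Finset.sum_sub_distrib, b.sum_coord_apply_eq_one, sub_self]
      simp only [smul_sub, Finset.sum_sub_distrib]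
      rw [← Finset.sum_smul, hs, zero_smul, sub_zero]
      simp only [hgj, sub_smul, Finset.sum_sub_distrib, b.linear_combination_coord_eq_self,
        sub_zero]
    rw [← hw, map_sum]
    refine Finset.sum_congr rfl fun i _ => ?_
    rw [map_smul, smul_eq_mul]
  have hzero : ∑ i, ∫ x in b.carrier, fderiv ℝ (ψ i) x (b i - b 0) = 0 := by
    rw [← integral_finsetSum]
    · rw [setIntegral_congr_fun b.measurableSet_carrier hedge]
      simp
    · intro i _
      refine ContinuousOn.integrableOn_compact b.isCompact_carrier ?_
      exact ((((hψ i).continuousOn_fderiv_of_isOpen hO le_rfl).clm_apply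
        continuousOn_const).mono hbO)
  have hψ0 : ∀ i, ∫ x in b.carrier, fderiv ℝ (ψ i) x (b i - b 0) =
      (∫ y in b.face 0, ψ i y ∂b.faceMeasure 0) - ∫ y in b.face i, ψ i y ∂b.faceMeasure i := by
    intro i
    by_cases hi : i = 0
    · subst hi
      simp
    · exact b.integral_fderiv_edge hd hi hO hbO (hψ i)
  simp only [hψ0, Finset.sum_sub_distrib] at hzero
  have hsum0 : ∑ i, ∫ y in b.face 0, ψ i y ∂b.faceMeasure 0 = 0 := by
    rw [← integral_finsetSum]
    · have : ∀ y, ∑ i, ψ i y = 0 := by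
        intro y
        have hs := b.sum_grad_inner (WithLp.toLp 2 fun j => q j y)
        rw [← hs]
        refine Finset.sum_congr rfl fun i _ => ?_
        simp [hψdef, PiLp.inner_apply, mul_comm]
      simp [this]
    · intro i _
      exact b.integrableOn_face hd 0
        ((hψ i).continuousOn.mono ((b.face_subset_carrier 0).trans hbO))
  linarith

end Divergence

/-! ### Areas of faces and volumes of simplices -/

section Sizes

variable {d : ℕ}

lemma Simp.faceMeasure_apply (b : Simp d) (i : Fin (d + 1)) {S : Set (Eu d)}
    (hS : S ⊆ b.face i) : b.faceMeasure i S = ENNReal.ofReal ‖b.grad i‖⁻¹ * μHE[d - 1] S := by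
  rw [Simp.faceMeasure, conormalMeasure, Measure.smul_apply, smul_eq_mul,
    Measure.restrict_eq_self]
  exact fun y hy => ((b.mem_face_iff i).1 (hS hy)).2

lemma Simp.area_face_lt_top (hd : 1 ≤ d) (b : Simp d) (i : Fin (d + 1)) :
    μHE[d - 1] (b.face i) < ⊤ := by
  have h := b.faceMeasure_lt_top hd i (b.isCompact_face i).isBounded
  rw [b.faceMeasure_apply i subset_rfl] at h
  have hg : 0 < ‖b.grad i‖ := norm_pos_iff.2 (b.grad_ne_zero hd i)
  exact ENNReal.lt_top_of_mul_ne_top_right h.ne (by simp [hg])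

lemma Simp.toReal_faceMeasure_face (b : Simp d) (i : Fin (d + 1)) :
    (b.faceMeasure i).real (b.face i) = ‖b.grad i‖⁻¹ * (μHE[d - 1]).real (b.face i) := by
  rw [measureReal_def, b.faceMeasure_apply i subset_rfl, ENNReal.toReal_mul,
    ENNReal.toReal_ofReal (by positivity), measureReal_def]

/-- The volume of the unit ball of `ℝ^d`. -/
noncomputable def unitBallVolume (d : ℕ) : ℝ :=
  (volume : Measure (Eu d)).real (Metric.ball 0 1)

lemma unitBallVolume_pos (d : ℕ) : 0 < unitBallVolume d :=
  ENNReal.toReal_pos (Metric.measure_ball_pos _ _ one_pos).ne' measure_ball_lt_top.ne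

lemma volume_real_closedBall (x : Eu d) {r : ℝ} (hr : 0 ≤ r) :
    (volume : Measure (Eu d)).real (Metric.closedBall x r) = r ^ d * unitBallVolume d := by
  rw [measureReal_def, Measure.addHaar_closedBall _ _ hr, ENNReal.toReal_mul,
    ENNReal.toReal_ofReal (by positivity), finrank_euclideanSpace, Fintype.card_fin]
  rfl

/-- The cylinder of height `h` over a face lies in a ball of radius `2 h`. -/
lemma Simp.area_face_le (hd : 1 ≤ d) (b : Simp d) (i : Fin (d + 1)) :
    (μHE[d - 1]).real (b.face i) ≤
      2 ^ d * unitBallVolume d * Metric.diam b.carrier ^ (d - 1) := by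
  have hh : 0 < Metric.diam b.carrier := b.diam_pos hd
  set h := Metric.diam b.carrier with hdef
  have hg : 0 < ‖b.grad i‖ := norm_pos_iff.2 (b.grad_ne_zero hd i)
  have hv : inner ℝ (b.grad i) ((‖b.grad i‖ ^ 2)⁻¹ • b.grad i) = 1 := by
    rw [inner_smul_right, real_inner_self_eq_norm_sq, inv_mul_cancel₀ (by positivity)]
  have hle := b.faceMeasure_mul_le hd hv (S := b.face i) (τ := h * ‖b.grad i‖)
    (X := Metric.closedBall (b 0) (2 * h)) Metric.isClosed_closedBall.measurableSet ?_
  · have hle' := ENNReal.toReal_mono measure_closedBall_lt_top.ne hle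
    rw [ENNReal.toReal_mul, ENNReal.toReal_ofReal (by positivity), ← measureReal_def,
      ← measureReal_def, b.toReal_faceMeasure_face, volume_real_closedBall _ (by positivity),
      mul_pow] at hle'
    have hp : h ^ d = h ^ (d - 1) * h := by
      rw [← pow_succ, Nat.sub_add_cancel hd]
    rw [hp] at hle'
    have : ‖b.grad i‖⁻¹ * (μHE[d - 1]).real (b.face i) * (h * ‖b.grad i‖) =
        (μHE[d - 1]).real (b.face i) * h := by
      field_simp
    rw [this] at hle'
    refine le_of_mul_le_mul_right (hle'.trans_eq ?_) hh
    ring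
  · intro y hy t ht
    have hy' := b.dist_le_diam (b.face_subset_carrier i hy) (b.vertex_mem_carrier 0)
    rw [Metric.mem_closedBall, dist_eq_norm]
    rw [dist_eq_norm] at hy'
    have ht' : ‖t • ((‖b.grad i‖ ^ 2)⁻¹ • b.grad i)‖ ≤ h := by
      rw [norm_smul, norm_smul, Real.norm_of_nonneg ht.1, norm_inv, norm_pow, norm_norm]
      calc t * ((‖b.grad i‖ ^ 2)⁻¹ * ‖b.grad i‖)
          ≤ h * ‖b.grad i‖ * ((‖b.grad i‖ ^ 2)⁻¹ * ‖b.grad i‖) := by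
            have := ht.2
            gcongr
        _ = h := by field_simp
    calc ‖y + t • ((‖b.grad i‖ ^ 2)⁻¹ • b.grad i) - b 0‖
        ≤ ‖y - b 0‖ + ‖t • ((‖b.grad i‖ ^ 2)⁻¹ • b.grad i)‖ := by
          rw [add_sub_right_comm]
          exact norm_add_le _ _
      _ ≤ 2 * h := by linarith

lemma Simp.norm_grad_inv_le (hd : 1 ≤ d) (b : Simp d) (i : Fin (d + 1)) :
    ‖b.grad i‖⁻¹ ≤ Metric.diam b.carrier := by
  have : Nontrivial (Fin (d + 1)) := Fin.nontrivial_iff_two_le.2 (by omega)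
  obtain ⟨j, hj⟩ := exists_ne i
  have hg : 0 < ‖b.grad i‖ := norm_pos_iff.2 (b.grad_ne_zero hd i)
  have h1 := b.inner_grad_vertex_sub_of_ne hj.symm
  have h2 := real_inner_le_norm (b.grad i) (b i - b j)
  have h3 := b.dist_le_diam (b.vertex_mem_carrier i) (b.vertex_mem_carrier j)
  rw [dist_eq_norm] at h3
  rw [h1] at h2
  rw [inv_le_iff_one_le_mul₀ hg, mul_comm]
  exact h2.trans (by gcongr)

/-- A simplex is swept by its face in the direction of an edge. -/
lemma Simp.volume_carrier_le (hd : 1 ≤ d) (b : Simp d) (i : Fin (d + 1)) :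
    (volume : Measure (Eu d)).real b.carrier ≤
      Metric.diam b.carrier * (μHE[d - 1]).real (b.face i) := by
  have : Nontrivial (Fin (d + 1)) := Fin.nontrivial_iff_two_le.2 (by omega)
  obtain ⟨j, hj⟩ := exists_ne i
  have := b.sFinite_faceMeasure hd i
  have hmp := b.measurePreserving_slice (b.inner_grad_vertex_sub_of_ne hj.symm)
  have hle : volume b.carrier ≤ b.faceMeasure i (b.face i) := by
    rw [← hmp.measure_preimage b.measurableSet_carrier.nullMeasurableSet]
    calc ((b.faceMeasure i).prod volume)
          ((fun q : Eu d × ℝ => q.1 + q.2 • (b i - b j)) ⁻¹' b.carrier)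
        ≤ ((b.faceMeasure i).prod volume) (b.face i ×ˢ Set.Icc (0 : ℝ) 1) := by
          refine measure_mono_ae ?_
          have hz : ∀ᵐ q ∂(b.faceMeasure i).prod (volume : Measure ℝ), b.coord i q.1 = 0 :=
            Measure.quasiMeasurePreserving_fst.ae (b.ae_faceMeasure i)
          filter_upwards [hz] with q hq hqm
          obtain ⟨hf, h0, h1⟩ := (b.add_smul_edge_mem_carrier_iff hj.symm hq q.2).1 hqm
          refine ⟨hf, h0, h1.trans ?_⟩
          rw [← b.sum_coord_apply_eq_one q.1]
          have hc := b.mem_carrier_iff.1 (b.face_subset_carrier i hf)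
          exact Finset.single_le_sum (f := fun l => b.coord l q.1) (fun l _ => hc l)
            (Finset.mem_univ j)
      _ = b.faceMeasure i (b.face i) := by
          rw [Measure.prod_prod, Real.volume_Icc]
          simp
  have hle' := ENNReal.toReal_mono
    (b.faceMeasure_lt_top hd i (b.isCompact_face i).isBounded).ne hle
  rw [← measureReal_def, ← measureReal_def, b.toReal_faceMeasure_face] at hle'
  refine hle'.trans ?_
  gcongr
  exact b.norm_grad_inv_le hd i

lemma Simp.pow_diam_le_volume (b : Simp d) {κ : ℝ} (hκ : 0 < κ) {x : Eu d}
    (hx : Metric.closedBall x (Metric.diam b.carrier / κ) ⊆ b.carrier) :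
    unitBallVolume d / κ ^ d * Metric.diam b.carrier ^ d ≤
      (volume : Measure (Eu d)).real b.carrier := by
  have h := measureReal_mono (μ := volume) hx b.isCompact_carrier.measure_lt_top.ne
  rw [volume_real_closedBall x (div_nonneg Metric.diam_nonneg hκ.le), div_pow] at h
  refine le_trans (le_of_eq ?_) h
  ring

end Sizes

/-! ### Functionals on finite-dimensional function spaces -/

section LinearAlgebra

/-- A linear functional that vanishes on the kernel of a linear map `M` on a finite-dimensional
space is bounded by the norm of `M`. -/
lemma exists_abs_le_norm_of_ker_le {E F : Type*} [AddCommGroup E] [Module ℝ E]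
    [FiniteDimensional ℝ E] [NormedAddCommGroup F] [NormedSpace ℝ F]
    (M : E →ₗ[ℝ] F) (ℓ : E →ₗ[ℝ] ℝ) (h : LinearMap.ker M ≤ LinearMap.ker ℓ) :
    ∃ C, 0 ≤ C ∧ ∀ c, |ℓ c| ≤ C * ‖M c‖ := by
  have hmem : ℓ ∈ (LinearMap.ker M.rangeRestrict).dualAnnihilator := by
    rw [Submodule.mem_dualAnnihilator, LinearMap.ker_rangeRestrict]
    exact fun w hw => h hw
  rw [← LinearMap.range_dualMap_eq_dualAnnihilator_ker] at hmem
  obtain ⟨g, hg⟩ := hmem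
  obtain ⟨C, hC0, hC⟩ := (LinearMap.toContinuousLinearMap g).bound
  refine ⟨C, hC0.le, fun c => ?_⟩
  have h1 : ℓ c = LinearMap.toContinuousLinearMap g (M.rangeRestrict c) := by
    rw [← hg]; rfl
  rw [h1, ← Real.norm_eq_abs]
  exact hC _

/-- On a finite-dimensional space of continuous functions on a compact set `S`, a functional which
vanishes on the functions that are zero in the interior of `S` is bounded by the `L¹` norm. -/
lemma exists_abs_le_integral_norm {d : ℕ} {E F : Type*} [AddCommGroup E] [Module ℝ E]
    [FiniteDimensional ℝ E] [NormedAddCommGroup F] [NormedSpace ℝ F]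
    {S : Set (Eu d)} (hS : IsCompact S) (Ψ : E →ₗ[ℝ] (Eu d → F)) (hΨ : ∀ c, Continuous (Ψ c))
    (ℓ : E →ₗ[ℝ] ℝ) (hℓ : ∀ c, (∀ x ∈ interior S, Ψ c x = 0) → ℓ c = 0) :
    ∃ C, 0 ≤ C ∧ ∀ c, |ℓ c| ≤ C * ∫ x in S, ‖Ψ c x‖ := by
  have hint : ∀ c, Integrable (Ψ c) (volume.restrict S) := fun c =>
    (hΨ c).continuousOn.integrableOn_compact hS
  let M : E →ₗ[ℝ] (Eu d →₁[volume.restrict S] F) :=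
    { toFun := fun c => (hint c).toL1 (Ψ c)
      map_add' := fun a c => by
        rw [← Integrable.toL1_add]
        congr 1
        exact map_add Ψ a c
      map_smul' := fun r c => by
        rw [RingHom.id_apply, ← Integrable.toL1_smul]
        congr 1
        exact map_smul Ψ r c }
  have hnorm : ∀ c, ‖M c‖ = ∫ x in S, ‖Ψ c x‖ := fun c => L1.norm_of_fun_eq_integral_norm (hint c)
  have hker : LinearMap.ker M ≤ LinearMap.ker ℓ := by
    intro c hc
    refine hℓ c ?_
    have h0 : ∫ x in S, ‖Ψ c x‖ = 0 := by
      rw [← hnorm, LinearMap.mem_ker.1 hc, norm_zero]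
    rw [integral_eq_zero_iff_of_nonneg (fun x => norm_nonneg _) (hint c).norm] at h0
    have h1 : Ψ c =ᵐ[volume.restrict (interior S)] fun _ => 0 := by
      filter_upwards [ae_restrict_of_ae_restrict_of_subset interior_subset h0] with x hx
      simpa using hx
    exact Measure.eqOn_open_of_ae_eq h1 isOpen_interior (hΨ c).continuousOn continuousOn_const
  obtain ⟨C, hC0, hC⟩ := exists_abs_le_norm_of_ker_le M ℓ hker
  exact ⟨C, hC0, fun c => by rw [← hnorm]; exact hC c⟩

end LinearAlgebra

/-! ### Coefficients in a basis of shape functions -/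

section ShapeFunctions

variable {d k : ℕ} (B : ShapeFunctions d k)

/-- A polynomial in the barycentric coordinates that vanishes in the open simplex vanishes. -/
lemma eval_eq_zero_of_forall_pos (q : MvPolynomial (Fin (d + 1)) ℝ)
    (hq : ∀ l : Fin (d + 1) → ℝ, (∀ i, 0 < l i) → ∑ i, l i = 1 → q.eval l = 0)
    (l : Fin (d + 1) → ℝ) (hl : ∑ i, l i = 1) : q.eval l = 0 := by
  -- restriction of `q` to the line from the centre of the simplex to `l`
  set m : ℝ := ((d : ℝ) + 1)⁻¹ with hm
  have hm0 : 0 < m := by positivity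
  let r : Polynomial ℝ :=
    MvPolynomial.aeval (fun i => Polynomial.C m + Polynomial.X * Polynomial.C (l i - m)) q
  have hr : ∀ t : ℝ, r.eval t = q.eval fun i => m + t * (l i - m) := by
    intro t
    have h := MvPolynomial.map_aeval
      (fun i => Polynomial.C m + Polynomial.X * Polynomial.C (l i - m)) (Polynomial.evalRingHom t) q
    simp only [Polynomial.coe_evalRingHom] at h
    change Polynomial.eval t _ = _
    rw [h]
    simp only [Polynomial.eval_add, Polynomial.eval_C, Polynomial.eval_mul, Polynomial.eval_X]
    rw [MvPolynomial.eval, MvPolynomial.coe_eval₂Hom, MvPolynomial.coe_eval₂Hom]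
    congr 1
    ext x
    simp
  have hroot : r = 0 := by
    refine Polynomial.eq_zero_of_infinite_isRoot r ?_
    have hopen : IsOpen {t : ℝ | ∀ i, 0 < m + t * (l i - m)} := by
      simp only [Set.ofPred_forall]
      exact isOpen_iInter_of_finite fun i => isOpen_lt continuous_const (by fun_prop)
    refine (infinite_of_mem_nhds (0 : ℝ) (hopen.mem_nhds ?_)).mono ?_
    · intro i
      simpa using hm0
    · intro t ht
      rw [Set.mem_ofPred_eq, Polynomial.IsRoot, hr]
      refine hq _ ht ?_
      rw [Finset.sum_add_distrib, ← Finset.mul_sum, Finset.sum_sub_distrib, hl]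
      simp [hm]
      field_simp
      simp
  have h1 := hr 1
  have hone : (fun i => m + 1 * (l i - m)) = l := by
    funext i
    ring
  rw [hroot, Polynomial.eval_zero, hone] at h1
  exact h1.symm

lemma ShapeFunctions.eq_zero_of_forall_pos (c : Idx d k → ℝ)
    (hc : ∀ l : Fin (d + 1) → ℝ, (∀ i, 0 < l i) → ∑ i, l i = 1 →
      ∑ α, c α * (B.poly α).eval l = 0) : c = 0 := by
  refine B.independent c fun l hl => ?_
  have h := eval_eq_zero_of_forall_pos (∑ α, MvPolynomial.C (c α) * B.poly α) ?_ l hl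
  · simpa using h
  · intro l hl hl1
    simpa using hc l hl hl1

/-- The coefficients are linear combinations of point values in the simplex. -/
lemma ShapeFunctions.exists_dual_points (α : Idx d k) :
    ∃ w : (stdSimplex ℝ (Fin (d + 1))) →₀ ℝ, ∀ β,
      (w.sum fun l r => r * (B.poly β).eval l.1) = if β = α then 1 else 0 := by
  classical
  -- otherwise a nonzero functional vanishes on all point values, against linear independence
  have htop : Submodule.span ℝ (Set.range fun l : stdSimplex ℝ (Fin (d + 1)) =>
      fun β : Idx d k => (B.poly β).eval l.1) = ⊤ := by
    by_contra hne
    obtain ⟨f, hf, hle⟩ := Submodule.exists_le_ker_of_lt_top _ (lt_top_iff_ne_top.2 hne)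
    have hrep : ∀ x : Idx d k → ℝ, f x = ∑ β, f (Pi.single β 1) * x β := by
      intro x
      conv_lhs => rw [← Finset.univ_sum_single x]
      rw [map_sum]
      refine Finset.sum_congr rfl fun β _ => ?_
      rw [mul_comm, ← smul_eq_mul, ← map_smul]
      congr 1
      rw [← Pi.single_smul]
      simp
    have hz := B.eq_zero_of_forall_pos (fun β => f (Pi.single β 1)) fun l hl hl1 => by
      have := hle (Submodule.subset_span ⟨⟨l, fun i => (hl i).le, hl1⟩, rfl⟩)
      rw [LinearMap.mem_ker, hrep] at this
      exact this
    refine hf (LinearMap.ext fun x => ?_)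
    rw [hrep]
    have hz' : ∀ β, f (Pi.single β 1) = 0 := fun β => congrFun hz β
    simp [hz']
  have hmem : (fun β : Idx d k => if β = α then (1 : ℝ) else 0) ∈
      Submodule.span ℝ (Set.range fun l : stdSimplex ℝ (Fin (d + 1)) =>
        fun β : Idx d k => (B.poly β).eval l.1) := htop ▸ Submodule.mem_top
  obtain ⟨w, hw⟩ := Finsupp.mem_span_range_iff_exists_finsupp.1 hmem
  refine ⟨w, fun β => ?_⟩
  have := congrFun hw β
  rw [← this, Finsupp.sum, Finsupp.sum, Finset.sum_apply]
  rfl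

variable {Y : Type} [NormedAddCommGroup Y] [NormedSpace ℝ Y]

/-- The combination of the shape functions with coefficients `c`, as a function of the barycentric
coordinates. -/
noncomputable def ShapeFunctions.comb (c : Idx d k → Y) (l : Fin (d + 1) → ℝ) : Y :=
  ∑ α, (B.poly α).eval l • c α

lemma ShapeFunctions.comb_const (y : Y) {l : Fin (d + 1) → ℝ} (hl : ∑ i, l i = 1) :
    B.comb (fun _ => y) l = y := by
  rw [ShapeFunctions.comb, ← Finset.sum_smul, B.sum_eq_one l hl, one_smul]

lemma ShapeFunctions.comb_sub_const (c : Idx d k → Y) (y : Y) {l : Fin (d + 1) → ℝ}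
    (hl : ∑ i, l i = 1) : B.comb (fun α => c α - y) l = B.comb c l - y := by
  conv_rhs => rw [← B.comb_const y hl]
  simp [ShapeFunctions.comb, smul_sub]

/-- The coefficients are bounded by the maximum norm on the simplex. -/
lemma ShapeFunctions.exists_norm_coeff_le : ∃ C, 0 ≤ C ∧ ∀ (c : Idx d k → Y) (M : ℝ),
    (∀ l ∈ stdSimplex ℝ (Fin (d + 1)), ‖B.comb c l‖ ≤ M) → ∀ α, ‖c α‖ ≤ C * M := by
  classical
  choose w hw using B.exists_dual_points
  refine ⟨∑ α, (w α).sum fun _ r => |r|,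
    Finset.sum_nonneg fun α _ => Finset.sum_nonneg fun _ _ => abs_nonneg _, fun c M hM α => ?_⟩
  have hM0 : 0 ≤ M := (norm_nonneg _).trans (hM _ (single_mem_stdSimplex ℝ (0 : Fin (d + 1))))
  have hc : c α = (w α).sum fun l r => r • B.comb c l.1 := by
    simp only [ShapeFunctions.comb, Finsupp.sum, Finset.smul_sum, smul_smul]
    rw [Finset.sum_comm]
    simp only [← Finset.sum_smul]
    have h : ∀ β, ∑ l ∈ (w α).support, (w α) l * (B.poly β).eval l.1 = if β = α then 1 else 0 :=
      fun β => hw α β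
    simp [h]
  calc ‖c α‖ ≤ (w α).sum fun l r => |r| * M := by
        rw [hc, Finsupp.sum]
        refine (norm_sum_le _ _).trans (Finset.sum_le_sum fun l _ => ?_)
        rw [norm_smul, Real.norm_eq_abs]
        exact mul_le_mul_of_nonneg_left (hM _ l.2) (abs_nonneg _)
    _ = ((w α).sum fun _ r => |r|) * M := by
        rw [Finsupp.sum, Finsupp.sum, Finset.sum_mul]
    _ ≤ _ := by
        refine mul_le_mul_of_nonneg_right ?_ hM0
        exact Finset.single_le_sum (f := fun α => (w α).sum fun _ r => |r|)
          (fun α _ => Finset.sum_nonneg fun _ _ => abs_nonneg _) (Finset.mem_univ α)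

/-- The shape functions are bounded on the simplex. -/
lemma ShapeFunctions.exists_abs_eval_le : ∃ M, 0 ≤ M ∧ ∀ α, ∀ l ∈ stdSimplex ℝ (Fin (d + 1)),
    |(B.poly α).eval l| ≤ M := by
  have h : ∀ α, ∃ M, ∀ l ∈ stdSimplex ℝ (Fin (d + 1)), ‖(B.poly α).eval l‖ ≤ M := fun α =>
    (isCompact_stdSimplex ℝ (Fin (d + 1))).exists_bound_of_continuousOn
      (MvPolynomial.continuous_eval _).continuousOn
  choose M hM using h
  have hM0 : ∀ α, 0 ≤ M α := fun α =>
    (norm_nonneg _).trans (hM α _ (single_mem_stdSimplex ℝ (0 : Fin (d + 1))))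
  refine ⟨∑ α, M α, Finset.sum_nonneg fun α _ => hM0 α, fun α l hl => ?_⟩
  exact (hM α l hl).trans (Finset.single_le_sum (fun α _ => hM0 α) (Finset.mem_univ α))

lemma ShapeFunctions.exists_norm_comb_le : ∃ M, 0 ≤ M ∧ ∀ (c : Idx d k → Y) (R : ℝ),
    (∀ α, ‖c α‖ ≤ R) → ∀ l ∈ stdSimplex ℝ (Fin (d + 1)), ‖B.comb c l‖ ≤ M * R := by
  obtain ⟨M, hM0, hM⟩ := B.exists_abs_eval_le
  refine ⟨Fintype.card (Idx d k) * M, by positivity, fun c R hR l hl => ?_⟩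
  calc ‖B.comb c l‖ ≤ ∑ α : Idx d k, M * R := by
        refine (norm_sum_le _ _).trans (Finset.sum_le_sum fun α _ => ?_)
        rw [norm_smul, Real.norm_eq_abs]
        exact mul_le_mul (hM α l hl) (hR α) (norm_nonneg _) hM0
    _ = _ := by
        rw [Finset.sum_const, nsmul_eq_mul, Finset.card_univ, mul_assoc]

end ShapeFunctions

/-! ### Affine maps between simplices -/

section Transport

variable {d k : ℕ}

/-- The affine map that sends the vertices of `b` to those of `b'`. -/
noncomputable def Simp.transport (b b' : Simp d) (x : Eu d) : Eu d := ∑ i, b.coord i x • b' i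

/-- The linear part of the affine map between two simplices. -/
noncomputable def Simp.transportLinear (b b' : Simp d) : Eu d →L[ℝ] Eu d :=
  ∑ i, (innerSL ℝ (b.grad i)).smulRight (b' i)

lemma Simp.transport_sub (b b' : Simp d) (x y : Eu d) :
    b.transport b' x - b.transport b' y = b.transportLinear b' (x - y) := by
  simp only [Simp.transport, Simp.transportLinear, ← Finset.sum_sub_distrib, ← sub_smul,
    b.coord_sub, sum_apply, ContinuousLinearMap.smulRight_apply,
    innerSL_apply_apply]

lemma Simp.coord_transport (b b' : Simp d) (l : Fin (d + 1)) (x : Eu d) :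
    b'.coord l (b.transport b' x) = b.coord l x := by
  have h := b'.coord_sub l (b.transport b' x) (b' 0)
  have h2 : b.transport b' x - b' 0 = ∑ i, b.coord i x • (b' i - b' 0) := by
    simp only [smul_sub, Finset.sum_sub_distrib, ← Finset.sum_smul, b.sum_coord_apply_eq_one,
      one_smul]
    rfl
  rw [h2, inner_sum] at h
  simp only [inner_smul_right, b'.inner_grad_vertex_sub, mul_sub, Finset.sum_sub_distrib,
    ← Finset.sum_mul, b.sum_coord_apply_eq_one, b'.coord_apply] at h
  simp only [mul_ite, mul_one, mul_zero, Finset.sum_ite_eq, Finset.mem_univ, if_true] at h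
  linarith

lemma Simp.transport_transport (b b' : Simp d) (x : Eu d) :
    b'.transport b (b.transport b' x) = x := by
  rw [Simp.transport]
  simp only [b.coord_transport b']
  exact b.linear_combination_coord_eq_self x

lemma Simp.image_transport_carrier (b b' : Simp d) :
    b.transport b' '' b.carrier = b'.carrier := by
  ext x
  constructor
  · rintro ⟨y, hy, rfl⟩
    rw [b'.mem_carrier_iff]
    intro i
    rw [b.coord_transport b']
    exact b.mem_carrier_iff.1 hy i
  · intro hx
    refine ⟨b'.transport b x, ?_, b'.transport_transport b x⟩
    rw [b.mem_carrier_iff]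
    intro i
    rw [b'.coord_transport b]
    exact b'.mem_carrier_iff.1 hx i

lemma Simp.hasFDerivAt_transport (b b' : Simp d) (x : Eu d) :
    HasFDerivAt (b.transport b') (b.transportLinear b') x := by
  have h : b.transport b' = fun y => b.transportLinear b' y + b.transport b' 0 := by
    funext y
    have := b.transport_sub b' y 0
    rw [sub_zero] at this
    rw [← this]; abel
  rw [h]
  exact (b.transportLinear b').hasFDerivAt.add_const _

lemma Simp.norm_transportLinear_le (b b' : Simp d) :
    ‖b.transportLinear b'‖ ≤ (∑ i, ‖b.grad i‖) * Metric.diam b'.carrier := by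
  refine ContinuousLinearMap.opNorm_le_bound _
    (mul_nonneg (Finset.sum_nonneg fun i _ => norm_nonneg _) Metric.diam_nonneg) fun w => ?_
  have h : b.transportLinear b' w = ∑ i, inner ℝ (b.grad i) w • (b' i - b' 0) := by
    simp only [smul_sub, Finset.sum_sub_distrib, ← Finset.sum_smul, b.sum_grad_inner, zero_smul,
      sub_zero]
    simp only [Simp.transportLinear, sum_apply,
      ContinuousLinearMap.smulRight_apply, innerSL_apply_apply]
  rw [h, Finset.sum_mul, Finset.sum_mul]
  refine (norm_sum_le _ _).trans (Finset.sum_le_sum fun i _ => ?_)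
  rw [norm_smul, mul_right_comm]
  refine mul_le_mul (norm_inner_le_norm _ _) ?_ (norm_nonneg _) (by positivity)
  rw [← dist_eq_norm]
  exact b'.dist_le_diam (b'.vertex_mem_carrier i) (b'.vertex_mem_carrier 0)

/-- Change of variables between two simplices. -/
lemma Simp.volume_mul_integral_transport (b b' : Simp d) (F : Eu d → ℝ) :
    (volume : Measure (Eu d)).real b'.carrier * ∫ x in b.carrier, F (b.transport b' x) =
      (volume : Measure (Eu d)).real b.carrier * ∫ x in b'.carrier, F x := by
  have hcv : ∀ F : Eu d → ℝ, ∫ x in b'.carrier, F x =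
      |(b.transportLinear b').det| * ∫ x in b.carrier, F (b.transport b' x) := by
    intro F
    rw [← b.image_transport_carrier b', integral_image_eq_integral_abs_det_fderiv_smul volume
      b.measurableSet_carrier (fun x _ => (b.hasFDerivAt_transport b' x).hasFDerivWithinAt)
      (Function.LeftInverse.injective (b.transport_transport b')).injOn, ← integral_const_mul]
    simp only [smul_eq_mul]
  have h1 := hcv fun _ => 1
  simp only [integral_const, measureReal_restrict_apply_univ, smul_eq_mul, mul_one] at h1
  rw [hcv F, h1]
  ring

end Transport

/-! ### Inverse and Poincaré inequalities, uniformly in the simplex -/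

section Estimates

variable {d k : ℕ} (B : ShapeFunctions d k)

/-- The function on `ℝ^d` with coefficients `c` relative to the simplex `b`. -/
noncomputable def ShapeFunctions.combOn {Y : Type} [NormedAddCommGroup Y] [NormedSpace ℝ Y]
    (b : Simp d) (c : Idx d k → Y) (x : Eu d) : Y :=
  B.comb c fun l => b.coord l x

lemma Simp.coord_mem_stdSimplex (b : Simp d) {x : Eu d} (hx : x ∈ b.carrier) :
    (fun l => b.coord l x) ∈ stdSimplex ℝ (Fin (d + 1)) :=
  ⟨b.mem_carrier_iff.1 hx, b.sum_coord_apply_eq_one x⟩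

lemma Simp.exists_coord_eq (b : Simp d) {l : Fin (d + 1) → ℝ}
    (hl : l ∈ stdSimplex ℝ (Fin (d + 1))) :
    ∃ x ∈ b.carrier, (fun i => b.coord i x) = l := by
  have hc : ∀ i, b.coord i (∑ j, l j • b j) = l i := by
    intro i
    have h := b.coord_sub i (∑ j, l j • b j) (b 0)
    have h2 : ∑ j, l j • b j - b 0 = ∑ j, l j • (b j - b 0) := by
      simp only [smul_sub, Finset.sum_sub_distrib, ← Finset.sum_smul, hl.2, one_smul]
    rw [h2, inner_sum] at h
    simp only [inner_smul_right, b.inner_grad_vertex_sub, mul_sub, Finset.sum_sub_distrib,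
      ← Finset.sum_mul, hl.2, b.coord_apply] at h
    simp only [mul_ite, mul_one, mul_zero, Finset.sum_ite_eq, Finset.mem_univ, if_true] at h
    linarith
  exact ⟨_, b.mem_carrier_iff.2 fun i => by rw [hc]; exact hl.1 i, funext hc⟩

lemma contDiff_eval_coord (b : Simp d) (q : MvPolynomial (Fin (d + 1)) ℝ) :
    ContDiff ℝ 1 fun x => q.eval fun l => b.coord l x := by
  have h1 : ContDiff ℝ 1 fun l : Fin (d + 1) → ℝ => q.eval l :=
    contDiffOn_univ.1 (AnalyticOnNhd.eval_mvPolynomial q).contDiffOn_of_completeSpace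
  refine h1.comp (contDiff_pi.2 fun l => ?_)
  have h : (fun x => b.coord l x) = fun x => inner ℝ (b.grad l) (x - 0) + b.coord l 0 := by
    funext x
    rw [← b.coord_sub]; ring
  rw [h]
  exact (contDiff_const.inner ℝ (contDiff_id.sub contDiff_const)).add contDiff_const

lemma ShapeFunctions.contDiff_combOn (b : Simp d) (c : Idx d k → ℝ) :
    ContDiff ℝ 1 (B.combOn b c) := by
  have h : ContDiff ℝ 1 fun x => ∑ α, (B.poly α).eval (fun l => b.coord l x) • c α :=
    ContDiff.sum fun α _ => (contDiff_eval_coord b (B.poly α)).smul contDiff_const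
  exact h

lemma ShapeFunctions.eq_zero_of_combOn_eq_zero (b : Simp d) (c : Idx d k → ℝ)
    (hc : ∀ x ∈ interior b.carrier, B.combOn b c x = 0) : c = 0 := by
  refine B.eq_zero_of_forall_pos c fun l hl hl1 => ?_
  obtain ⟨x, hx, hxl⟩ := b.exists_coord_eq (l := l) ⟨fun i => (hl i).le, hl1⟩
  have hx' : x ∈ interior b.carrier := b.mem_interior_iff.2 fun i => by
    rw [show b.coord i x = l i from congrFun hxl i]
    exact hl i
  rw [← hc x hx', ShapeFunctions.combOn, hxl, ShapeFunctions.comb]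
  exact Finset.sum_congr rfl fun α _ => mul_comm _ _

lemma ShapeFunctions.combOn_transport (b b' : Simp d) (c : Idx d k → ℝ) (x : Eu d) :
    B.combOn b' c (b.transport b' x) = B.combOn b c x := by
  simp only [ShapeFunctions.combOn, b.coord_transport b']

lemma exists_simp (d : ℕ) : Nonempty (Simp d) :=
  AffineBasis.exists_affineBasis_of_finiteDimensional (ι := Fin (d + 1)) (k := ℝ) (P := Eu d)
    (by simp)

/-- Inverse inequality between the coefficients and the `L¹` norm, uniformly in the simplex. -/
lemma ShapeFunctions.exists_abs_coeff_mul_volume_le : ∃ C, 0 ≤ C ∧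
    ∀ (b : Simp d) (c : Idx d k → ℝ) (α : Idx d k),
      |c α| * (volume : Measure (Eu d)).real b.carrier ≤
        C * ∫ x in b.carrier, |B.combOn b c x| := by
  obtain ⟨b₀⟩ := exists_simp d
  let Ψ : (Idx d k → ℝ) →ₗ[ℝ] (Eu d → ℝ) :=
    { toFun := fun c x => B.combOn b₀ c x
      map_add' := fun a c => by
        funext x
        simp [ShapeFunctions.combOn, ShapeFunctions.comb, mul_add, Finset.sum_add_distrib]
      map_smul' := fun r c => by
        funext x
        simp [ShapeFunctions.combOn, ShapeFunctions.comb, Finset.mul_sum, mul_left_comm] }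
  have h : ∀ α : Idx d k, ∃ C, 0 ≤ C ∧ ∀ c : Idx d k → ℝ,
      |c α| ≤ C * ∫ x in b₀.carrier, |B.combOn b₀ c x| := fun α =>
    exists_abs_le_integral_norm b₀.isCompact_carrier Ψ
      (fun c => (B.contDiff_combOn b₀ c).continuous) (LinearMap.proj α) fun c hc => by
        rw [B.eq_zero_of_combOn_eq_zero b₀ c hc]; rfl
  choose C hC0 hC using h
  refine ⟨(∑ α, C α) * (volume : Measure (Eu d)).real b₀.carrier,
    mul_nonneg (Finset.sum_nonneg fun α _ => hC0 α) measureReal_nonneg, fun b c α => ?_⟩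
  have ht := b₀.volume_mul_integral_transport b fun x => |B.combOn b c x|
  simp only [B.combOn_transport] at ht
  have hle : C α ≤ ∑ α, C α :=
    Finset.single_le_sum (f := C) (fun α _ => hC0 α) (Finset.mem_univ α)
  have hi : 0 ≤ ∫ x in b₀.carrier, |B.combOn b₀ c x| := integral_nonneg fun _ => abs_nonneg _
  calc |c α| * (volume : Measure (Eu d)).real b.carrier
      ≤ ((∑ α, C α) * ∫ x in b₀.carrier, |B.combOn b₀ c x|) *
          (volume : Measure (Eu d)).real b.carrier := by
        refine mul_le_mul_of_nonneg_right ((hC α c).trans ?_) measureReal_nonneg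
        exact mul_le_mul_of_nonneg_right hle hi
    _ = (∑ α, C α) * ((volume : Measure (Eu d)).real b.carrier *
          ∫ x in b₀.carrier, |B.combOn b₀ c x|) := by ring
    _ = _ := by rw [ht]; ring

/-- Poincaré inequality for the coefficients, uniformly in the simplex. -/
lemma ShapeFunctions.exists_abs_coeff_sub_mul_volume_le : ∃ C, 0 ≤ C ∧
    ∀ (b : Simp d) (c : Idx d k → ℝ) (α β : Idx d k),
      |c α - c β| * (volume : Measure (Eu d)).real b.carrier ≤
        C * Metric.diam b.carrier * ∫ x in b.carrier, ‖fderiv ℝ (B.combOn b c) x‖ := by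
  obtain ⟨b₀⟩ := exists_simp d
  have hdiff : ∀ (b : Simp d) (c : Idx d k → ℝ) x, DifferentiableAt ℝ (B.combOn b c) x :=
    fun b c x => (B.contDiff_combOn b c).differentiable (by simp) x
  let Ψ : (Idx d k → ℝ) →ₗ[ℝ] (Eu d → (Eu d →L[ℝ] ℝ)) :=
    { toFun := fun c x => fderiv ℝ (B.combOn b₀ c) x
      map_add' := fun a c => by
        funext x
        have : B.combOn b₀ (a + c) = B.combOn b₀ a + B.combOn b₀ c := by
          funext x
          simp [ShapeFunctions.combOn, ShapeFunctions.comb, mul_add, Finset.sum_add_distrib]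
        rw [this, fderiv_add (hdiff b₀ a x) (hdiff b₀ c x)]
        rfl
      map_smul' := fun r c => by
        funext x
        have : B.combOn b₀ (r • c) = r • B.combOn b₀ c := by
          funext x
          simp [ShapeFunctions.combOn, ShapeFunctions.comb, Finset.mul_sum, mul_left_comm]
        rw [this, fderiv_const_smul (hdiff b₀ c x)]
        rfl }
  have h : ∀ q : Idx d k × Idx d k, ∃ C, 0 ≤ C ∧ ∀ c : Idx d k → ℝ,
      |c q.1 - c q.2| ≤ C * ∫ x in b₀.carrier, ‖fderiv ℝ (B.combOn b₀ c) x‖ := fun q =>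
    exists_abs_le_integral_norm b₀.isCompact_carrier Ψ
      (fun c => (B.contDiff_combOn b₀ c).continuous_fderiv (by simp))
      ((LinearMap.proj q.1 : (Idx d k → ℝ) →ₗ[ℝ] ℝ) - LinearMap.proj q.2) fun c hc => by
        -- a function of zero gradient is constant, so its coefficients are equal
        obtain ⟨z, hz⟩ := b₀.nonempty_interior_carrier
        have hconst : ∀ x ∈ interior b₀.carrier, B.combOn b₀ c x = B.combOn b₀ c z := by
          intro x hx
          have := b₀.convex_carrier.interior.norm_image_sub_le_of_norm_fderiv_le (𝕜 := ℝ)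
            (C := 0) (fun y _ => hdiff b₀ c y)
            (fun y hy => by rw [show fderiv ℝ (B.combOn b₀ c) y = 0 from hc y hy, norm_zero]) hz hx
          rw [zero_mul] at this
          exact sub_eq_zero.1 (norm_le_zero_iff.1 this)
        have h0 := B.eq_zero_of_combOn_eq_zero b₀ (fun α => c α - B.combOn b₀ c z) fun x hx => by
          rw [ShapeFunctions.combOn, B.comb_sub_const _ _ (b₀.sum_coord_apply_eq_one x)]
          exact sub_eq_zero.2 (hconst x hx)
        have h1 : c q.1 - B.combOn b₀ c z = 0 := congrFun h0 q.1
        have h2 : c q.2 - B.combOn b₀ c z = 0 := congrFun h0 q.2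
        simp only [LinearMap.sub_apply, LinearMap.proj_apply]
        linarith
  choose C hC0 hC using h
  have hG : 0 ≤ ∑ i, ‖b₀.grad i‖ := Finset.sum_nonneg fun i _ => norm_nonneg _
  have hS : 0 ≤ ∑ q, C q := Finset.sum_nonneg fun q _ => hC0 q
  refine ⟨(∑ q, C q) * (volume : Measure (Eu d)).real b₀.carrier * ∑ i, ‖b₀.grad i‖,
    mul_nonneg (mul_nonneg hS measureReal_nonneg) hG, fun b c α β => ?_⟩
  have ht := b₀.volume_mul_integral_transport b fun x => ‖fderiv ℝ (B.combOn b c) x‖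
  have hle : C (α, β) ≤ ∑ q, C q :=
    Finset.single_le_sum (f := C) (fun α _ => hC0 α) (Finset.mem_univ (α, β))
  have hi : 0 ≤ ∫ x in b₀.carrier, ‖fderiv ℝ (B.combOn b₀ c) x‖ :=
    integral_nonneg fun _ => norm_nonneg _
  have hV : 0 ≤ (volume : Measure (Eu d)).real b.carrier := measureReal_nonneg
  have hchain : ∫ x in b₀.carrier, ‖fderiv ℝ (B.combOn b₀ c) x‖ ≤
      ((∑ i, ‖b₀.grad i‖) * Metric.diam b.carrier) *
        ∫ x in b₀.carrier, ‖fderiv ℝ (B.combOn b c) (b₀.transport b x)‖ := by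
    have hct : Continuous (b₀.transport b) :=
      continuous_iff_continuousAt.2 fun x => (b₀.hasFDerivAt_transport b x).continuousAt
    rw [← integral_const_mul]
    refine setIntegral_mono_on ?_ ?_ b₀.measurableSet_carrier fun x _ => ?_
    · exact ((B.contDiff_combOn b₀ c).continuous_fderiv
        (by simp)).norm.continuousOn.integrableOn_compact b₀.isCompact_carrier
    · exact (((((B.contDiff_combOn b c).continuous_fderiv (by simp)).comp
        hct).norm.const_mul _).continuousOn).integrableOn_compact b₀.isCompact_carrier
    · have hcomp : B.combOn b₀ c = B.combOn b c ∘ b₀.transport b := by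
        funext y
        exact (B.combOn_transport b₀ b c y).symm
      rw [hcomp, ((hdiff b c _).hasFDerivAt.comp x (b₀.hasFDerivAt_transport b x)).fderiv, mul_comm]
      refine (ContinuousLinearMap.opNorm_comp_le _ _).trans ?_
      exact mul_le_mul_of_nonneg_left (b₀.norm_transportLinear_le b) (norm_nonneg _)
  calc |c α - c β| * (volume : Measure (Eu d)).real b.carrier
      ≤ ((∑ q, C q) * (((∑ i, ‖b₀.grad i‖) * Metric.diam b.carrier) *
        ∫ x in b₀.carrier, ‖fderiv ℝ (B.combOn b c) (b₀.transport b x)‖)) *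
          (volume : Measure (Eu d)).real b.carrier := by
        refine mul_le_mul_of_nonneg_right ((hC (α, β) c).trans ?_) hV
        exact mul_le_mul hle hchain hi hS
    _ = (∑ q, C q) * (∑ i, ‖b₀.grad i‖) * Metric.diam b.carrier *
          ((volume : Measure (Eu d)).real b.carrier *
          ∫ x in b₀.carrier, ‖fderiv ℝ (B.combOn b c) (b₀.transport b x)‖) := by ring
    _ = _ := by rw [ht]; ring

end Estimates

/-! ### Piecewise smooth functions of one variable -/

section PiecewiseFTC

/-- A continuous function on `[0, t]` that is piecewise `C¹` on a finite cover by closed intervals: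
its increment is at most the integral of the sum of the derivatives of the pieces. -/
lemma enorm_le_add_lintegral_of_piecewise {n : ℕ} {S : Fin n → Set ℝ} {w : Fin n → ℝ → ℝ} {t : ℝ}
    (ht : 0 ≤ t) (hSc : ∀ i, IsCompact (S i)) (hSconv : ∀ i, Convex ℝ (S i))
    (hw : ∀ i, ContDiff ℝ 1 (w i)) (hcover : ∀ s ∈ Set.Icc 0 t, ∃ i, s ∈ S i)
    (hagree : ∀ s ∈ Set.Icc 0 t, ∀ i j, s ∈ S i → s ∈ S j → w i s = w j s)
    {i₀ i₁ : Fin n} (h₀ : (0 : ℝ) ∈ S i₀) (h₁ : t ∈ S i₁) :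
    ‖w i₀ 0‖ₑ ≤ ‖w i₁ t‖ₑ +
      ∫⁻ s in Set.Icc 0 t, ∑ i, (S i).indicator (fun s => ‖deriv (w i) s‖ₑ) s := by
  classical
  -- the function glued from the pieces; it is differentiable off the endpoints of the intervals
  let ψ : ℝ → ℝ := fun s => if h : ∃ i, s ∈ S i then w h.choose s else 0
  have hψ : ∀ s ∈ Set.Icc 0 t, ∀ i, s ∈ S i → ψ s = w i s := by
    intro s hs i hi
    have hex : ∃ i, s ∈ S i := ⟨i, hi⟩
    change (if h : ∃ i, s ∈ S i then w h.choose s else 0) = _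
    rw [dif_pos hex]
    exact hagree s hs _ _ hex.choose_spec hi
  have hcont : ContinuousOn ψ (Set.Icc 0 t) := by
    have h : ContinuousOn ψ (⋃ i, S i ∩ Set.Icc 0 t) := by
      refine (locallyFinite_of_finite _).continuousOn_iUnion
        (fun i => (hSc i).isClosed.inter isClosed_Icc) fun i => ?_
      exact (hw i).continuous.continuousOn.congr fun s hs => hψ s hs.2 i hs.1
    refine h.mono fun s hs => ?_
    obtain ⟨i, hi⟩ := hcover s hs
    exact Set.mem_iUnion.2 ⟨i, hi, hs⟩
  have hfront : ∀ i, (frontier (S i)).Countable := by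
    intro i
    rcases (S i).eq_empty_or_nonempty with he | hne
    · rw [he, frontier_empty]
      exact Set.countable_empty
    · have hI := eq_Icc_of_connected_compact
        ⟨hne, (hSconv i).isPreconnected⟩ (hSc i)
      have hle : sInf (S i) ≤ sSup (S i) := Real.sInf_le_sSup _ (hSc i).bddBelow (hSc i).bddAbove
      rw [hI, frontier_Icc hle]
      exact (Set.toFinite _).countable
  have hE : (⋃ i, frontier (S i)).Countable := Set.countable_iUnion hfront
  have hder : ∀ s ∈ Set.Ioo 0 t \ ⋃ i, frontier (S i), ∃ i, s ∈ S i ∧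
      HasDerivAt ψ (deriv (w i) s) s := by
    rintro s ⟨hs, hsE⟩
    obtain ⟨i, hi⟩ := hcover s (Set.Ioo_subset_Icc_self hs)
    refine ⟨i, hi, ?_⟩
    have hint : s ∈ interior (S i) := by
      by_contra hn
      refine hsE (Set.mem_iUnion.2 ⟨i, ?_⟩)
      rw [(hSc i).isClosed.frontier_eq]
      exact ⟨hi, hn⟩
    have hev : ψ =ᶠ[nhds s] w i := by
      filter_upwards [isOpen_interior.mem_nhds hint, isOpen_Ioo.mem_nhds hs] with r hr hr'
      exact hψ r (Set.Ioo_subset_Icc_self hr') i (interior_subset hr)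
    exact (((hw i).differentiable (by simp) s).hasDerivAt).congr_of_eventuallyEq hev
  have hbound : ∀ s ∈ Set.Ioo 0 t \ ⋃ i, frontier (S i),
      ‖deriv ψ s‖ₑ ≤ ∑ i, (S i).indicator (fun s => ‖deriv (w i) s‖ₑ) s := by
    intro s hs
    obtain ⟨i, hi, hd⟩ := hder s hs
    rw [hd.deriv]
    refine le_trans (le_of_eq ?_) (Finset.single_le_sum
      (f := fun i => (S i).indicator (fun s => ‖deriv (w i) s‖ₑ) s) (fun _ _ => zero_le)
      (Finset.mem_univ i))
    simp only [Set.indicator_of_mem hi]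
  have hae : ∀ᵐ s ∂volume.restrict (Set.Ioc 0 t), s ∈ Set.Ioo 0 t \ ⋃ i, frontier (S i) := by
    have h1 : ∀ᵐ s ∂(volume : Measure ℝ), s ∉ ⋃ i, frontier (S i) := hE.ae_notMem _
    have h2 : ∀ᵐ s ∂(volume : Measure ℝ), s ∉ ({t} : Set ℝ) :=
      (Set.countable_singleton t).ae_notMem _
    filter_upwards [ae_restrict_mem measurableSet_Ioc, ae_restrict_of_ae h1,
      ae_restrict_of_ae h2] with s hs hs1 hs2
    exact ⟨⟨hs.1, lt_of_le_of_ne hs.2 hs2⟩, hs1⟩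
  have hfin : ∀ i, ∃ C, ∀ s ∈ Set.Icc 0 t, ‖deriv (w i) s‖ ≤ C := fun i =>
    isCompact_Icc.exists_bound_of_continuousOn ((hw i).continuous_deriv (by simp)).continuousOn
  choose C hC using hfin
  have hC0 : ∀ i, 0 ≤ C i := fun i => (norm_nonneg _).trans (hC i 0 ⟨le_rfl, ht⟩)
  have hintg : IntervalIntegrable (deriv ψ) volume 0 t := by
    rw [intervalIntegrable_iff_integrableOn_Ioc_of_le ht]
    refine Integrable.of_bound (measurable_deriv ψ).aestronglyMeasurable (∑ i, C i) ?_
    filter_upwards [hae] with s hs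
    obtain ⟨i, hi, hd⟩ := hder s hs
    rw [hd.deriv]
    exact (hC i s (Set.Ioo_subset_Icc_self hs.1)).trans
      (Finset.single_le_sum (f := C) (fun i _ => hC0 i) (Finset.mem_univ i))
  have hftc := integral_eq_of_hasDerivAt_off_countable_of_le ψ (deriv ψ) ht hE hcont
    (fun s hs => by
      obtain ⟨i, -, hd⟩ := hder s hs
      rw [hd.deriv]
      exact hd) hintg
  rw [hψ t ⟨ht, le_rfl⟩ i₁ h₁, hψ 0 ⟨le_rfl, ht⟩ i₀ h₀, intervalIntegral.integral_of_le ht] at hftc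
  have heq : w i₀ 0 = w i₁ t - ∫ s in Set.Ioc 0 t, deriv ψ s := by
    rw [hftc]; ring
  rw [heq]
  refine enorm_sub_le.trans (add_le_add le_rfl ?_)
  refine (enorm_integral_le_lintegral_enorm _).trans ?_
  rw [setLIntegral_congr (Ioc_ae_eq_Icc (a := (0 : ℝ)) (b := t)).symm]
  refine lintegral_mono_ae ?_
  filter_upwards [hae] with s hs using hbound s hs

end PiecewiseFTC

/-! ### Elements and facets of a mesh -/

section MeshTopology

namespace Mesh

variable {d : ℕ} {Ω : Set (Eu d)} (T : Mesh d Ω)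

lemma facet_subset_face {K : Fin T.nElem} {f : Fin T.nFacet} (hf : f ∈ T.facets K) :
    T.facet f ⊆ (T.elem K).face (T.side K f) := by
  rw [T.face_eq]
  intro x hx
  exact Set.mem_biUnion (Finset.mem_filter.2 ⟨hf, rfl⟩) hx

lemma facet_subset_carrier {K : Fin T.nElem} {f : Fin T.nFacet} (hf : f ∈ T.facets K) :
    T.facet f ⊆ (T.elem K).carrier :=
  (T.facet_subset_face hf).trans ((T.elem K).face_subset_carrier _)

lemma carrier_subset_closure (K : Fin T.nElem) : (T.elem K).carrier ⊆ closure Ω := by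
  rw [← T.iUnion_elem]
  exact Set.subset_iUnion (fun K => (T.elem K).carrier) K

lemma isCompact_closure {Ω : Set (Eu d)} (T : Mesh d Ω) : IsCompact (closure Ω) := by
  rw [← T.iUnion_elem]
  exact isCompact_iUnion fun K => (T.elem K).isCompact_carrier

lemma exists_facet_of_mem_face {K : Fin T.nElem} {i : Fin (d + 1)} {x : Eu d}
    (hx : x ∈ (T.elem K).face i) : ∃ f ∈ T.facets K, x ∈ T.facet f := by
  rw [T.face_eq] at hx
  obtain ⟨f, hf, hxf⟩ := Set.mem_iUnion₂.1 hx
  exact ⟨f, (Finset.mem_filter.1 hf).1, hxf⟩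

lemma mem_boundaryFacets {K : Fin T.nElem} {f : Fin T.nFacet} :
    f ∈ T.boundaryFacets K ↔ f ∈ T.facets K ∧ T.IsBoundary f := by
  rw [boundaryFacets, Finset.mem_filter]
  rfl

lemma eq_of_mem_boundaryFacets {K K' : Fin T.nElem} {f : Fin T.nFacet}
    (hf : f ∈ T.boundaryFacets K) (hf' : f ∈ T.facets K') : K' = K := by
  obtain ⟨h1, h2⟩ := T.mem_boundaryFacets.1 hf
  exact Finset.card_le_one.1 h2.le K' (Finset.mem_filter.2 ⟨Finset.mem_univ _, hf'⟩) K
    (Finset.mem_filter.2 ⟨Finset.mem_univ _, h1⟩)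

lemma facet_eq_face_of_mem {K : Fin T.nElem} {f : Fin T.nFacet} (hf : f ∈ T.boundaryFacets K) :
    T.facet f = (T.elem K).face (T.side K f) := by
  obtain ⟨h1, h2⟩ := T.mem_boundaryFacets.1 hf
  exact T.facet_eq_face K f h1 h2

lemma frontier_eq_biUnion : frontier Ω = ⋃ K, ⋃ f ∈ T.boundaryFacets K, T.facet f := by
  rw [T.frontier_eq]
  ext x
  simp only [Set.mem_iUnion, exists_prop]
  constructor
  · rintro ⟨f, hf, hx⟩
    have h1 := (Finset.mem_filter.1 hf).2
    obtain ⟨K, hK⟩ := Finset.card_eq_one.1 h1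
    have hKm : K ∈ Finset.univ.filter fun K => f ∈ T.facets K := by
      rw [hK]; exact Finset.mem_singleton_self K
    exact ⟨K, f, T.mem_boundaryFacets.2 ⟨(Finset.mem_filter.1 hKm).2, h1⟩, hx⟩
  · rintro ⟨K, f, hf, hx⟩
    exact ⟨f, Finset.mem_filter.2 ⟨Finset.mem_univ _, (T.mem_boundaryFacets.1 hf).2⟩, hx⟩

lemma eq_of_mem_interior {K K' : Fin T.nElem} {x : Eu d}
    (hx : x ∈ interior (T.elem K).carrier) (hx' : x ∈ (T.elem K').carrier) : K' = K := by
  by_contra hne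
  rw [← (T.elem K').closure_interior_carrier] at hx'
  obtain ⟨y, hy, hy'⟩ := mem_closure_iff.1 hx' _ isOpen_interior hx
  exact (T.disjoint_interior K' K hne).le_bot ⟨hy', hy⟩

/-- The elements have no interior point on `∂Ω`. -/
lemma interior_carrier_subset (hΩ : IsOpen Ω) (K : Fin T.nElem) :
    interior (T.elem K).carrier ⊆ Ω := by
  intro x hx
  by_contra hn
  have hfr : x ∈ frontier Ω := by
    rw [frontier, hΩ.interior_eq]
    exact ⟨T.carrier_subset_closure K (interior_subset hx), hn⟩
  rw [T.frontier_eq_biUnion] at hfr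
  simp only [Set.mem_iUnion, exists_prop] at hfr
  obtain ⟨K', f, hf, hxf⟩ := hfr
  rw [T.facet_eq_face_of_mem hf] at hxf
  obtain ⟨hc, h0⟩ := ((T.elem K').mem_face_iff _).1 hxf
  have hK := T.eq_of_mem_interior hx hc
  subst hK
  exact ((T.elem K').mem_interior_iff.1 hx _).ne' h0

/-- The points of the skeleton that belong to two facets. -/
def multipleFacetPoints : Set (Eu d) :=
  ⋃ f, ⋃ f', ⋃ _ : f ≠ f', T.facet f ∩ T.facet f'

lemma measure_multipleFacetPoints : μHE[d - 1] T.multipleFacetPoints = 0 := by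
  simp only [multipleFacetPoints, measure_iUnion_null_iff]
  exact fun f f' h => T.area_inter f f' h

/-- Almost every point of a boundary facet lies in a single element: there are no cracks. -/
lemma eq_of_mem_boundary_facet {K K' : Fin T.nElem} {f : Fin T.nFacet} {y : Eu d}
    (hf : f ∈ T.boundaryFacets K) (hy : y ∈ T.facet f) (hN : y ∉ T.multipleFacetPoints)
    (hy' : y ∈ (T.elem K').carrier) : K' = K := by
  by_cases hint : y ∈ interior (T.elem K').carrier
  · exact (T.eq_of_mem_interior hint
      (T.facet_subset_carrier (T.mem_boundaryFacets.1 hf).1 hy)).symm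
  · have h : ∃ i, (T.elem K').coord i y = 0 := by
      by_contra hne
      push Not at hne
      refine hint ((T.elem K').mem_interior_iff.2 fun i => ?_)
      exact lt_of_le_of_ne ((T.elem K').mem_carrier_iff.1 hy' i) (hne i).symm
    obtain ⟨i, hi⟩ := h
    obtain ⟨f', hf', hyf'⟩ := T.exists_facet_of_mem_face (((T.elem K').mem_face_iff i).2 ⟨hy', hi⟩)
    have hff : f' = f := by
      by_contra hne
      refine hN ?_
      simp only [multipleFacetPoints, Set.mem_iUnion]
      exact ⟨f', f, hne, hyf', hy⟩
    rw [hff] at hf'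
    exact T.eq_of_mem_boundaryFacets hf hf'

end Mesh

end MeshTopology

/-! ### Traces on a boundary face -/

section Trace

variable {d : ℕ} {Ω : Set (Eu d)}

/-- The norm of a piecewise defined function, counted once for each element that contains the
point. -/
noncomputable def Mesh.pieceNorm (T : Mesh d Ω) {Z : Type} [NormedAddCommGroup Z]
    (u : Fin T.nElem → Eu d → Z) (x : Eu d) : ENNReal :=
  ∑ K, (T.elem K).carrier.indicator (fun x => ‖u K x‖ₑ) x

namespace Mesh

variable (T : Mesh d Ω) {Z : Type} [NormedAddCommGroup Z]

lemma measurable_pieceNorm {u : Fin T.nElem → Eu d → Z} (hu : ∀ K, Continuous (u K)) :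
    Measurable (T.pieceNorm u) := by
  refine Finset.measurable_sum _ fun K _ => ?_
  exact ((hu K).enorm.measurable).indicator (T.elem K).measurableSet_carrier

lemma lintegral_pieceNorm {u : Fin T.nElem → Eu d → Z} (hu : ∀ K, Continuous (u K)) :
    ∫⁻ x, T.pieceNorm u x = ∑ K, ∫⁻ x in (T.elem K).carrier, ‖u K x‖ₑ := by
  simp only [pieceNorm]
  rw [lintegral_finsetSum]
  · exact Finset.sum_congr rfl fun K _ => lintegral_indicator (T.elem K).measurableSet_carrier _
  · exact fun K _ => ((hu K).enorm.measurable).indicator (T.elem K).measurableSet_carrier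

lemma enorm_le_pieceNorm (u : Fin T.nElem → Eu d → Z) {K : Fin T.nElem} {x : Eu d}
    (hx : x ∈ (T.elem K).carrier) : ‖u K x‖ₑ ≤ T.pieceNorm u x := by
  refine le_trans (le_of_eq ?_) (Finset.single_le_sum
    (f := fun K => (T.elem K).carrier.indicator (fun x => ‖u K x‖ₑ) x) (fun _ _ => zero_le)
    (Finset.mem_univ K))
  simp only [Set.indicator_of_mem hx]

lemma pieceNorm_eq_of_unique (u : Fin T.nElem → Eu d → Z) {K : Fin T.nElem} {x : Eu d}
    (hx : x ∈ (T.elem K).carrier) (hK : ∀ K', x ∈ (T.elem K').carrier → K' = K) :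
    T.pieceNorm u x = ‖u K x‖ₑ := by
  rw [pieceNorm, Finset.sum_eq_single K]
  · rw [Set.indicator_of_mem hx]
  · exact fun K' _ hne => Set.indicator_of_notMem (fun h => hne (hK K' h)) _
  · exact fun h => absurd (Finset.mem_univ K) h

/-- The value at a point of a face is controlled along a segment that enters a simplex contained in
the domain. -/
lemma pieceNorm_mul_le {u : Fin T.nElem → Eu d → ℝ} (hu : ∀ K, ContDiff ℝ 1 (u K))
    (hagree : ∀ K K', ∀ x ∈ Ω, x ∈ (T.elem K).carrier → x ∈ (T.elem K').carrier →
      u K x = u K' x)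
    {b : Simp d} (hb : interior b.carrier ⊆ Ω) {i j : Fin (d + 1)} (hij : i ≠ j) {y : Eu d}
    (hyi : b.coord i y = 0) (hpos : ∀ l, l ≠ i → 0 < b.coord l y) {δ : ℝ}
    (hδ : δ ≤ b.coord j y) {K : Fin T.nElem}
    (hyK : y ∈ (T.elem K).carrier) (hK : ∀ K', y ∈ (T.elem K').carrier → K' = K) :
    T.pieceNorm u y * ENNReal.ofReal δ ≤
      (∫⁻ t in Set.Icc 0 δ, T.pieceNorm u (y + t • (b i - b j))) +
        ENNReal.ofReal δ * ∫⁻ t in Set.Icc 0 δ, ‖b i - b j‖ₑ *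
          T.pieceNorm (fun K => fderiv ℝ (u K)) (y + t • (b i - b j)) := by
  set v : Eu d := b i - b j with hv
  have hcu : ∀ K, Continuous (u K) := fun K => (hu K).continuous
  have hline : Continuous fun t : ℝ => y + t • v := by fun_prop
  have hint : ∀ t ∈ Set.Ioo 0 δ, y + t • v ∈ interior b.carrier := by
    intro t ht
    rw [b.mem_interior_iff]
    intro l
    rw [b.coord_add_smul_edge]
    by_cases hli : l = i
    · subst hli
      simpa [hij, hyi] using ht.1
    by_cases hlj : l = j
    · subst hlj
      simp only [hli, if_true, if_false]
      linarith [ht.2]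
    · simpa [hli, hlj] using hpos l hli
  have hkey : ∀ t ∈ Set.Ioo 0 δ, T.pieceNorm u y ≤ T.pieceNorm u (y + t • v) +
      ∫⁻ s in Set.Icc 0 δ, ‖v‖ₑ * T.pieceNorm (fun K => fderiv ℝ (u K)) (y + s • v) := by
    intro t ht
    have hcov : ∀ s ∈ Set.Icc 0 t, ∃ K', y + s • v ∈ (T.elem K').carrier := by
      intro s hs
      rcases hs.1.eq_or_lt with h0 | h0
      · exact ⟨K, by rw [← h0]; simpa using hyK⟩
      · have : y + s • v ∈ closure Ω :=
          subset_closure (hb (hint s ⟨h0, hs.2.trans_lt ht.2⟩))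
        rw [← T.iUnion_elem] at this
        exact Set.mem_iUnion.1 this
    obtain ⟨K₁, hK₁⟩ := hcov t ⟨ht.1.le, le_rfl⟩
    have hderiv : ∀ K' s, deriv (fun s : ℝ => u K' (y + s • v)) s =
        fderiv ℝ (u K') (y + s • v) v := by
      intro K' s
      have h2 : HasDerivAt (fun t : ℝ => y + t • v) v s := by
        simpa using ((hasDerivAt_id s).smul_const v).const_add y
      exact (((hu K').differentiable (by simp) _).hasFDerivAt.comp_hasDerivAt s h2).deriv
    have h1d := enorm_le_add_lintegral_of_piecewise
      (S := fun K' => Set.Icc 0 t ∩ (fun s : ℝ => y + s • v) ⁻¹' (T.elem K').carrier)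
      (w := fun K' s => u K' (y + s • v)) ht.1.le
      (fun K' => isCompact_Icc.inter_right
        ((T.elem K').isCompact_carrier.isClosed.preimage hline))
      (fun K' => (convex_Icc 0 t).inter ?_)
      (fun K' => (hu K').comp (by fun_prop))
      (fun s hs => (hcov s hs).imp fun K' h => ⟨hs, h⟩)
      (fun s hs K' K'' h h' => ?_) (i₀ := K) (i₁ := K₁)
      ⟨⟨le_rfl, ht.1.le⟩, by simpa using hyK⟩ ⟨⟨ht.1.le, le_rfl⟩, hK₁⟩
    · rw [T.pieceNorm_eq_of_unique u hyK hK]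
      rw [zero_smul, add_zero] at h1d
      refine h1d.trans (add_le_add (T.enorm_le_pieceNorm u hK₁) ?_)
      refine (lintegral_mono_set (Set.Icc_subset_Icc_right ht.2.le)).trans
        (lintegral_mono fun s => ?_)
      rw [pieceNorm, Finset.mul_sum]
      refine Finset.sum_le_sum fun K' _ => ?_
      by_cases hs : s ∈ Set.Icc 0 t ∩ (fun s : ℝ => y + s • v) ⁻¹' (T.elem K').carrier
      · have hs' : y + s • v ∈ (T.elem K').carrier := hs.2
        rw [Set.indicator_of_mem hs, Set.indicator_of_mem hs', hderiv, mul_comm]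
        exact ContinuousLinearMap.le_opENorm _ _
      · rw [Set.indicator_of_notMem hs]
        exact zero_le
    · intro s hs r hr a c ha hc hac
      have h := (T.elem K').convex_carrier hs hr ha hc hac
      have he : y + (a • s + c • r) • v = a • (y + s • v) + c • (y + r • v) := by
        have : y = (a + c) • y := by rw [hac, one_smul]
        conv_lhs => rw [this]
        simp only [smul_eq_mul]
        module
      rw [Set.mem_preimage, he]
      exact h
    · rcases hs.1.eq_or_lt with h0 | h0
      · rw [← h0]
        have e1 := hK K' (by have := h.2; rw [Set.mem_preimage, ← h0] at this; simpa using this)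
        have e2 := hK K'' (by have := h'.2; rw [Set.mem_preimage, ← h0] at this; simpa using this)
        rw [e1, e2]
      · exact hagree K' K'' _ (hb (hint s ⟨h0, hs.2.trans_lt ht.2⟩)) h.2 h'.2
  have hvol : volume (Set.Ioo 0 δ) = ENNReal.ofReal δ := by rw [Real.volume_Ioo, sub_zero]
  calc T.pieceNorm u y * ENNReal.ofReal δ
      = ∫⁻ _ in Set.Ioo 0 δ, T.pieceNorm u y := by
        rw [setLIntegral_const, hvol]
    _ ≤ ∫⁻ t in Set.Ioo 0 δ, (T.pieceNorm u (y + t • v) +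
          ∫⁻ s in Set.Icc 0 δ, ‖v‖ₑ * T.pieceNorm (fun K => fderiv ℝ (u K)) (y + s • v)) := by
        refine lintegral_mono_ae ?_
        filter_upwards [ae_restrict_mem measurableSet_Ioo] with t ht using hkey t ht
    _ = (∫⁻ t in Set.Ioo 0 δ, T.pieceNorm u (y + t • v)) +
          ENNReal.ofReal δ *
          ∫⁻ s in Set.Icc 0 δ, ‖v‖ₑ * T.pieceNorm (fun K => fderiv ℝ (u K)) (y + s • v) := by
        rw [lintegral_add_left (f := fun t : ℝ => T.pieceNorm u (y + t • v))
            ((T.measurable_pieceNorm hcu).comp hline.measurable),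
          setLIntegral_const, hvol, mul_comm]
    _ ≤ _ := add_le_add (lintegral_mono_set Set.Ioo_subset_Icc_self) le_rfl

end Mesh

/-- Almost every point of a face lies in its relative interior. -/
lemma Simp.ae_face_coord_pos (hd : 1 ≤ d) (b : Simp d) (i : Fin (d + 1)) :
    ∀ᵐ y ∂b.faceMeasure i, y ∈ b.face i → ∀ l, l ≠ i → 0 < b.coord l y := by
  have := b.sFinite_faceMeasure hd i
  -- in every edge direction, almost every line meets the boundary in a null set
  have h : ∀ j, j ≠ i → ∀ᵐ y ∂b.faceMeasure i, ∀ᵐ t : ℝ,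
      y + t • (b i - b j) ∉ frontier b.carrier := by
    intro j hj
    have hmp := b.measurePreserving_slice (b.inner_grad_vertex_sub_of_ne hj.symm)
    have hfr : ∀ᵐ x ∂(volume : Measure (Eu d)), x ∉ frontier b.carrier :=
      measure_eq_zero_iff_ae_notMem.1 (b.convex_carrier.addHaar_frontier volume)
    exact Measure.ae_ae_of_ae_prod (hmp.quasiMeasurePreserving.ae hfr)
  have h' : ∀ᵐ y ∂b.faceMeasure i, ∀ j, j ≠ i → ∀ᵐ t : ℝ,
      y + t • (b i - b j) ∉ frontier b.carrier :=
    ae_all_iff.2 fun j => by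
      by_cases hj : j = i
      · exact Filter.Eventually.of_forall fun y hne => absurd hj hne
      · filter_upwards [h j hj] with y hy _ using hy
  filter_upwards [h', b.ae_faceMeasure i] with y hy hyi hyf
  have hnn := b.mem_carrier_iff.1 (b.face_subset_carrier i hyf)
  have hex : ∃ j, j ≠ i ∧ 0 < b.coord j y := by
    by_contra hne
    push Not at hne
    have hsum := b.sum_coord_apply_eq_one y
    rw [Finset.sum_eq_zero] at hsum
    · exact zero_ne_one hsum
    · intro l _
      by_cases hl : l = i
      · rw [hl, hyi]
      · exact le_antisymm (hne l hl) (hnn l)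
  obtain ⟨j, hj, hjpos⟩ := hex
  have hpos : (volume : Measure ℝ) (Set.Ioo 0 (b.coord j y)) ≠ 0 := by
    rw [Real.volume_Ioo, sub_zero]
    simpa using hjpos
  obtain ⟨t, ht, htf⟩ : ∃ t ∈ Set.Ioo 0 (b.coord j y),
      y + t • (b i - b j) ∉ frontier b.carrier := by
    by_contra hne
    push Not at hne
    refine hpos (measure_mono_null (fun t ht => ?_) (ae_iff.1 (hy j hj)))
    simpa using hne t ht
  have hmem := (b.add_smul_edge_mem_carrier_iff hj.symm hyi t).2
    ⟨hyf, Set.Ioo_subset_Icc_self ht⟩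
  have hint : y + t • (b i - b j) ∈ interior b.carrier := by
    by_contra hn
    refine htf ?_
    rw [b.isCompact_carrier.isClosed.frontier_eq]
    exact ⟨hmem, hn⟩
  intro l hl
  by_cases hlj : l = j
  · rw [hlj]; exact hjpos
  · have := b.mem_interior_iff.1 hint l
    rw [b.coord_add_smul_edge] at this
    simpa [hl, hlj] using this

lemma Simp.lintegral_lintegral_line_le (hd : 1 ≤ d) (b : Simp d) {i j : Fin (d + 1)} (hij : i ≠ j)
    {G : Eu d → ENNReal} (hG : Measurable G) (S : Set (Eu d)) (I : Set ℝ) :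
    ∫⁻ y in S, ∫⁻ t in I, G (y + t • (b i - b j)) ∂volume ∂b.faceMeasure i ≤ ∫⁻ x, G x := by
  have := b.sFinite_faceMeasure hd i
  have hmp := b.measurePreserving_slice (b.inner_grad_vertex_sub_of_ne hij)
  rw [← hmp.lintegral_comp hG,
    lintegral_prod (fun q : Eu d × ℝ => G (q.1 + q.2 • (b i - b j)))
      (hG.comp hmp.measurable).aemeasurable]
  exact (lintegral_mono fun y => setLIntegral_le_lintegral _ _).trans
    (setLIntegral_le_lintegral _ _)

/-- The trace inequality on one boundary face of a fixed triangulation, for functions that are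
piecewise `C¹` on another triangulation. -/
lemma Mesh.lintegral_face_pieceNorm_le (hd : 1 ≤ d) (hΩ : IsOpen Ω) (T₀ T : Mesh d Ω)
    {u : Fin T.nElem → Eu d → ℝ} (hu : ∀ K, ContDiff ℝ 1 (u K))
    (hagree : ∀ K K', ∀ x ∈ Ω, x ∈ (T.elem K).carrier → x ∈ (T.elem K').carrier →
      u K x = u K' x)
    {K₀ : Fin T₀.nElem} {f₀ : Fin T₀.nFacet} (hf₀ : f₀ ∈ T₀.boundaryFacets K₀) :
    ∫⁻ y in T₀.facet f₀, T.pieceNorm u y ∂μHE[d - 1] ≤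
      ENNReal.ofReal ‖(T₀.elem K₀).grad (T₀.side K₀ f₀)‖ * ∑ j, ENNReal.ofReal d *
        ((∫⁻ x, T.pieceNorm u x) + ‖T₀.elem K₀ (T₀.side K₀ f₀) - T₀.elem K₀ j‖ₑ *
          ∫⁻ x, T.pieceNorm (fun K => fderiv ℝ (u K)) x) := by
  set b := T₀.elem K₀ with hb
  set i := T₀.side K₀ f₀ with hi
  have hface : T₀.facet f₀ = b.face i := T₀.facet_eq_face_of_mem hf₀
  have hg : 0 < ‖b.grad i‖ := norm_pos_iff.2 (b.grad_ne_zero hd i)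
  have hd0 : (0 : ℝ) < d := by exact_mod_cast hd
  have := b.sFinite_faceMeasure hd i
  have hr : (μHE[d - 1]).restrict (b.face i) =
      ENNReal.ofReal ‖b.grad i‖ • (b.faceMeasure i).restrict (b.face i) := by
    rw [Simp.faceMeasure, conormalMeasure, Measure.restrict_smul,
      Measure.restrict_restrict (b.measurableSet_face i), smul_smul, ← ENNReal.ofReal_mul hg.le,
      mul_inv_cancel₀ hg.ne', ENNReal.ofReal_one, one_smul]
    congr 1
    exact (Set.inter_eq_left.2 fun y hy => ((b.mem_face_iff i).1 hy).2).symm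
  have hae : ∀ᵐ y ∂b.faceMeasure i, y ∉ T.multipleFacetPoints := by
    refine Measure.ae_smul_measure (ae_restrict_of_ae ?_) _
    exact measure_eq_zero_iff_ae_notMem.1 T.measure_multipleFacetPoints
  have hG := T.measurable_pieceNorm fun K => (hu K).continuous
  have hH := T.measurable_pieceNorm fun K => (hu K).continuous_fderiv (by simp)
  -- the part of the face that is at a distance from the opposite face of the vertex `j`
  have hpart : ∀ j, j ≠ i →
      ∫⁻ y in b.face i ∩ {y | (d : ℝ)⁻¹ ≤ b.coord j y}, T.pieceNorm u y ∂b.faceMeasure i ≤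
        ENNReal.ofReal d * ((∫⁻ x, T.pieceNorm u x) + ‖b i - b j‖ₑ *
          ∫⁻ x, T.pieceNorm (fun K => fderiv ℝ (u K)) x) := by
    intro j hj
    set S := b.face i ∩ {y | (d : ℝ)⁻¹ ≤ b.coord j y} with hS
    have hSm : MeasurableSet S := (b.measurableSet_face i).inter
      (isClosed_le continuous_const (b.continuous_coord j)).measurableSet
    have hpt : ∀ᵐ y ∂(b.faceMeasure i).restrict S,
        T.pieceNorm u y ≤ ENNReal.ofReal d *
          ((∫⁻ t in Set.Icc 0 (d : ℝ)⁻¹, T.pieceNorm u (y + t • (b i - b j))) +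
            ∫⁻ t in Set.Icc 0 (d : ℝ)⁻¹, ‖b i - b j‖ₑ *
              T.pieceNorm (fun K => fderiv ℝ (u K)) (y + t • (b i - b j))) := by
      filter_upwards [ae_restrict_mem hSm, ae_restrict_of_ae hae,
        ae_restrict_of_ae (b.ae_face_coord_pos hd i)] with y hy hyN hpos
      have hyfr : y ∈ frontier Ω := by
        rw [T₀.frontier_eq_biUnion]
        refine Set.mem_iUnion.2 ⟨K₀, Set.mem_iUnion₂.2 ⟨f₀, hf₀, ?_⟩⟩
        rw [hface]
        exact hy.1
      rw [T.frontier_eq_biUnion] at hyfr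
      simp only [Set.mem_iUnion, exists_prop] at hyfr
      obtain ⟨K, f, hf, hyf⟩ := hyfr
      have hle := T.pieceNorm_mul_le hu hagree (T₀.interior_carrier_subset hΩ K₀) hj.symm
        ((b.mem_face_iff i).1 hy.1).2 (hpos hy.1) hy.2
        (T.facet_subset_carrier (T.mem_boundaryFacets.1 hf).1 hyf)
        (fun K' => T.eq_of_mem_boundary_facet hf hyf hyN)
      have hone : ENNReal.ofReal (d : ℝ)⁻¹ ≤ 1 := by
        rw [ENNReal.ofReal_le_one]
        exact inv_le_one_of_one_le₀ (by exact_mod_cast hd)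
      calc T.pieceNorm u y = ENNReal.ofReal d * (T.pieceNorm u y * ENNReal.ofReal (d : ℝ)⁻¹) := by
            rw [mul_left_comm, ← ENNReal.ofReal_mul hd0.le, mul_inv_cancel₀ hd0.ne',
              ENNReal.ofReal_one, mul_one]
        _ ≤ _ := by
            refine mul_le_mul_right (hle.trans (add_le_add le_rfl ?_)) _
            exact mul_le_of_le_one_left zero_le hone
    calc ∫⁻ y in S, T.pieceNorm u y ∂b.faceMeasure i
        ≤ ∫⁻ y in S, ENNReal.ofReal d *
          ((∫⁻ t in Set.Icc 0 (d : ℝ)⁻¹, T.pieceNorm u (y + t • (b i - b j))) +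
            ∫⁻ t in Set.Icc 0 (d : ℝ)⁻¹, ‖b i - b j‖ₑ *
              T.pieceNorm (fun K => fderiv ℝ (u K)) (y + t • (b i - b j))) ∂b.faceMeasure i :=
          lintegral_mono_ae hpt
      _ = ENNReal.ofReal d *
          ((∫⁻ y in S, ∫⁻ t in Set.Icc 0 (d : ℝ)⁻¹, T.pieceNorm u (y + t • (b i - b j))
              ∂volume ∂b.faceMeasure i) +
            ∫⁻ y in S, ∫⁻ t in Set.Icc 0 (d : ℝ)⁻¹, ‖b i - b j‖ₑ *
              T.pieceNorm (fun K => fderiv ℝ (u K)) (y + t • (b i - b j))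
              ∂volume ∂b.faceMeasure i) := by
          rw [lintegral_const_mul' _ _ ENNReal.ofReal_ne_top, lintegral_add_left]
          refine Measurable.lintegral_prod_right' (f := fun q : Eu d × ℝ =>
            T.pieceNorm u (q.1 + q.2 • (b i - b j))) ?_
          exact hG.comp (by fun_prop)
      _ ≤ _ := by
          refine mul_le_mul_right (add_le_add
            (b.lintegral_lintegral_line_le hd hj.symm hG _ _) ?_) _
          rw [← lintegral_const_mul _ hH]
          exact b.lintegral_lintegral_line_le hd hj.symm (hH.const_mul _) _ _
  rw [hface, hr, lintegral_smul_measure, smul_eq_mul]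
  refine mul_le_mul_right ?_ _
  have hcov : b.face i ⊆ ⋃ j ∈ Finset.univ.erase i,
      b.face i ∩ {y | (d : ℝ)⁻¹ ≤ b.coord j y} := by
    intro y hy
    by_contra hne
    simp only [Set.mem_iUnion, not_exists] at hne
    have hlt : ∀ j ∈ Finset.univ.erase i, b.coord j y < (d : ℝ)⁻¹ := by
      intro j hj
      by_contra hle
      exact hne j hj ⟨hy, not_lt.1 hle⟩
    have hsum := b.sum_coord_apply_eq_one y
    rw [← Finset.add_sum_erase _ _ (Finset.mem_univ i), ((b.mem_face_iff i).1 hy).2,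
      zero_add] at hsum
    have hcard : (Finset.univ.erase i : Finset (Fin (d + 1))).card = d := by
      simp
    have hnon : (Finset.univ.erase i : Finset (Fin (d + 1))).Nonempty := by
      rw [← Finset.card_pos, hcard]
      exact hd
    have hs := Finset.sum_lt_sum_of_nonempty hnon hlt
    rw [Finset.sum_const, hcard, nsmul_eq_mul, mul_inv_cancel₀ hd0.ne'] at hs
    linarith
  calc ∫⁻ y in b.face i, T.pieceNorm u y ∂b.faceMeasure i
      ≤ ∫⁻ y in ⋃ j : (Finset.univ.erase i : Finset (Fin (d + 1))),
          b.face i ∩ {y | (d : ℝ)⁻¹ ≤ b.coord j y}, T.pieceNorm u y ∂b.faceMeasure i := by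
        refine lintegral_mono_set (hcov.trans ?_)
        rw [Set.iUnion_subtype]
    _ ≤ ∑ j : (Finset.univ.erase i : Finset (Fin (d + 1))),
          ∫⁻ y in b.face i ∩ {y | (d : ℝ)⁻¹ ≤ b.coord j y}, T.pieceNorm u y ∂b.faceMeasure i := by
        refine (lintegral_iUnion_le _ _).trans_eq ?_
        rw [tsum_fintype]
    _ ≤ ∑ j : (Finset.univ.erase i : Finset (Fin (d + 1))), ENNReal.ofReal d *
          ((∫⁻ x, T.pieceNorm u x) + ‖b i - b j‖ₑ *
          ∫⁻ x, T.pieceNorm (fun K => fderiv ℝ (u K)) x) :=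
        Finset.sum_le_sum fun j _ => hpart j (Finset.ne_of_mem_erase j.2)
    _ ≤ _ := by
        rw [Finset.sum_coe_sort (Finset.univ.erase i) fun j => ENNReal.ofReal d *
          ((∫⁻ x, T.pieceNorm u x) + ‖b i - b j‖ₑ *
          ∫⁻ x, T.pieceNorm (fun K => fderiv ℝ (u K)) x)]
        exact Finset.sum_le_sum_of_subset (Finset.subset_univ _)

end Trace

/-! ### The trace inequality on the boundary of the domain -/

section TraceSum

variable {d : ℕ} {Ω : Set (Eu d)}

lemma Simp.integrableOn_face_area (hd : 1 ≤ d) (b : Simp d) (i : Fin (d + 1)) {ψ : Eu d → ℝ}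
    (hψ : ContinuousOn ψ (b.face i)) : IntegrableOn ψ (b.face i) μHE[d - 1] := by
  have : IsFiniteMeasure ((μHE[d - 1]).restrict (b.face i)) :=
    ⟨by
      rw [Measure.restrict_apply_univ]
      exact b.area_face_lt_top hd i⟩
  obtain ⟨C, hC⟩ := (b.isCompact_face i).exists_bound_of_continuousOn hψ
  refine Integrable.of_bound (hψ.aestronglyMeasurable (b.measurableSet_face i)) C ?_
  filter_upwards [ae_restrict_mem (b.measurableSet_face i)] with x hx using hC x hx

/-- The trace inequality on `∂Ω`. The constant depends only on the domain, through one fixed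
triangulation of it. -/
theorem Mesh.exists_trace_le (hd : 1 ≤ d) (hΩ : IsOpen Ω) (T₀ : Mesh d Ω) :
    ∃ C, 0 ≤ C ∧ ∀ (T : Mesh d Ω) (u : Fin T.nElem → Eu d → ℝ), (∀ K, ContDiff ℝ 1 (u K)) →
      (∀ K K', ∀ x ∈ Ω, x ∈ (T.elem K).carrier → x ∈ (T.elem K').carrier → u K x = u K' x) →
      ∑ K, ∑ f ∈ T.boundaryFacets K, ∫ y in T.facet f, |u K y| ∂μHE[d - 1] ≤
        C * ∑ K, ((∫ x in (T.elem K).carrier, |u K x|) +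
          ∫ x in (T.elem K).carrier, ‖fderiv ℝ (u K) x‖) := by
  classical
  set Ce : ENNReal := ∑ p : (Σ K, {f // f ∈ T₀.boundaryFacets K}),
    ENNReal.ofReal ‖(T₀.elem p.1).grad (T₀.side p.1 p.2)‖ * ∑ j, ENNReal.ofReal d *
        (1 + ‖T₀.elem p.1 (T₀.side p.1 p.2) - T₀.elem p.1 j‖ₑ) with hCe
  have hCtop : Ce ≠ ⊤ := by
    refine ENNReal.sum_ne_top.2 fun p _ => ENNReal.mul_ne_top ENNReal.ofReal_ne_top ?_
    refine ENNReal.sum_ne_top.2 fun j _ => ENNReal.mul_ne_top ENNReal.ofReal_ne_top ?_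
    exact ENNReal.add_ne_top.2 ⟨ENNReal.one_ne_top, enorm_ne_top⟩
  refine ⟨Ce.toReal, ENNReal.toReal_nonneg, fun T u hu hagree => ?_⟩
  have hcu : ∀ K, Continuous (u K) := fun K => (hu K).continuous
  have hcd : ∀ K, Continuous (fderiv ℝ (u K)) := fun K => (hu K).continuous_fderiv (by simp)
  -- the boundary facets of `T` and of `T₀` both cover `∂Ω`
  have hcover : ∀ T : Mesh d Ω, frontier Ω =
      ⋃ p : (Σ K, {f // f ∈ T.boundaryFacets K}), T.facet p.2 := by
    intro T
    rw [T.frontier_eq_biUnion]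
    ext x
    simp only [Set.mem_iUnion, exists_prop, Sigma.exists, Subtype.exists]
  have hdisj : Pairwise (Function.onFun (AEDisjoint μHE[d - 1])
      fun p : (Σ K, {f // f ∈ T.boundaryFacets K}) => T.facet p.2) := by
    rintro ⟨K, f, hf⟩ ⟨K', f', hf'⟩ hne
    refine T.area_inter f f' fun h => hne ?_
    subst h
    have := T.eq_of_mem_boundaryFacets hf (T.mem_boundaryFacets.1 hf').1
    subst this
    rfl
  have hlint : ∑ p : (Σ K, {f // f ∈ T.boundaryFacets K}),
      ∫⁻ y in T.facet p.2, ‖u p.1 y‖ₑ ∂μHE[d - 1] ≤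
      Ce * ((∫⁻ x, T.pieceNorm u x) + ∫⁻ x, T.pieceNorm (fun K => fderiv ℝ (u K)) x) := by
    calc ∑ p : (Σ K, {f // f ∈ T.boundaryFacets K}),
          ∫⁻ y in T.facet p.2, ‖u p.1 y‖ₑ ∂μHE[d - 1]
        ≤ ∑ p : (Σ K, {f // f ∈ T.boundaryFacets K}),
          ∫⁻ y in T.facet p.2, T.pieceNorm u y ∂μHE[d - 1] := by
          refine Finset.sum_le_sum fun p _ => ?_
          refine setLIntegral_mono (T.measurable_pieceNorm hcu) fun y hy => ?_
          exact T.enorm_le_pieceNorm u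
            (T.facet_subset_carrier (T.mem_boundaryFacets.1 p.2.2).1 hy)
      _ = ∫⁻ y in frontier Ω, T.pieceNorm u y ∂μHE[d - 1] := by
          rw [hcover T, lintegral_iUnion₀ (fun p => (T.isClosed_facet _).nullMeasurableSet) hdisj,
            tsum_fintype]
      _ ≤ ∑ p : (Σ K, {f // f ∈ T₀.boundaryFacets K}),
          ∫⁻ y in T₀.facet p.2, T.pieceNorm u y ∂μHE[d - 1] := by
          rw [hcover T₀]
          refine (lintegral_iUnion_le _ _).trans_eq ?_
          rw [tsum_fintype]
      _ ≤ _ := by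
          rw [hCe, Finset.sum_mul]
          refine Finset.sum_le_sum fun p _ => ?_
          refine (T₀.lintegral_face_pieceNorm_le hd hΩ T hu hagree p.2.2).trans ?_
          rw [mul_assoc]
          refine mul_le_mul_right ?_ _
          rw [Finset.sum_mul]
          refine Finset.sum_le_sum fun j _ => ?_
          rw [mul_assoc]
          refine mul_le_mul_right ?_ _
          rw [mul_add, add_mul, add_mul, one_mul, one_mul]
          refine add_le_add le_self_add ?_
          exact le_add_self
  have hfacet : ∀ p : (Σ K, {f // f ∈ T.boundaryFacets K}),
      ENNReal.ofReal (∫ y in T.facet p.2, |u p.1 y| ∂μHE[d - 1]) =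
        ∫⁻ y in T.facet p.2, ‖u p.1 y‖ₑ ∂μHE[d - 1] := by
    intro p
    have hi : IntegrableOn (u p.1) (T.facet p.2) μHE[d - 1] := by
      rw [T.facet_eq_face_of_mem p.2.2]
      exact Simp.integrableOn_face_area hd _ _ (hcu p.1).continuousOn
    exact ofReal_integral_norm_eq_lintegral_enorm hi
  have hG : ∫⁻ x, T.pieceNorm u x =
      ENNReal.ofReal (∑ K, ∫ x in (T.elem K).carrier, |u K x|) := by
    rw [T.lintegral_pieceNorm hcu, ENNReal.ofReal_sum_of_nonneg
      fun K _ => integral_nonneg fun _ => abs_nonneg _]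
    refine Finset.sum_congr rfl fun K _ => ?_
    exact (ofReal_integral_norm_eq_lintegral_enorm
      ((hcu K).continuousOn.integrableOn_compact (T.elem K).isCompact_carrier)).symm
  have hH : ∫⁻ x, T.pieceNorm (fun K => fderiv ℝ (u K)) x =
      ENNReal.ofReal (∑ K, ∫ x in (T.elem K).carrier, ‖fderiv ℝ (u K) x‖) := by
    rw [T.lintegral_pieceNorm hcd, ENNReal.ofReal_sum_of_nonneg
      fun K _ => integral_nonneg fun _ => norm_nonneg _]
    refine Finset.sum_congr rfl fun K _ => ?_
    exact (ofReal_integral_norm_eq_lintegral_enorm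
      ((hcd K).continuousOn.integrableOn_compact (T.elem K).isCompact_carrier)).symm
  have hsum : ∑ K, ∑ f ∈ T.boundaryFacets K, ∫ y in T.facet f, |u K y| ∂μHE[d - 1] =
      ∑ p : (Σ K, {f // f ∈ T.boundaryFacets K}),
        ∫ y in T.facet p.2, |u p.1 y| ∂μHE[d - 1] := by
    rw [Fintype.sum_sigma]
    refine Finset.sum_congr rfl fun K _ => ?_
    exact (Finset.sum_coe_sort (T.boundaryFacets K)
      fun f => ∫ y in T.facet f, |u K y| ∂μHE[d - 1]).symm
  have h1 : 0 ≤ ∑ K, ∫ x in (T.elem K).carrier, |u K x| :=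
    Finset.sum_nonneg fun K _ => integral_nonneg fun _ => abs_nonneg _
  have h2 : 0 ≤ ∑ K, ∫ x in (T.elem K).carrier, ‖fderiv ℝ (u K) x‖ :=
    Finset.sum_nonneg fun K _ => integral_nonneg fun _ => norm_nonneg _
  rw [Finset.sum_add_distrib, hsum]
  rw [hG, hH, ← ENNReal.ofReal_add h1 h2] at hlint
  rw [← ENNReal.ofReal_le_ofReal_iff (mul_nonneg ENNReal.toReal_nonneg (add_nonneg h1 h2)),
    ENNReal.ofReal_mul ENNReal.toReal_nonneg, ENNReal.ofReal_toReal hCtop,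
    ENNReal.ofReal_sum_of_nonneg fun p _ => integral_nonneg fun _ => abs_nonneg _]
  simp only [hfacet]
  exact hlint

end TraceSum

/-! ### Orders of magnitude along a family of meshes -/

section FineMeshes

variable {d : ℕ} {Ω : Set (Eu d)}

lemma Mesh.size_nonneg (T : Mesh d Ω) : 0 ≤ T.size :=
  Real.iSup_nonneg fun _ => Metric.diam_nonneg

lemma Mesh.diam_nonneg (T : Mesh d Ω) (K : Fin T.nElem) : 0 ≤ T.diam K := Metric.diam_nonneg

lemma Mesh.diam_le_size (T : Mesh d Ω) (K : Fin T.nElem) : T.diam K ≤ T.size :=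
  le_ciSup (Set.finite_range T.diam).bddAbove K

variable {ι : Type} (T : ι → Mesh d Ω)

/-- The filter of the sufficiently fine meshes of a family. -/
noncomputable def fineMeshes : Filter ι := Filter.comap (fun i => (T i).size) (nhds 0)

lemma eventually_fineMeshes {P : ι → Prop} :
    (∀ᶠ i in fineMeshes T, P i) ↔ ∃ h₀ : ℝ, 0 < h₀ ∧ ∀ i, (T i).size ≤ h₀ → P i := by
  rw [fineMeshes, (Metric.nhds_basis_closedBall.comap fun i => (T i).size).eventually_iff]
  refine exists_congr fun h₀ => and_congr_right fun _ => forall_congr' fun i => ?_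
  rw [Set.mem_preimage, Metric.mem_closedBall, Real.dist_0_eq_abs, abs_of_nonneg (T i).size_nonneg]

lemma tendsto_size : Filter.Tendsto (fun i => (T i).size) (fineMeshes T) (nhds 0) :=
  Filter.tendsto_comap

lemma eventually_size_lt {ε : ℝ} (hε : 0 < ε) : ∀ᶠ i in fineMeshes T, (T i).size < ε :=
  (tendsto_size T).eventually_lt_const hε

lemma elementO_iff {m : ℕ} {q : ∀ i, Fin (T i).nElem → ℝ} :
    ElementO T m q ↔ ∃ C, 0 ≤ C ∧ ∀ᶠ i in fineMeshes T, ∀ K, |q i K| ≤ C * (T i).diam K ^ m := by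
  constructor
  · rintro ⟨C, h₀, h⟩
    refine ⟨max C 0, le_max_right _ _, (eventually_fineMeshes T).2 ⟨h₀, h.1, fun i hi K => ?_⟩⟩
    refine (h.2 i hi K).trans (mul_le_mul_of_nonneg_right (le_max_left _ _) ?_)
    exact pow_nonneg ((T i).diam_nonneg K) _
  · rintro ⟨C, -, h⟩
    obtain ⟨h₀, h⟩ := (eventually_fineMeshes T).1 h
    exact ⟨C, h₀, h⟩

lemma FacetO.exists_eventually {m : ℕ} {q : ∀ i, Fin (T i).nElem → Fin (T i).nFacet → ℝ}
    (h : FacetO T m q) : ∃ C, 0 ≤ C ∧ ∀ᶠ i in fineMeshes T, ∀ K, ∀ f ∈ (T i).facets K,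
      |q i K f| ≤ C * (T i).diam K ^ m := by
  obtain ⟨C, h₀, h⟩ := h
  refine ⟨max C 0, le_max_right _ _, (eventually_fineMeshes T).2 ⟨h₀, h.1, fun i hi K f hf => ?_⟩⟩
  refine (h.2 i hi K f hf).trans (mul_le_mul_of_nonneg_right (le_max_left _ _) ?_)
  exact pow_nonneg ((T i).diam_nonneg K) _

lemma BoundaryFacetO.exists_eventually {m : ℕ}
    {q : ∀ i, Fin (T i).nElem → Fin (T i).nFacet → ℝ}
    (h : BoundaryFacetO T m q) : ∃ C, 0 ≤ C ∧ ∀ᶠ i in fineMeshes T, ∀ K,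
      ∀ f ∈ (T i).boundaryFacets K, |q i K f| ≤ C * (T i).diam K ^ m := by
  obtain ⟨C, h₀, h⟩ := h
  refine ⟨max C 0, le_max_right _ _, (eventually_fineMeshes T).2 ⟨h₀, h.1, fun i hi K f hf => ?_⟩⟩
  refine (h.2 i hi K f hf).trans (mul_le_mul_of_nonneg_right (le_max_left _ _) ?_)
  exact pow_nonneg ((T i).diam_nonneg K) _

lemma IsApproximation.exists_eventually {k m : ℕ} {s : SpaceKind} {Y : Type}
    [NormedAddCommGroup Y] [NormedSpace ℝ Y] {B : ShapeFunctions d k} {v : Eu d → Y}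
    {vh : ∀ i, DiscreteField (T i) s k Y} (h : IsApproximation T B m v vh) :
    ∃ C, 0 ≤ C ∧ ∀ᶠ i in fineMeshes T, ∀ K, ∀ x ∈ ((T i).elem K).carrier,
      ‖evalOn B (vh i) K x - v x‖ ≤ C * (T i).diam K ^ m := by
  obtain ⟨C, h₀, h⟩ := h
  refine ⟨max C 0, le_max_right _ _, (eventually_fineMeshes T).2 ⟨h₀, h.1, fun i hi K x hx => ?_⟩⟩
  refine (h.2 i hi K x hx).trans (mul_le_mul_of_nonneg_right (le_max_left _ _) ?_)
  exact pow_nonneg ((T i).diam_nonneg K) _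

/-- The constants of a regular family may be taken to be at least one. -/
lemma IsRegularFamily.exists_one_le (h : IsRegularFamily T) : ∃ κ : ℝ, 1 ≤ κ ∧ ∀ i,
    (∀ K, ∃ x, Metric.closedBall x ((T i).diam K / κ) ⊆ ((T i).elem K).carrier) ∧
    (∀ K, (((T i).facets K).card : ℝ) ≤ κ) ∧
    ∀ K K', ∀ f ∈ (T i).facets K, f ∈ (T i).facets K' → (T i).diam K' ≤ κ * (T i).diam K := by
  obtain ⟨κ, hκ, h⟩ := h
  refine ⟨max κ 1, le_max_right _ _, fun i => ⟨fun K => ?_, fun K => ?_, fun K K' f hf hf' => ?_⟩⟩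
  · obtain ⟨x, hx⟩ := (h i).1 K
    refine ⟨x, (Metric.closedBall_subset_closedBall ?_).trans hx⟩
    exact div_le_div_of_nonneg_left ((T i).diam_nonneg K) hκ (le_max_left _ _)
  · exact ((h i).2.1 K).trans (le_max_left _ _)
  · refine ((h i).2.2 K K' f hf hf').trans ?_
    exact mul_le_mul_of_nonneg_right (le_max_left _ _) ((T i).diam_nonneg K)

end FineMeshes

/-! ### Uniform Lipschitz bounds for numerical fluxes -/

section Flux

variable {d p : ℕ}

/-- On a compact set of states, the numerical flux is Lipschitz near the diagonal with uniform
constants. -/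
lemma IsLipschitzFlux.exists_uniform {Y : Type} [NormedAddCommGroup Y] {sys : EntropySystem d p}
    {F : NumFlux d p Y} (hF : IsLipschitzFlux sys F) {S : Set (Eu p)} (hS : IsCompact S)
    (hSW : S ⊆ sys.W) :
    ∃ ε > 0, ∃ L : ℝ, 0 ≤ L ∧ ∀ n : Eu d, ‖n‖ = 1 → ∀ a ∈ S,
      ∀ b ∈ sys.W ∩ Metric.ball a ε, ∀ b' ∈ sys.W ∩ Metric.ball a ε,
        ‖F n b b' - F n a a‖ ≤ L * (‖b - a‖ + ‖b' - a‖) := by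
  have key : ∃ ε > 0, ∃ L : ℝ, 0 ≤ L ∧ ∀ n : Eu d, ‖n‖ = 1 → ∀ a ∈ S, a ∈ sys.W →
      ∀ b ∈ sys.W ∩ Metric.ball a ε, ∀ b' ∈ sys.W ∩ Metric.ball a ε,
        ‖F n b b' - F n a a‖ ≤ L * (‖b - a‖ + ‖b' - a‖) := by
    refine hS.induction_on (p := fun S => ∃ ε > 0, ∃ L : ℝ, 0 ≤ L ∧ ∀ n : Eu d, ‖n‖ = 1 →
      ∀ a ∈ S, a ∈ sys.W → ∀ b ∈ sys.W ∩ Metric.ball a ε, ∀ b' ∈ sys.W ∩ Metric.ball a ε,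
        ‖F n b b' - F n a a‖ ≤ L * (‖b - a‖ + ‖b' - a‖)) ?_ ?_ ?_ ?_
    · exact ⟨1, one_pos, 0, le_rfl, fun n _ a ha => absurd ha (Set.notMem_empty a)⟩
    · rintro S S' hSS ⟨ε, hε, L, hL, h⟩
      exact ⟨ε, hε, L, hL, fun n hn a ha => h n hn a (hSS ha)⟩
    · rintro S S' ⟨ε, hε, L, hL, h⟩ ⟨ε', hε', L', hL', h'⟩
      refine ⟨min ε ε', lt_min hε hε', max L L', le_max_of_le_left hL, ?_⟩
      rintro n hn a (ha | ha) haW b ⟨hbW, hb⟩ b' ⟨hbW', hb'⟩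
      · refine (h n hn a ha haW b ⟨hbW, Metric.ball_subset_ball (min_le_left _ _) hb⟩ b'
          ⟨hbW', Metric.ball_subset_ball (min_le_left _ _) hb'⟩).trans ?_
        exact mul_le_mul_of_nonneg_right (le_max_left _ _) (by positivity)
      · refine (h' n hn a ha haW b ⟨hbW, Metric.ball_subset_ball (min_le_right _ _) hb⟩ b'
          ⟨hbW', Metric.ball_subset_ball (min_le_right _ _) hb'⟩).trans ?_
        exact mul_le_mul_of_nonneg_right (le_max_right _ _) (by positivity)
    · intro a₀ ha₀
      obtain ⟨ε, hε, L, h⟩ := hF a₀ (hSW ha₀) a₀ (hSW ha₀)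
      refine ⟨Metric.ball a₀ (ε / 2), mem_nhdsWithin_of_mem_nhds
        (Metric.ball_mem_nhds _ (half_pos hε)), ε / 2, half_pos hε, max L 0, le_max_right _ _, ?_⟩
      rintro n hn a ha haW b ⟨hbW, hb⟩ b' ⟨hbW', hb'⟩
      have hsub : Metric.ball a (ε / 2) ⊆ Metric.ball a₀ ε := by
        refine Metric.ball_subset_ball' ?_
        have := Metric.mem_ball.1 ha
        linarith
      have haa : a ∈ Metric.ball a₀ ε := hsub (Metric.mem_ball_self (half_pos hε))
      refine (h n hn b ⟨hbW, hsub hb⟩ a ⟨haW, haa⟩ b' ⟨hbW', hsub hb'⟩ a ⟨haW, haa⟩).trans ?_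
      exact mul_le_mul_of_nonneg_right (le_max_left _ _) (by positivity)
  obtain ⟨ε, hε, L, hL, h⟩ := key
  exact ⟨ε, hε, L, hL, fun n hn a ha => h n hn a ha (hSW ha)⟩

end Flux

/-! ### Integrals over the boundary of an element -/

section BoundaryIntegral

variable {d p k : ℕ} {Ω : Set (Eu d)}

lemma Mesh.opposite_eq_or_mem (T : Mesh d Ω) (K : Fin T.nElem) (f : Fin T.nFacet) :
    T.opposite K f = K ∨ f ∈ T.facets (T.opposite K f) := by
  by_cases h : ∃ K', K' ≠ K ∧ f ∈ T.facets K'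
  · right
    rw [Mesh.opposite, dif_pos h]
    exact h.choose_spec.2
  · left
    rw [Mesh.opposite, dif_neg h]

lemma Mesh.facet_subset_opposite (T : Mesh d Ω) {K : Fin T.nElem} {f : Fin T.nFacet}
    (hf : f ∈ T.facets K) : T.facet f ⊆ (T.elem (T.opposite K f)).carrier := by
  rcases T.opposite_eq_or_mem K f with h | h
  · rw [h]; exact T.facet_subset_carrier hf
  · exact T.facet_subset_carrier h

lemma Mesh.area_nonneg (T : Mesh d Ω) (f : Fin T.nFacet) : 0 ≤ T.area f := measureReal_nonneg

lemma Mesh.area_le (hd : 1 ≤ d) (T : Mesh d Ω) {K : Fin T.nElem} {f : Fin T.nFacet}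
    (hf : f ∈ T.facets K) :
    T.area f ≤ 2 ^ d * unitBallVolume d * T.diam K ^ (d - 1) := by
  refine le_trans ?_ ((T.elem K).area_face_le hd (T.side K f))
  exact measureReal_mono (T.facet_subset_face hf) ((T.elem K).area_face_lt_top hd _).ne

lemma Mesh.abs_normal_le (hd : 1 ≤ d) (T : Mesh d Ω) (K : Fin T.nElem) (f : Fin T.nFacet)
    (j : Fin d) : |T.normal K f j| ≤ 1 := by
  have h := (T.elem K).norm_normal hd (T.side K f)
  calc |T.normal K f j| = ‖(T.elem K).normal (T.side K f) j‖ := rfl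
    _ ≤ ‖(T.elem K).normal (T.side K f)‖ := PiLp.norm_apply_le _ _
    _ = 1 := h

/-- The exact flux of a divergence-free field through the boundary of an element vanishes. -/
lemma Mesh.sum_facets_integral_eq_zero (hd : 1 ≤ d) (T : Mesh d Ω) (K : Fin T.nElem)
    {O : Set (Eu d)} (hO : IsOpen O) (hΩO : closure Ω ⊆ O) {q : Fin d → Eu d → ℝ}
    (hq : ∀ j, ContDiffOn ℝ 1 (q j) O)
    (hdiv : ∀ x ∈ closure Ω, ∑ j, fderiv ℝ (q j) x (EuclideanSpace.single j 1) = 0) :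
    ∑ f ∈ T.facets K, ∑ j, T.normal K f j * ∫ x in T.facet f, q j x ∂μHE[d - 1] = 0 := by
  have hKO := T.carrier_subset_closure K
  rw [← (T.elem K).sum_integral_face_eq_zero hd hO (hKO.trans hΩO) hq
    fun x hx => hdiv x (hKO hx), ← Finset.sum_fiberwise _ (T.side K)]
  refine Finset.sum_congr rfl fun i _ => ?_
  rw [Finset.sum_comm]
  refine Finset.sum_congr rfl fun j _ => ?_
  have hsum : ∑ f ∈ (T.facets K).filter (fun f => T.side K f = i),
      ∫ x in T.facet f, q j x ∂μHE[d - 1] =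
        ∫ x in (T.elem K).face i, q j x ∂μHE[d - 1] := by
    have hint : IntegrableOn (q j) ((T.elem K).face i) μHE[d - 1] :=
      (T.elem K).integrableOn_face_area hd i ((hq j).continuousOn.mono
        (((T.elem K).face_subset_carrier i).trans (hKO.trans hΩO)))
    have hU : (T.elem K).face i = ⋃ f : {f // f ∈ (T.facets K).filter fun f => T.side K f = i},
        T.facet f := by
      rw [T.face_eq, Set.iUnion_subtype]
    rw [hU] at hint ⊢
    rw [integral_iUnion_ae (fun f => (T.isClosed_facet _).nullMeasurableSet)
      (fun f f' hne => T.area_inter _ _ fun h => hne (Subtype.ext h)) hint, tsum_fintype]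
    exact (Finset.sum_coe_sort _ fun f => ∫ x in T.facet f, q j x ∂μHE[d - 1]).symm
  rw [← hsum, Finset.mul_sum]
  refine Finset.sum_congr rfl fun f hf => ?_
  rw [Mesh.normal, (Finset.mem_filter.1 hf).2]

lemma FacetQuadrature.abs_integral_le {T : Mesh d Ω} (Q : FacetQuadrature T) (f : Fin T.nFacet)
    {ψ : Eu d → ℝ} {M R : ℝ} (hM : ∑ q, |Q.weight f q| ≤ M) (hR0 : 0 ≤ R)
    (hR : ∀ x ∈ T.facet f, |ψ x| ≤ R) : |Q.integral f ψ| ≤ T.area f * (M * R) := by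
  rw [FacetQuadrature.integral, smul_eq_mul, abs_mul, abs_of_nonneg (T.area_nonneg f)]
  refine mul_le_mul_of_nonneg_left ?_ (T.area_nonneg f)
  calc |∑ q, Q.weight f q • ψ (Q.node f q)| ≤ ∑ q, |Q.weight f q| * R := by
        refine (Finset.abs_sum_le_sum_abs _ _).trans (Finset.sum_le_sum fun q _ => ?_)
        rw [smul_eq_mul, abs_mul]
        exact mul_le_mul_of_nonneg_left (hR _ (Q.node_mem f q)) (abs_nonneg _)
    _ ≤ M * R := by
        rw [← Finset.sum_mul]
        exact mul_le_mul_of_nonneg_right hM hR0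

end BoundaryIntegral

/-! ### Flux balance of an element for a divergence-free field -/

section SmoothFields

variable {d k : ℕ} {Ω : Set (Eu d)}

lemma SmoothNear.exists_common {m : ℕ} {n : ℕ} {q : Fin n → Eu d → ℝ}
    (hq : ∀ j, SmoothNear Ω m (q j)) :
    ∃ O : Set (Eu d), IsOpen O ∧ closure Ω ⊆ O ∧ ∀ j, ContDiffOn ℝ m (q j) O := by
  choose O hO hΩO hqO using hq
  exact ⟨⋂ j, O j, isOpen_iInter_of_finite hO, Set.subset_iInter hΩO,
    fun j => (hqO j).mono (Set.iInter_subset _ j)⟩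

end SmoothFields

section FluxBalance

variable {d p k : ℕ} {Ω : Set (Eu d)} {ι : Type}

/-- If the numerical flux is consistent with a divergence-free field, then its integral over the
boundary of an element is of order `k + d`: the difference with the exact integral, which vanishes,
is made of the approximation error and of the quadrature error. -/
theorem boundaryIntegral_elementO (hd : 1 ≤ d) {sys : EntropySystem d p} (T : ι → Mesh d Ω)
    (hT : IsRegularFamily T) {s : SpaceKind} (B : ShapeFunctions d k)
    {Q : ∀ i, FacetQuadrature (T i)} (hQ : IsQuadratureOfOrder T Q k)
    {F : NumFlux d p ℝ} (hF : IsLipschitzFlux sys F)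
    {q : Fin d → Eu d → ℝ} (hq : ∀ j, SmoothNear Ω (k + 1) (q j))
    (hdiv : ∀ x ∈ closure Ω, ∑ j, fderiv ℝ (q j) x (EuclideanSpace.single j 1) = 0)
    {V : Eu d → Eu p} (hV : ContinuousOn V (closure Ω)) (hVW : ∀ x ∈ closure Ω, V x ∈ sys.W)
    (hcons : ∀ n : Eu d, ‖n‖ = 1 → ∀ x ∈ closure Ω, F n (V x) (V x) = ∑ j, n j * q j x)
    {Vh : ∀ i, DiscreteField (T i) s k (Eu p)}
    (hadm : ∀ᶠ i in fineMeshes T, IsAdmissible sys B (Vh i))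
    (happ : IsApproximation T B (k + 1) V Vh) :
    ElementO T (k + d) fun i K => boundaryIntegral B (Q i) F (Vh i) K := by
  rcases isEmpty_or_nonempty ι with hι | ⟨⟨i₀⟩⟩
  · exact ⟨0, 1, one_pos, fun i => (hι.false i).elim⟩
  have hcomp : IsCompact (V '' closure Ω) := (T i₀).isCompact_closure.image_of_continuousOn hV
  obtain ⟨ε, hε, L, hL, hlip⟩ := hF.exists_uniform hcomp (by
    rintro _ ⟨x, hx, rfl⟩
    exact hVW x hx)
  obtain ⟨κ, hκ, hreg⟩ := hT.exists_one_le
  obtain ⟨C, hC, happ⟩ := happ.exists_eventually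
  obtain ⟨⟨M, hM⟩, hQ⟩ := hQ
  have hquad := fun j => (hQ (q j) (hq j)).exists_eventually
  choose Cq hCq hquad using hquad
  obtain ⟨O, hO, hΩO, hqO⟩ := SmoothNear.exists_common hq
  have hqO1 : ∀ j, ContDiffOn ℝ 1 (q j) O := fun j => (hqO j).of_le (by
    exact_mod_cast Nat.le_add_left 1 k)
  set D : ℝ := C * κ ^ (k + 1) with hD
  have hD0 : 0 ≤ D := by positivity
  set A : ℝ := 2 ^ d * unitBallVolume d with hA
  have hA0 : 0 ≤ A := mul_nonneg (by positivity) (unitBallVolume_pos d).le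
  have hsmall : ∀ᶠ i in fineMeshes T, D * (T i).size ^ (k + 1) < ε := by
    have h := ((tendsto_size T).pow (k + 1)).const_mul D
    rw [zero_pow (Nat.succ_ne_zero k), mul_zero] at h
    exact h.eventually_lt_const hε
  rw [elementO_iff]
  refine ⟨κ * (A * (|M| * (L * (2 * D))) + ∑ j, Cq j), by
    have := Finset.sum_nonneg fun j (_ : j ∈ Finset.univ) => hCq j
    positivity, ?_⟩
  filter_upwards [hadm, happ, hsmall, Filter.eventually_all.2 hquad] with i hadm happ hsmall hquad K
  set h : ℝ := (T i).diam K with hh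
  have hh0 : 0 ≤ h := (T i).diam_nonneg K
  have hnorm : ∀ f, ‖(T i).normal K f‖ = 1 := fun f => ((T i).elem K).norm_normal hd _
  have hDh : D * h ^ (k + 1) < ε := lt_of_le_of_lt
    (mul_le_mul_of_nonneg_left (pow_le_pow_left₀ hh0 ((T i).diam_le_size K) _) hD0) hsmall
  -- the approximation error on a facet
  have herr : ∀ f ∈ (T i).facets K, ∀ x ∈ (T i).facet f,
      |F ((T i).normal K f) (evalOn B (Vh i) K x) (evalOn B (Vh i) ((T i).opposite K f) x) -
        ∑ j, (T i).normal K f j * q j x| ≤ L * (2 * D) * h ^ (k + 1) := by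
    intro f hf x hx
    have hxK := (T i).facet_subset_carrier hf hx
    have hxK' := (T i).facet_subset_opposite hf hx
    have hxΩ := (T i).carrier_subset_closure K hxK
    have hdiam : (T i).diam ((T i).opposite K f) ≤ κ * h := by
      rcases (T i).opposite_eq_or_mem K f with ho | ho
      · rw [ho]
        exact le_mul_of_one_le_left hh0 hκ
      · exact (hreg i).2.2 K _ f hf ho
    have h1 : ‖evalOn B (Vh i) K x - V x‖ ≤ D * h ^ (k + 1) := by
      refine (happ K x hxK).trans ?_
      rw [hD, mul_assoc]
      refine mul_le_mul_of_nonneg_left ?_ hC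
      exact le_mul_of_one_le_left (by positivity) (one_le_pow₀ hκ)
    have h2 : ‖evalOn B (Vh i) ((T i).opposite K f) x - V x‖ ≤ D * h ^ (k + 1) := by
      refine (happ _ x hxK').trans ?_
      rw [hD, mul_assoc, ← mul_pow]
      refine mul_le_mul_of_nonneg_left ?_ hC
      exact pow_le_pow_left₀ ((T i).diam_nonneg _) hdiam _
    rw [← hcons _ (hnorm f) x hxΩ]
    refine (hlip _ (hnorm f) (V x) ⟨x, hxΩ, rfl⟩ _ ⟨hadm K x hxK, ?_⟩ _
      ⟨hadm _ x hxK', ?_⟩).trans ?_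
    · rw [Metric.mem_ball, dist_eq_norm]
      exact h1.trans_lt hDh
    · rw [Metric.mem_ball, dist_eq_norm]
      exact h2.trans_lt hDh
    · rw [mul_assoc]
      refine mul_le_mul_of_nonneg_left ?_ hL
      linarith
  have hhd : h ^ (d - 1) * h ^ (k + 1) = h ^ (k + d) := by
    rw [← pow_add]
    congr 1
    omega
  -- the error on a facet
  have hfacet : ∀ f ∈ (T i).facets K,
      |(Q i).integral f (fun x => F ((T i).normal K f) (evalOn B (Vh i) K x)
          (evalOn B (Vh i) ((T i).opposite K f) x)) -
        ∑ j, (T i).normal K f j * ∫ x in (T i).facet f, q j x ∂μHE[d - 1]| ≤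
      (A * (|M| * (L * (2 * D))) + ∑ j, Cq j) * h ^ (k + d) := by
    intro f hf
    have hsplit : (Q i).integral f (fun x => F ((T i).normal K f) (evalOn B (Vh i) K x)
          (evalOn B (Vh i) ((T i).opposite K f) x)) -
        ∑ j, (T i).normal K f j * ∫ x in (T i).facet f, q j x ∂μHE[d - 1] =
        (Q i).integral f (fun x => F ((T i).normal K f) (evalOn B (Vh i) K x)
          (evalOn B (Vh i) ((T i).opposite K f) x) - ∑ j, (T i).normal K f j * q j x) -
        ∑ j, (T i).normal K f j *
          ((∫ x in (T i).facet f, q j x ∂μHE[d - 1]) - (Q i).integral f (q j)) := by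
      have hlin : (Q i).integral f (fun x => ∑ j, (T i).normal K f j * q j x) =
          ∑ j, (T i).normal K f j * (Q i).integral f (q j) := by
        simp only [FacetQuadrature.integral, smul_eq_mul, Finset.mul_sum]
        rw [Finset.sum_comm]
        refine Finset.sum_congr rfl fun j _ => Finset.sum_congr rfl fun r _ => ?_
        ring
      have hsub : ∀ φ ψ : Eu d → ℝ, (Q i).integral f (fun x => φ x - ψ x) =
          (Q i).integral f φ - (Q i).integral f ψ := by
        intro φ ψ
        simp only [FacetQuadrature.integral, smul_eq_mul, mul_sub, Finset.sum_sub_distrib]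
      rw [hsub, hlin]
      simp only [mul_sub, Finset.sum_sub_distrib]
      ring
    rw [hsplit]
    refine (abs_sub _ _).trans ?_
    rw [add_mul]
    refine add_le_add ?_ ?_
    · refine ((Q i).abs_integral_le f ((hM i f).trans (le_abs_self M)) (by positivity)
        (herr f hf)).trans ?_
      calc (T i).area f * (|M| * (L * (2 * D) * h ^ (k + 1)))
          ≤ A * h ^ (d - 1) * (|M| * (L * (2 * D) * h ^ (k + 1))) :=
            mul_le_mul_of_nonneg_right ((T i).area_le hd hf) (by positivity)
        _ = A * (|M| * (L * (2 * D))) * (h ^ (d - 1) * h ^ (k + 1)) := by ring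
        _ = _ := by rw [hhd]
    · refine (Finset.abs_sum_le_sum_abs _ _).trans ?_
      rw [Finset.sum_mul]
      refine Finset.sum_le_sum fun j _ => ?_
      rw [abs_mul, add_comm k d]
      refine (mul_le_of_le_one_left (abs_nonneg _) ((T i).abs_normal_le hd K f j)).trans ?_
      exact hquad j K f hf
  have hzero := (T i).sum_facets_integral_eq_zero hd K hO hΩO hqO1 hdiv
  have hE0 : 0 ≤ (A * (|M| * (L * (2 * D))) + ∑ j, Cq j) * h ^ (k + d) := by
    have := Finset.sum_nonneg fun j (_ : j ∈ Finset.univ) => hCq j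
    positivity
  calc |boundaryIntegral B (Q i) F (Vh i) K|
      = |∑ f ∈ (T i).facets K, ((Q i).integral f (fun x => F ((T i).normal K f)
          (evalOn B (Vh i) K x) (evalOn B (Vh i) ((T i).opposite K f) x)) -
        ∑ j, (T i).normal K f j * ∫ x in (T i).facet f, q j x ∂μHE[d - 1])| := by
        rw [Finset.sum_sub_distrib, hzero, sub_zero]
        rfl
    _ ≤ ∑ f ∈ (T i).facets K, (A * (|M| * (L * (2 * D))) + ∑ j, Cq j) * h ^ (k + d) :=
        (Finset.abs_sum_le_sum_abs _ _).trans (Finset.sum_le_sum hfacet)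
    _ ≤ κ * ((A * (|M| * (L * (2 * D))) + ∑ j, Cq j) * h ^ (k + d)) := by
        rw [Finset.sum_const, nsmul_eq_mul]
        exact mul_le_mul_of_nonneg_right ((hreg i).2.1 K) hE0
    _ = _ := by ring

end FluxBalance

/-! ### Smooth steady solutions -/

section SteadySolution

variable {d p k : ℕ} {Ω : Set (Eu d)} {sys : EntropySystem d p} {u : Eu d → Eu p}

/-- The equation extends to the boundary of the domain by continuity. -/
lemma IsSmoothSteadySolution.div_flux_eq_zero (hu : IsSmoothSteadySolution sys Ω (k + 1) u)
    {x : Eu d} (hx : x ∈ closure Ω) :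
    ∑ j, fderiv ℝ (fun y => sys.f j (u y)) x (EuclideanSpace.single j 1) = 0 := by
  have hcont : ContinuousOn
      (fun x => ∑ j, fderiv ℝ (fun y => sys.f j (u y)) x (EuclideanSpace.single j 1))
      (closure Ω) := by
    refine continuousOn_finsetSum _ fun j _ => ?_
    obtain ⟨O, hO, hΩO, hf⟩ := hu.smooth_f j
    exact ((hf.continuousOn_fderiv_of_isOpen hO (by exact_mod_cast Nat.le_add_left 1 k)).clm_apply
      continuousOn_const).mono hΩO
  have h : Set.EqOn
      (fun x => ∑ j, fderiv ℝ (fun y => sys.f j (u y)) x (EuclideanSpace.single j 1))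
      (fun _ => 0) Ω := fun x hx => hu.div_eq_zero x hx
  exact h.of_subset_closure hcont continuousOn_const subset_closure subset_rfl hx

/-- The entropy is conserved by smooth solutions: `div g(u) = ∇U(u) · div f(u)`. -/
lemma IsSmoothSteadySolution.div_entropyFlux_eq_zero
    (hu : IsSmoothSteadySolution sys Ω (k + 1) u) {x : Eu d} (hx : x ∈ closure Ω) :
    ∑ j, fderiv ℝ (fun y => sys.g j (u y)) x (EuclideanSpace.single j 1) = 0 := by
  obtain ⟨O, hO, hΩO, hus⟩ := hu.smooth
  have hdu : HasFDerivAt u (fderiv ℝ u x) x :=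
    ((hus.contDiffAt (hO.mem_nhds (hΩO hx))).differentiableAt (by simp)).hasFDerivAt
  have hD := sys.isOpen_D.mem_nhds (hu.mem_D x hx)
  have hchain : ∀ j, fderiv ℝ (fun y => sys.g j (u y)) x =
      (fderiv ℝ sys.U (u x)).comp (fderiv ℝ (fun y => sys.f j (u y)) x) := by
    intro j
    have hg : HasFDerivAt (sys.g j) (fderiv ℝ (sys.g j) (u x)) (u x) :=
      (((sys.contDiffOn_g j).contDiffAt hD).differentiableAt (by simp)).hasFDerivAt
    have hf : HasFDerivAt (sys.f j) (fderiv ℝ (sys.f j) (u x)) (u x) :=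
      (((sys.contDiffOn_f j).contDiffAt hD).differentiableAt (by simp)).hasFDerivAt
    have hgu : fderiv ℝ (fun y => sys.g j (u y)) x =
        (fderiv ℝ (sys.g j) (u x)).comp (fderiv ℝ u x) := (hg.comp x hdu).fderiv
    have hfu : fderiv ℝ (fun y => sys.f j (u y)) x =
        (fderiv ℝ (sys.f j) (u x)).comp (fderiv ℝ u x) := (hf.comp x hdu).fderiv
    rw [hgu, hfu, ← sys.compatible j (u x) (hu.mem_D x hx)]
    rfl
  simp only [hchain, ContinuousLinearMap.comp_apply]
  rw [← map_sum, hu.div_flux_eq_zero hx, map_zero]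

lemma IsSmoothSteadySolution.entropyVar_mem (hu : IsSmoothSteadySolution sys Ω (k + 1) u)
    {x : Eu d} (hx : x ∈ closure Ω) : sys.entropyVar (u x) ∈ sys.W :=
  ⟨u x, hu.mem_D x hx, rfl⟩

lemma IsSmoothSteadySolution.continuousOn_entropyVar
    (hu : IsSmoothSteadySolution sys Ω (k + 1) u) :
    ContinuousOn (fun x => sys.entropyVar (u x)) (closure Ω) := by
  obtain ⟨O, hO, hΩO, h⟩ := hu.smooth_entropyVar
  exact h.continuousOn.mono hΩO

variable {ι : Type} {s : SpaceKind} {T : ι → Mesh d Ω}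

/-- The entropy flux through the boundary of an element is of order `k + d`. -/
lemma IsSmoothSteadySolution.boundaryIntegral_entropyFlux (hd : 1 ≤ d)
    (hu : IsSmoothSteadySolution sys Ω (k + 1) u)
    (hT : IsRegularFamily T) (B : ShapeFunctions d k)
    {Q : ∀ i, FacetQuadrature (T i)} (hQ : IsQuadratureOfOrder T Q k)
    {ghat : NumFlux d p ℝ} (hg : IsConsistent sys sys.normalEntropyFlux ghat)
    (hgL : IsLipschitzFlux sys ghat) {Vh : ∀ i, DiscreteField (T i) s k (Eu p)}
    (hadm : ∀ᶠ i in fineMeshes T, IsAdmissible sys B (Vh i))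
    (happ : IsApproximation T B (k + 1) (fun x => sys.entropyVar (u x)) Vh) :
    ElementO T (k + d) fun i K => boundaryIntegral B (Q i) ghat (Vh i) K :=
  boundaryIntegral_elementO hd T hT B hQ hgL hu.smooth_g (fun _ hx => hu.div_entropyFlux_eq_zero hx)
    hu.continuousOn_entropyVar (fun _ hx => hu.entropyVar_mem hx)
    (fun n hn x hx => hg n hn (u x) (hu.mem_D x hx)) hadm happ

/-- The flux of the conserved variables through the boundary of an element is of order `k + d`. -/
lemma IsSmoothSteadySolution.boundaryIntegral_flux (hd : 1 ≤ d)
    (hu : IsSmoothSteadySolution sys Ω (k + 1) u)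
    (hT : IsRegularFamily T) (B : ShapeFunctions d k)
    {Q : ∀ i, FacetQuadrature (T i)} (hQ : IsQuadratureOfOrder T Q k)
    {fhat : NumFlux d p (Eu p)} (hf : IsConsistent sys sys.normalFlux fhat)
    (hfL : IsLipschitzFlux sys fhat) {Vh : ∀ i, DiscreteField (T i) s k (Eu p)}
    (hadm : ∀ᶠ i in fineMeshes T, IsAdmissible sys B (Vh i))
    (happ : IsApproximation T B (k + 1) (fun x => sys.entropyVar (u x)) Vh) :
    ElementO T (k + d) fun i K => ‖boundaryIntegral B (Q i) fhat (Vh i) K‖ := by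
  -- each component is the integral of a scalar flux
  have hcomp : ∀ l : Fin p, ElementO T (k + d) fun i K =>
      boundaryIntegral B (Q i) (fun n a b => fhat n a b l) (Vh i) K := by
    intro l
    let π : Eu p →L[ℝ] ℝ := EuclideanSpace.proj l
    have hdiff : ∀ j, ∀ x ∈ closure Ω, fderiv ℝ (fun y => sys.f j (u y) l) x =
        π.comp (fderiv ℝ (fun y => sys.f j (u y)) x) := by
      intro j x hx
      obtain ⟨O, hO, hΩO, hfs⟩ := hu.smooth_f j
      have h : HasFDerivAt (fun y => sys.f j (u y)) _ x :=
        ((hfs.contDiffAt (hO.mem_nhds (hΩO hx))).differentiableAt (by simp)).hasFDerivAt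
      exact (π.hasFDerivAt.comp x h).fderiv
    refine boundaryIntegral_elementO hd T hT B hQ (q := fun j x => sys.f j (u x) l) ?_ ?_ ?_
      hu.continuousOn_entropyVar (fun _ hx => hu.entropyVar_mem hx) ?_ hadm happ
    · intro a₀ ha₀ b₀ hb₀
      obtain ⟨ε, hε, L, h⟩ := hfL a₀ ha₀ b₀ hb₀
      refine ⟨ε, hε, L, fun n hn a ha a' ha' b hb b' hb' => ?_⟩
      refine le_trans ?_ (h n hn a ha a' ha' b hb b' hb')
      exact PiLp.norm_apply_le (fhat n a b - fhat n a' b') l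
    · intro j
      obtain ⟨O, hO, hΩO, hfs⟩ := hu.smooth_f j
      exact ⟨O, hO, hΩO, π.contDiff.comp_contDiffOn hfs⟩
    · intro x hx
      simp only [hdiff _ x hx, ContinuousLinearMap.comp_apply]
      rw [← map_sum, hu.div_flux_eq_zero hx, map_zero]
    · intro n hn x hx
      have h := hf n hn (u x) (hu.mem_D x hx)
      simp only [h, EntropySystem.normalFlux]
      simp
  have hcomp' := fun l => (elementO_iff T).1 (hcomp l)
  choose C hC h using hcomp'
  rw [elementO_iff]
  refine ⟨∑ l, C l, Finset.sum_nonneg fun l _ => hC l, ?_⟩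
  filter_upwards [Filter.eventually_all.2 h] with i h K
  have hl : ∀ l, (boundaryIntegral B (Q i) fhat (Vh i) K) l =
      boundaryIntegral B (Q i) (fun n a b => fhat n a b l) (Vh i) K := by
    intro l
    simp [boundaryIntegral, FacetQuadrature.integral]
  rw [abs_of_nonneg (norm_nonneg _), Finset.sum_mul]
  calc ‖boundaryIntegral B (Q i) fhat (Vh i) K‖
      ≤ ∑ l, ‖(boundaryIntegral B (Q i) fhat (Vh i) K) l‖ := by
        conv_lhs => rw [← (EuclideanSpace.basisFun (Fin p) ℝ).sum_repr
          (boundaryIntegral B (Q i) fhat (Vh i) K)]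
        refine (norm_sum_le _ _).trans (Finset.sum_le_sum fun l _ => ?_)
        rw [norm_smul, (EuclideanSpace.basisFun (Fin p) ℝ).orthonormal.1 l, mul_one]
        rfl
    _ ≤ _ := Finset.sum_le_sum fun l _ => by
        rw [hl, Real.norm_eq_abs]
        exact h l K

end SteadySolution

/-! ### Bounds on the degrees of freedom -/

section Coefficients

variable {d p k : ℕ} {Ω : Set (Eu d)} {ι : Type} {s : SpaceKind} {T : ι → Mesh d Ω}

lemma evalOn_eq_comb {T : Mesh d Ω} {Y : Type} [NormedAddCommGroup Y] [NormedSpace ℝ Y]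
    (B : ShapeFunctions d k) (v : DiscreteField T s k Y) (K : Fin T.nElem) (x : Eu d) :
    evalOn B v K x = B.comb (fun α => v (T.dof s K α)) fun l => (T.elem K).coord l x := rfl

/-- The degrees of freedom of the approximations of a bounded function are bounded. -/
lemma IsApproximation.exists_norm_coeff_le {m : ℕ} {B : ShapeFunctions d k} {V : Eu d → Eu p}
    (hV : ContinuousOn V (closure Ω)) {Vh : ∀ i, DiscreteField (T i) s k (Eu p)}
    (happ : IsApproximation T B m V Vh) :
    ∃ R, 0 ≤ R ∧ ∀ᶠ i in fineMeshes T, ∀ K α, ‖Vh i ((T i).dof s K α)‖ ≤ R := by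
  rcases isEmpty_or_nonempty ι with hι | ⟨⟨i₀⟩⟩
  · exact ⟨0, le_rfl, Filter.Eventually.of_forall fun i => (hι.false i).elim⟩
  obtain ⟨C₀, hC₀, hcoeff⟩ := B.exists_norm_coeff_le (Y := Eu p)
  obtain ⟨C, hC, happ⟩ := happ.exists_eventually
  obtain ⟨R, hR⟩ := (T i₀).isCompact_closure.exists_bound_of_continuousOn hV
  refine ⟨C₀ * (|R| + C), by positivity, ?_⟩
  filter_upwards [happ, eventually_size_lt T one_pos] with i happ hsize K α
  refine hcoeff (fun α => Vh i ((T i).dof s K α)) _ (fun l hl => ?_) α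
  obtain ⟨x, hx, rfl⟩ := ((T i).elem K).exists_coord_eq hl
  rw [← evalOn_eq_comb]
  have h1 := happ K x hx
  have h2 := hR x ((T i).carrier_subset_closure K hx)
  have h3 : (T i).diam K ^ m ≤ 1 :=
    pow_le_one₀ ((T i).diam_nonneg K) (((T i).diam_le_size K).trans hsize.le)
  calc ‖evalOn B (Vh i) K x‖ = ‖V x + (evalOn B (Vh i) K x - V x)‖ := by
        rw [add_sub_cancel]
    _ ≤ ‖V x‖ + ‖evalOn B (Vh i) K x - V x‖ := norm_add_le _ _
    _ ≤ |R| + C := by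
        refine add_le_add (h2.trans (le_abs_self R)) (h1.trans ?_)
        exact mul_le_of_le_one_right hC h3

end Coefficients

/-! ### The spread of the degrees of freedom -/

section Spread

variable {d p k : ℕ} {Ω : Set (Eu d)} {ι : Type} {s : SpaceKind}

lemma norm_dof_sub_mean_le {T : Mesh d Ω} (V : DiscreteField T s k (Eu p)) (K : Fin T.nElem)
    (α : Idx d k) : ‖V (T.dof s K α) - mean V K‖ ≤ √(spread V K) := by
  refine Real.le_sqrt_of_sq_le ?_
  exact Finset.single_le_sum (f := fun α => ‖V (T.dof s K α) - mean V K‖ ^ 2)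
    (fun β _ => sq_nonneg _) (Finset.mem_univ α)

lemma spread_nonneg {T : Mesh d Ω} (V : DiscreteField T s k (Eu p)) (K : Fin T.nElem) :
    0 ≤ spread V K := Finset.sum_nonneg fun _ _ => sq_nonneg _

/-- The oscillation of a discrete field on an element is controlled by the spread of its degrees of
freedom, because the shape functions sum to one. -/
lemma ShapeFunctions.exists_norm_evalOn_sub_le (B : ShapeFunctions d k) :
    ∃ M, 0 < M ∧ ∀ (T : Mesh d Ω) (V : DiscreteField T s k (Eu p)) (K : Fin T.nElem),
      ∀ x ∈ (T.elem K).carrier, ∀ y ∈ (T.elem K).carrier,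
        ‖evalOn B V K y - evalOn B V K x‖ ≤ M * √(spread V K) := by
  obtain ⟨M, hM, h⟩ := B.exists_norm_comb_le (Y := Eu p)
  refine ⟨2 * M + 1, by positivity, fun T V K x hx y hy => ?_⟩
  have key : ∀ z ∈ (T.elem K).carrier, ‖evalOn B V K z - mean V K‖ ≤ M * √(spread V K) := by
    intro z hz
    have hz' := (T.elem K).coord_mem_stdSimplex hz
    rw [evalOn_eq_comb, ← B.comb_sub_const _ _ hz'.2]
    exact h _ _ (norm_dof_sub_mean_le V K) _ hz'
  have hs := Real.sqrt_nonneg (spread V K)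
  calc ‖evalOn B V K y - evalOn B V K x‖
      = ‖(evalOn B V K y - mean V K) - (evalOn B V K x - mean V K)‖ := by
        rw [sub_sub_sub_cancel_right]
    _ ≤ M * √(spread V K) + M * √(spread V K) :=
        (norm_sub_le _ _).trans (add_le_add (key y hy) (key x hx))
    _ ≤ _ := by linarith

/-- Where the gradient of the limit does not vanish, the degrees of freedom of its approximations
on an element differ by at least a multiple of the diameter: the ball inscribed in the element
contains a segment along which the limit varies that much. -/
lemma IsApproximation.exists_spread_ge (hk : 1 ≤ k) {T : ι → Mesh d Ω}
    (hT : IsRegularFamily T) (B : ShapeFunctions d k) {V : Eu d → Eu p}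
    (hV : SmoothNear Ω (k + 1) V) (hne : ∀ x ∈ closure Ω, fderiv ℝ V x ≠ 0)
    {Vh : ∀ i, DiscreteField (T i) s k (Eu p)} (happ : IsApproximation T B (k + 1) V Vh) :
    ∃ c, 0 < c ∧ ∀ᶠ i in fineMeshes T, ∀ K, c * (T i).diam K ^ 2 ≤ spread (Vh i) K := by
  rcases isEmpty_or_nonempty ι with hι | ⟨⟨i₀⟩⟩
  · exact ⟨1, one_pos, Filter.Eventually.of_forall fun i => (hι.false i).elim⟩
  obtain ⟨κ, hκ, hreg⟩ := hT.exists_one_le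
  obtain ⟨C, hC, happ⟩ := happ.exists_eventually
  obtain ⟨M, hM, hosc⟩ := B.exists_norm_evalOn_sub_le (Ω := Ω) (s := s) (p := p)
  obtain ⟨O, hO, hΩO, hVO⟩ := hV
  have hcomp : IsCompact (closure Ω) := (T i₀).isCompact_closure
  have hcont : ContinuousOn (fderiv ℝ V) (closure Ω) :=
    (hVO.continuousOn_fderiv_of_isOpen hO (by exact_mod_cast Nat.le_add_left 1 k)).mono hΩO
  have hdiff : ∀ x ∈ closure Ω, DifferentiableAt ℝ V x := fun x hx =>
    (hVO.contDiffAt (hO.mem_nhds (hΩO hx))).differentiableAt (by simp)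
  obtain ⟨m, hm, hmin⟩ := hcomp.exists_forall_le' hcont.norm (a := 0)
    fun x hx => norm_pos_iff.2 (hne x hx)
  obtain ⟨δ, hδ, huc⟩ := Metric.uniformContinuousOn_iff.1
    (hcomp.uniformContinuousOn_of_continuous hcont) (m / 4) (by positivity)
  have hκ0 : 0 < κ := by linarith
  refine ⟨(m / (8 * κ * M)) ^ 2, by positivity, ?_⟩
  have hsmall : ∀ᶠ i in fineMeshes T, 2 * C * (T i).size < m / (8 * κ) := by
    have h := (tendsto_size T).const_mul (2 * C)
    rw [mul_zero] at h
    exact h.eventually_lt_const (by positivity)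
  filter_upwards [happ, hsmall, eventually_size_lt T hδ, eventually_size_lt T one_pos]
    with i happ hsmall hsδ hs1 K
  set h : ℝ := (T i).diam K with hh
  have hh0 : 0 ≤ h := (T i).diam_nonneg K
  have hhs : h ≤ (T i).size := (T i).diam_le_size K
  obtain ⟨x, hx⟩ := (hreg i).1 K
  have hxK : x ∈ ((T i).elem K).carrier := hx (Metric.mem_closedBall_self (by positivity))
  have hKΩ := (T i).carrier_subset_closure K
  obtain ⟨e, he1, he⟩ := (fderiv ℝ V x).exists_lt_apply_of_lt_opNorm
    (r := m / 2) ((half_lt_self hm).trans_le (hmin x (hKΩ hxK)))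
  set r : ℝ := h / κ with hr
  have hr0 : 0 ≤ r := by positivity
  have hre : ‖r • e‖ ≤ r := by
    rw [norm_smul, Real.norm_of_nonneg hr0]
    exact mul_le_of_le_one_right hr0 he1.le
  have hyK : x + r • e ∈ ((T i).elem K).carrier := hx (by
    rw [Metric.mem_closedBall, dist_eq_norm, add_sub_cancel_left]
    exact hre)
  have hmv : ‖V (x + r • e) - V x - fderiv ℝ V x (x + r • e - x)‖ ≤
      m / 4 * ‖x + r • e - x‖ := by
    refine Convex.norm_image_sub_le_of_norm_fderiv_le' (𝕜 := ℝ)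
      (fun z hz => hdiff z (hKΩ hz)) (fun z hz => ?_) ((T i).elem K).convex_carrier hxK hyK
    rw [← dist_eq_norm]
    refine (huc z (hKΩ hz) x (hKΩ hxK) ?_).le
    exact (((T i).elem K).dist_le_diam hz hxK).trans_lt (hhs.trans_lt hsδ)
  rw [add_sub_cancel_left, map_smul] at hmv
  have hlow : r * (m / 4) ≤ ‖V (x + r • e) - V x‖ := by
    have h1 : r * (m / 2) ≤ ‖r • fderiv ℝ V x e‖ := by
      rw [norm_smul, Real.norm_of_nonneg hr0]
      exact mul_le_mul_of_nonneg_left he.le hr0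
    have h2 : ‖r • fderiv ℝ V x e‖ ≤ ‖V (x + r • e) - V x‖ +
        ‖V (x + r • e) - V x - r • fderiv ℝ V x e‖ := norm_le_norm_add_norm_sub _ _
    have h3 : m / 4 * ‖r • e‖ ≤ m / 4 * r := mul_le_mul_of_nonneg_left hre (by positivity)
    linarith
  have herr : C * h ^ (k + 1) ≤ C * (T i).size * h := by
    rw [pow_succ, mul_assoc]
    refine mul_le_mul_of_nonneg_left (mul_le_mul_of_nonneg_right ?_ hh0) hC
    exact (pow_le_of_le_one hh0 (hhs.trans hs1.le) (by omega)).trans hhs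
  have hdisc : h * (m / (8 * κ)) ≤ ‖evalOn B (Vh i) K (x + r • e) - evalOn B (Vh i) K x‖ := by
    have h1 := happ K x hxK
    have h2 := happ K _ hyK
    have h3 : ‖V (x + r • e) - V x‖ ≤
        ‖evalOn B (Vh i) K (x + r • e) - evalOn B (Vh i) K x‖ +
        ‖evalOn B (Vh i) K (x + r • e) - V (x + r • e)‖ + ‖evalOn B (Vh i) K x - V x‖ := by
      have : V (x + r • e) - V x = (evalOn B (Vh i) K (x + r • e) - evalOn B (Vh i) K x) -
        (evalOn B (Vh i) K (x + r • e) - V (x + r • e)) + (evalOn B (Vh i) K x - V x) := by abel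
      rw [this]
      refine (norm_add_le _ _).trans (add_le_add ?_ le_rfl)
      exact norm_sub_le _ _
    have h4 : 2 * C * (T i).size * h ≤ m / (8 * κ) * h :=
      mul_le_mul_of_nonneg_right hsmall.le hh0
    have h5 : r * (m / 4) = 2 * (m / (8 * κ) * h) := by
      rw [hr]
      field_simp
      ring
    linarith
  have hfin : m / (8 * κ * M) * h ≤ √(spread (Vh i) K) := by
    have h1 := hdisc.trans (hosc (T i) (Vh i) K x hxK _ hyK)
    calc m / (8 * κ * M) * h = h * (m / (8 * κ)) / M := by field_simp
      _ ≤ M * √(spread (Vh i) K) / M := div_le_div_of_nonneg_right h1 hM.le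
      _ = _ := by field_simp
  rw [← mul_pow, ← Real.sq_sqrt (spread_nonneg (Vh i) K)]
  exact pow_le_pow_left₀ (by positivity) hfin 2

end Spread

/-! ### Size of the entropy correction -/

section Correction

variable {d p k : ℕ} {Ω : Set (Eu d)} {ι : Type} {s : SpaceKind} {sys : EntropySystem d p}
  {T : ι → Mesh d Ω} {B : ShapeFunctions d k} {Q : ∀ i, FacetQuadrature (T i)}
  {fhat : NumFlux d p (Eu p)} {ub : Eu d → Eu p}

lemma ElementO.of_le {m : ℕ} {q q' : ∀ i, Fin (T i).nElem → ℝ} (h : ElementO T m q)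
    (hq : ∀ i K, |q' i K| ≤ |q i K|) : ElementO T m q' := by
  obtain ⟨C, h₀, hh₀, h⟩ := h
  exact ⟨C, h₀, hh₀, fun i hi K => (hq i K).trans (h i hi K)⟩

lemma ElementO.add {m : ℕ} {q q' : ∀ i, Fin (T i).nElem → ℝ} (h : ElementO T m q)
    (h' : ElementO T m q') : ElementO T m fun i K => q i K + q' i K := by
  rw [elementO_iff] at *
  obtain ⟨C, hC, h⟩ := h
  obtain ⟨C', hC', h'⟩ := h'
  refine ⟨C + C', by positivity, ?_⟩
  filter_upwards [h, h'] with i h h' K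
  rw [add_mul]
  exact (abs_add_le _ _).trans (add_le_add (h K) (h' K))

lemma ElementO.mono_order {m m' : ℕ} (hm : m' ≤ m) {q : ∀ i, Fin (T i).nElem → ℝ}
    (h : ElementO T m q) : ElementO T m' q := by
  rw [elementO_iff] at *
  obtain ⟨C, hC, h⟩ := h
  refine ⟨C, hC, ?_⟩
  filter_upwards [h, eventually_size_lt T one_pos] with i h hs K
  refine (h K).trans (mul_le_mul_of_nonneg_left ?_ hC)
  exact pow_le_pow_of_le_one ((T i).diam_nonneg K) (((T i).diam_le_size K).trans hs.le) hm

/-- The entropy defect has the order of the flux integrals and of the residuals. -/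
lemma entropyDefect_elementO {m : ℕ} (S : ∀ i, ResidualScheme sys (T i) s B (Q i) fhat ub)
    {ghat : NumFlux d p ℝ} {Vh : ∀ i, DiscreteField (T i) s k (Eu p)}
    (hg : ElementO T m fun i K => boundaryIntegral B (Q i) ghat (Vh i) K)
    (hbdd : ∃ R, 0 ≤ R ∧ ∀ᶠ i in fineMeshes T, ∀ K α, ‖Vh i ((T i).dof s K α)‖ ≤ R)
    (hres : ∀ α, ElementO T m fun i K => ‖(S i).res (Vh i) K α‖) :
    ElementO T m fun i K => (S i).entropyDefect ghat (Vh i) K := by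
  have hres' := fun α => (elementO_iff T).1 (hres α)
  choose C hC hres using hres'
  obtain ⟨D, hD, hg⟩ := (elementO_iff T).1 hg
  obtain ⟨R, hR, hbdd⟩ := hbdd
  rw [elementO_iff]
  refine ⟨D + ∑ α, R * C α, by
    have := Finset.sum_nonneg fun α (_ : α ∈ Finset.univ) => mul_nonneg hR (hC α)
    positivity, ?_⟩
  filter_upwards [hg, hbdd, Filter.eventually_all.2 hres] with i hg hbdd hres K
  rw [ResidualScheme.entropyDefect, add_mul, Finset.sum_mul]
  refine (abs_sub _ _).trans (add_le_add (hg K) ?_)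
  refine (Finset.abs_sum_le_sum_abs _ _).trans (Finset.sum_le_sum fun α _ => ?_)
  have h := hres α K
  rw [abs_of_nonneg (norm_nonneg _)] at h
  rw [mul_assoc]
  exact (abs_real_inner_le_norm _ _).trans (mul_le_mul (hbdd K α) h (norm_nonneg _) hR)

variable {ghat : NumFlux d p ℝ} {Vh : ∀ i, DiscreteField (T i) s k (Eu p)}

lemma coeff_elementO (hd : 1 ≤ d) (hk : 1 ≤ k)
    (S : ∀ i, ResidualScheme sys (T i) s B (Q i) fhat ub)
    (hE : ElementO T (k + d) fun i K => (S i).entropyDefect ghat (Vh i) K)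
    (hspread : ∃ c, 0 < c ∧ ∀ᶠ i in fineMeshes T, ∀ K,
      c * (T i).diam K ^ 2 ≤ spread (Vh i) K) :
    ElementO T (k + d - 2) fun i K => (S i).coeff ghat (Vh i) K := by
  obtain ⟨C, hC, hE⟩ := (elementO_iff T).1 hE
  obtain ⟨c, hc, hspread⟩ := hspread
  rw [elementO_iff]
  refine ⟨C / c, by positivity, ?_⟩
  filter_upwards [hE, hspread] with i hE hspread K
  have hdiam : 0 < (T i).diam K := ((T i).elem K).diam_pos hd
  have hpos : 0 < c * (T i).diam K ^ 2 := by positivity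
  rw [ResidualScheme.coeff, abs_div, abs_of_nonneg (spread_nonneg _ _)]
  calc |(S i).entropyDefect ghat (Vh i) K| / spread (Vh i) K
      ≤ C * (T i).diam K ^ (k + d) / (c * (T i).diam K ^ 2) :=
        div_le_div₀ (by positivity) (hE K) hpos (hspread K)
    _ = C / c * (T i).diam K ^ (k + d - 2) := by
        have : k + d = k + d - 2 + 2 := by omega
        rw [this, pow_add]
        simp only [Nat.add_sub_cancel]
        field_simp

/-- One order is lost with respect to the defect: `|r_σ| ≤ |𝓔| / (∑ |V_σ - V̄|²)^{1/2}`. -/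
lemma correction_elementO (hd : 1 ≤ d) (hk : 1 ≤ k)
    (S : ∀ i, ResidualScheme sys (T i) s B (Q i) fhat ub)
    (hE : ElementO T (k + d) fun i K => (S i).entropyDefect ghat (Vh i) K)
    (hspread : ∃ c, 0 < c ∧ ∀ᶠ i in fineMeshes T, ∀ K,
      c * (T i).diam K ^ 2 ≤ spread (Vh i) K)
    (α : Idx d k) :
    ElementO T (k + d - 1) fun i K => ‖(S i).correction ghat (Vh i) K α‖ := by
  obtain ⟨C, hC, hE⟩ := (elementO_iff T).1 hE
  obtain ⟨c, hc, hspread⟩ := hspread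
  rw [elementO_iff]
  refine ⟨C / √c, by positivity, ?_⟩
  filter_upwards [hE, hspread] with i hE hspread K
  have hdiam : 0 < (T i).diam K := ((T i).elem K).diam_pos hd
  have hsp : 0 < spread (Vh i) K := lt_of_lt_of_le (by positivity) (hspread K)
  have hsq : √c * (T i).diam K ≤ √(spread (Vh i) K) := by
    refine Real.le_sqrt_of_sq_le ?_
    rw [mul_pow, Real.sq_sqrt hc.le]
    exact hspread K
  have hsqc : 0 < √c := Real.sqrt_pos.2 hc
  rw [abs_of_nonneg (norm_nonneg _), ResidualScheme.correction, norm_smul, ResidualScheme.coeff,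
    norm_div, Real.norm_eq_abs, Real.norm_of_nonneg hsp.le]
  calc |(S i).entropyDefect ghat (Vh i) K| / spread (Vh i) K *
        ‖Vh i ((T i).dof s K α) - mean (Vh i) K‖
      ≤ |(S i).entropyDefect ghat (Vh i) K| / spread (Vh i) K * √(spread (Vh i) K) :=
        mul_le_mul_of_nonneg_left (norm_dof_sub_mean_le _ _ _) (by positivity)
    _ = |(S i).entropyDefect ghat (Vh i) K| / √(spread (Vh i) K) := by
        have h := Real.mul_self_sqrt hsp.le
        have h' := Real.sqrt_pos.2 hsp
        rw [div_mul_eq_mul_div, div_eq_div_iff hsp.ne' h'.ne', mul_assoc, h]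
    _ ≤ C * (T i).diam K ^ (k + d) / (√c * (T i).diam K) :=
        div_le_div₀ (by positivity) (hE K) (by positivity) hsq
    _ = C / √c * (T i).diam K ^ (k + d - 1) := by
        have : k + d = k + d - 1 + 1 := by omega
        rw [this, pow_succ]
        simp only [Nat.add_sub_cancel]
        field_simp

lemma correctedRes_elementO (hd : 1 ≤ d) (hk : 1 ≤ k)
    (S : ∀ i, ResidualScheme sys (T i) s B (Q i) fhat ub)
    (hE : ElementO T (k + d) fun i K => (S i).entropyDefect ghat (Vh i) K)
    (hspread : ∃ c, 0 < c ∧ ∀ᶠ i in fineMeshes T, ∀ K,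
      c * (T i).diam K ^ 2 ≤ spread (Vh i) K)
    (hres : ∀ α, ElementO T (k + d) fun i K => ‖(S i).res (Vh i) K α‖) (α : Idx d k) :
    ElementO T (k + d - 1) fun i K => ‖(S i).correctedRes ghat (Vh i) K α‖ := by
  refine (((hres α).mono_order (Nat.sub_le _ 1)).add
    (correction_elementO hd hk S hE hspread α)).of_le fun i K => ?_
  rw [abs_of_nonneg (norm_nonneg _)]
  exact (norm_add_le _ _).trans (le_abs_self _)

end Correction

/-! ### Conservation properties of the correction -/

section Conservation

variable {d p k : ℕ} {Ω : Set (Eu d)} {s : SpaceKind} {T : Mesh d Ω}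

lemma sum_dof_sub_mean (V : DiscreteField T s k (Eu p)) (K : Fin T.nElem) :
    ∑ α, (V (T.dof s K α) - mean V K) = 0 := by
  rcases isEmpty_or_nonempty (Idx d k) with h | h
  · simp
  have hcard : (Fintype.card (Idx d k) : ℝ) ≠ 0 := Nat.cast_ne_zero.2 Fintype.card_ne_zero
  rw [Finset.sum_sub_distrib, Finset.sum_const, Finset.card_univ, mean,
    ← Nat.cast_smul_eq_nsmul ℝ, smul_smul, mul_inv_cancel₀ hcard, one_smul, sub_self]

lemma sum_inner_dof_sub_mean (V : DiscreteField T s k (Eu p)) (K : Fin T.nElem) :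
    ∑ α, inner ℝ (V (T.dof s K α)) (V (T.dof s K α) - mean V K) = spread V K := by
  have h : ∑ α, inner ℝ (mean V K) (V (T.dof s K α) - mean V K) = 0 := by
    rw [← inner_sum, sum_dof_sub_mean, inner_zero_right]
  rw [spread, ← sub_zero (∑ α, _), ← h, ← Finset.sum_sub_distrib]
  refine Finset.sum_congr rfl fun α _ => ?_
  rw [← inner_sub_left, real_inner_self_eq_norm_sq]

lemma spread_ne_zero {V : DiscreteField T s k (Eu p)} {K : Fin T.nElem}
    (h : ∃ α β : Idx d k, V (T.dof s K α) ≠ V (T.dof s K β)) : spread V K ≠ 0 := by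
  intro h0
  obtain ⟨α, β, hne⟩ := h
  have key : ∀ γ, V (T.dof s K γ) = mean V K := fun γ => by
    have := norm_dof_sub_mean_le V K γ
    rw [h0, Real.sqrt_zero] at this
    exact sub_eq_zero.1 (norm_le_zero_iff.1 this)
  exact hne ((key α).trans (key β).symm)

variable {sys : EntropySystem d p} {B : ShapeFunctions d k} {Q : FacetQuadrature T}
  {fhat : NumFlux d p (Eu p)} {ub : Eu d → Eu p}

/-- The correction redistributes the residual inside the element. -/
lemma ResidualScheme.sum_correctedRes (S : ResidualScheme sys T s B Q fhat ub)
    (ghat : NumFlux d p ℝ) {V : DiscreteField T s k (Eu p)} (hV : IsAdmissible sys B V)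
    (K : Fin T.nElem) : ∑ α, S.correctedRes ghat V K α = boundaryIntegral B Q fhat V K := by
  simp only [ResidualScheme.correctedRes, ResidualScheme.correction, Finset.sum_add_distrib,
    ← Finset.smul_sum, sum_dof_sub_mean, smul_zero, add_zero, S.conservation V hV K]

lemma ResidualScheme.sum_inner_correctedRes (S : ResidualScheme sys T s B Q fhat ub)
    (ghat : NumFlux d p ℝ) {V : DiscreteField T s k (Eu p)} {K : Fin T.nElem}
    (h : ∃ α β : Idx d k, V (T.dof s K α) ≠ V (T.dof s K β)) :
    ∑ α, inner ℝ (V (T.dof s K α)) (S.correctedRes ghat V K α) =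
      boundaryIntegral B Q ghat V K := by
  simp only [ResidualScheme.correctedRes, ResidualScheme.correction, inner_add_right,
    inner_smul_right, Finset.sum_add_distrib, ← Finset.mul_sum, sum_inner_dof_sub_mean]
  rw [ResidualScheme.coeff, div_mul_cancel₀ _ (spread_ne_zero h), ResidualScheme.entropyDefect]
  ring

end Conservation

/-! ### Coefficients of the test functions -/

section CoefficientBounds

variable {d k : ℕ} (B : ShapeFunctions d k)

lemma ShapeFunctions.exists_abs_coeff_le {κ : ℝ} (hκ : 0 < κ) : ∃ C, 0 ≤ C ∧
    ∀ (b : Simp d) (x : Eu d), Metric.closedBall x (Metric.diam b.carrier / κ) ⊆ b.carrier →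
      ∀ (c : Idx d k → ℝ) (α : Idx d k),
        |c α| * Metric.diam b.carrier ^ d ≤ C * ∫ x in b.carrier, |B.combOn b c x| := by
  obtain ⟨C, hC, h⟩ := B.exists_abs_coeff_mul_volume_le
  have ha : 0 < unitBallVolume d / κ ^ d := div_pos (unitBallVolume_pos d) (by positivity)
  refine ⟨C / (unitBallVolume d / κ ^ d), by positivity, fun b x hx c α => ?_⟩
  rw [div_mul_eq_mul_div, le_div_iff₀ ha]
  refine le_trans ?_ (h b c α)
  rw [mul_assoc, mul_comm _ (unitBallVolume d / κ ^ d)]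
  exact mul_le_mul_of_nonneg_left (b.pow_diam_le_volume hκ hx) (abs_nonneg _)

lemma ShapeFunctions.exists_abs_coeff_sub_le {κ : ℝ} (hκ : 0 < κ) : ∃ C, 0 ≤ C ∧
    ∀ (b : Simp d) (x : Eu d), Metric.closedBall x (Metric.diam b.carrier / κ) ⊆ b.carrier →
      ∀ (c : Idx d k → ℝ) (α β : Idx d k), |c α - c β| * Metric.diam b.carrier ^ d ≤
        C * Metric.diam b.carrier * ∫ x in b.carrier, ‖fderiv ℝ (B.combOn b c) x‖ := by
  obtain ⟨C, hC, h⟩ := B.exists_abs_coeff_sub_mul_volume_le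
  have ha : 0 < unitBallVolume d / κ ^ d := div_pos (unitBallVolume_pos d) (by positivity)
  refine ⟨C / (unitBallVolume d / κ ^ d), by positivity, fun b x hx c α β => ?_⟩
  rw [mul_assoc, div_mul_eq_mul_div, le_div_iff₀ ha, ← mul_assoc]
  refine le_trans ?_ (h b c α β)
  rw [mul_assoc, mul_comm _ (unitBallVolume d / κ ^ d)]
  exact mul_le_mul_of_nonneg_left (b.pow_diam_le_volume hκ hx) (abs_nonneg _)

/-- A coefficient is controlled by the trace on a face and by the gradient: it differs little from
the values of the function on the face. -/
lemma ShapeFunctions.exists_abs_coeff_le_trace (hd : 1 ≤ d) {κ : ℝ} (hκ : 0 < κ) : ∃ C, 0 ≤ C ∧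
    ∀ (b : Simp d) (x : Eu d), Metric.closedBall x (Metric.diam b.carrier / κ) ⊆ b.carrier →
      ∀ (c : Idx d k → ℝ) (α : Idx d k) (i : Fin (d + 1)),
        |c α| * Metric.diam b.carrier ^ (d - 1) ≤
          C * ((∫ y in b.face i, |B.combOn b c y| ∂μHE[d - 1]) +
            ∫ x in b.carrier, ‖fderiv ℝ (B.combOn b c) x‖) := by
  obtain ⟨C, hC, hsub⟩ := B.exists_abs_coeff_sub_le hκ
  obtain ⟨M, hM, hcomb⟩ := B.exists_norm_comb_le (Y := ℝ)
  set a := unitBallVolume d / κ ^ d with ha_def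
  have ha : 0 < a := div_pos (unitBallVolume_pos d) (by positivity)
  set A : ℝ := 2 ^ d * unitBallVolume d with hA
  have hA0 : 0 ≤ A := mul_nonneg (by positivity) (unitBallVolume_pos d).le
  refine ⟨(1 + A * (M * C)) / a, by positivity, fun b x hx c α i => ?_⟩
  set h := Metric.diam b.carrier with hh
  have hh0 : 0 < h := b.diam_pos hd
  have hpow : h ^ d = h * h ^ (d - 1) := by
    rw [← pow_succ']
    congr 1
    omega
  set G := ∫ x in b.carrier, ‖fderiv ℝ (B.combOn b c) x‖ with hG
  have hG0 : 0 ≤ G := integral_nonneg fun _ => norm_nonneg _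
  set S := ∫ y in b.face i, |B.combOn b c y| ∂μHE[d - 1] with hS
  have hS0 : 0 ≤ S := integral_nonneg fun _ => abs_nonneg _
  set μF := (μHE[d - 1] : Measure (Eu d)).real (b.face i) with hμF
  -- the area of the face is comparable to the power `d - 1` of the diameter
  have harea : a * h ^ (d - 1) ≤ μF := by
    have h1 := (b.pow_diam_le_volume hκ hx).trans (b.volume_carrier_le hd i)
    rw [← hh, hpow] at h1
    refine le_of_mul_le_mul_left ?_ hh0
    linarith
  have harea' : μF ≤ A * h ^ (d - 1) := b.area_face_le hd i
  set R := C * G / h ^ (d - 1) with hR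
  have hR0 : 0 ≤ R := by positivity
  have hRβ : ∀ β, ‖c β - c α‖ ≤ R := by
    intro β
    have h1 := hsub b x hx c β α
    rw [← hh, hpow] at h1
    rw [hR, le_div_iff₀ (by positivity), Real.norm_eq_abs]
    refine le_of_mul_le_mul_left ?_ hh0
    rw [← hG] at h1
    linarith
  have hpt : ∀ y ∈ b.face i, |c α| ≤ |B.combOn b c y| + M * R := by
    intro y hy
    have hl := b.coord_mem_stdSimplex (b.face_subset_carrier i hy)
    have h1 := hcomb (fun β => c β - c α) R hRβ _ hl
    rw [B.comb_sub_const c (c α) hl.2, Real.norm_eq_abs, abs_sub_comm] at h1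
    have h2 : |c α| ≤ |B.combOn b c y| + |c α - B.combOn b c y| := by
      have := abs_add_le (B.combOn b c y) (c α - B.combOn b c y)
      rwa [add_sub_cancel] at this
    exact h2.trans (add_le_add le_rfl h1)
  have hfin : (μHE[d - 1] : Measure (Eu d)) (b.face i) ≠ ⊤ := (b.area_face_lt_top hd i).ne
  have hint : IntegrableOn (fun y => |B.combOn b c y|) (b.face i) μHE[d - 1] :=
    b.integrableOn_face_area hd i (B.contDiff_combOn b c).continuous.abs.continuousOn
  have hinteg : |c α| * μF ≤ S + M * R * μF := by
    have h1 : ∫ _ in b.face i, |c α| ∂μHE[d - 1] ≤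
        ∫ y in b.face i, (|B.combOn b c y| + M * R) ∂μHE[d - 1] :=
      setIntegral_mono_on (integrableOn_const hfin) (hint.add (integrableOn_const hfin))
        (b.measurableSet_face i) hpt
    rw [integral_add hint (integrableOn_const hfin), setIntegral_const, setIntegral_const,
      smul_eq_mul, smul_eq_mul] at h1
    linarith
  have hMR : M * R * μF ≤ A * (M * C) * G := by
    calc M * R * μF ≤ M * R * (A * h ^ (d - 1)) :=
          mul_le_mul_of_nonneg_left harea' (by positivity)
      _ = A * (M * C) * G := by
          rw [hR]
          field_simp
  rw [div_mul_eq_mul_div, le_div_iff₀ ha]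
  calc |c α| * h ^ (d - 1) * a = |c α| * (a * h ^ (d - 1)) := by ring
    _ ≤ |c α| * μF := mul_le_mul_of_nonneg_left harea (abs_nonneg _)
    _ ≤ S + A * (M * C) * G := by linarith
    _ ≤ (1 + A * (M * C)) * (S + G) := by
        have : 0 ≤ A * (M * C) := by positivity
        nlinarith [mul_nonneg this hS0]

end CoefficientBounds

/-! ### The `L¹` norm is bounded by the `H¹` norm -/

section CauchySchwarz

variable {d k : ℕ} {Ω : Set (Eu d)}

lemma Mesh.sum_volume_le (T : Mesh d Ω) :
    ∑ K, (volume : Measure (Eu d)).real (T.elem K).carrier ≤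
      (volume : Measure (Eu d)).real (closure Ω) := by
  have h : ∀ K, (volume : Measure (Eu d)).real (T.elem K).carrier =
      (volume : Measure (Eu d)).real (interior (T.elem K).carrier) := fun K => by
    rw [measureReal_def, measureReal_def, measure_interior_of_null_frontier
      ((T.elem K).convex_carrier.addHaar_frontier volume)]
  simp only [h]
  rw [← measureReal_iUnion_fintype (fun K K' hne => T.disjoint_interior K K' hne)
    (fun K => isOpen_interior.measurableSet)
    fun K => ((measure_mono interior_subset).trans_lt
      (T.elem K).isCompact_carrier.measure_lt_top).ne]
  exact measureReal_mono
    (Set.iUnion_subset fun K => interior_subset.trans (T.carrier_subset_closure K))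
    T.isCompact_closure.measure_lt_top.ne

/-- The Cauchy–Schwarz inequality against the constants. -/
lemma sq_integral_le_volume_mul {S : Set (Eu d)} (hS : IsCompact S) {g : Eu d → ℝ}
    (hg : Continuous g) :
    (∫ x in S, g x) ^ 2 ≤ (volume : Measure (Eu d)).real S * ∫ x in S, g x ^ 2 := by
  set v := (volume : Measure (Eu d)).real S with hv
  have hint : ∀ {f : Eu d → ℝ}, Continuous f → IntegrableOn f S := fun hf =>
    hf.continuousOn.integrableOn_compact hS
  have hfin : (volume : Measure (Eu d)) S ≠ ⊤ := hS.measure_lt_top.ne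
  have hI : ∀ r : ℝ, 0 ≤ (∫ x in S, g x ^ 2) - 2 * r * (∫ x in S, g x) + r ^ 2 * v := by
    intro r
    have h : 0 ≤ ∫ x in S, (g x - r) ^ 2 := integral_nonneg fun _ => sq_nonneg _
    have he : ∀ x, (g x - r) ^ 2 = g x ^ 2 - 2 * r * g x + r ^ 2 := fun x => by ring
    simp only [he] at h
    have hlin : Continuous fun x => 2 * r * g x := continuous_const.mul hg
    rw [integral_add (f := fun x => g x ^ 2 - 2 * r * g x) (g := fun _ => r ^ 2)
        (hint ((hg.pow 2).sub hlin)) (integrableOn_const hfin),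
      integral_sub (f := fun x => g x ^ 2) (hint (hg.pow 2)) (hint hlin), integral_const_mul,
      setIntegral_const, smul_eq_mul] at h
    linarith
  have hv0 : 0 ≤ v := measureReal_nonneg
  have h := discrim_le_zero (a := v) (b := -2 * ∫ x in S, g x) (c := ∫ x in S, g x ^ 2)
    fun r => by linarith [hI r]
  rw [discrim] at h
  linarith

lemma norm_gradient_eq (f : Eu d → ℝ) (x : Eu d) : ‖gradient f x‖ = ‖fderiv ℝ f x‖ :=
  (InnerProductSpace.toDual ℝ (Eu d)).symm.norm_map _

lemma h1Norm_bound {T : Mesh d Ω} {s : SpaceKind} (B : ShapeFunctions d k)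
    (φ : DiscreteField T s k ℝ) :
    ∑ K, ((∫ x in (T.elem K).carrier, |evalOn B φ K x|) +
      ∫ x in (T.elem K).carrier, ‖fderiv ℝ (evalOn B φ K) x‖) ≤
      √(2 * (volume : Measure (Eu d)).real (closure Ω)) * h1Norm B φ := by
  have hsm : ∀ K, ContDiff ℝ 1 (evalOn B φ K) := fun K =>
    B.contDiff_combOn (T.elem K) fun α => φ (T.dof s K α)
  have hc : ∀ K, Continuous (evalOn B φ K) := fun K => (hsm K).continuous
  have hc' : ∀ K, Continuous fun x => ‖fderiv ℝ (evalOn B φ K) x‖ := fun K =>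
    ((hsm K).continuous_fderiv (by simp)).norm
  set e : Fin T.nElem → ℝ := fun K => ∫ x in (T.elem K).carrier,
    ((evalOn B φ K x) ^ 2 + ‖gradient (evalOn B φ K) x‖ ^ 2) with he
  have hint : ∀ K {f : Eu d → ℝ}, Continuous f → IntegrableOn f (T.elem K).carrier :=
    fun K _ hf => hf.continuousOn.integrableOn_compact (T.elem K).isCompact_carrier
  have hK : ∀ K, (∫ x in (T.elem K).carrier, |evalOn B φ K x|) +
      (∫ x in (T.elem K).carrier, ‖fderiv ℝ (evalOn B φ K) x‖) ≤
      √(2 * (volume : Measure (Eu d)).real (T.elem K).carrier) * √(e K) := by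
    intro K
    rw [← integral_add (hint K (hc K).abs) (hint K (hc' K)),
      ← Real.sqrt_mul (by positivity)]
    refine Real.le_sqrt_of_sq_le ?_
    have hsum : Continuous fun x => |evalOn B φ K x| + ‖fderiv ℝ (evalOn B φ K) x‖ :=
      (hc K).abs.add (hc' K)
    refine (sq_integral_le_volume_mul (T.elem K).isCompact_carrier hsum).trans ?_
    rw [mul_comm 2, mul_assoc]
    refine mul_le_mul_of_nonneg_left ?_ measureReal_nonneg
    rw [he, ← integral_const_mul]
    simp only [norm_gradient_eq]
    refine setIntegral_mono_on (hint K (hsum.pow 2))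
      (hint K (continuous_const.mul (((hc K).pow 2).add ((hc' K).pow 2))))
      (T.elem K).measurableSet_carrier fun x _ => ?_
    rw [← sq_abs (evalOn B φ K x)]
    nlinarith [sq_nonneg (|evalOn B φ K x| - ‖fderiv ℝ (evalOn B φ K) x‖)]
  refine (Finset.sum_le_sum fun K _ => hK K).trans ?_
  refine (Real.sum_sqrt_mul_sqrt_le _ (fun K => by positivity) fun K => ?_).trans ?_
  · exact integral_nonneg fun _ => by positivity
  · rw [← Finset.mul_sum]
    refine mul_le_mul_of_nonneg_right (Real.sqrt_le_sqrt ?_) (Real.sqrt_nonneg _)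
    exact mul_le_mul_of_nonneg_left T.sum_volume_le (by norm_num)

end CauchySchwarz

/-! ### The truncation error -/

section TruncationError

variable {d p k : ℕ} {Ω : Set (Eu d)}

/-- The truncation error, assembled element by element. -/
lemma truncationError_eq {T : Mesh d Ω} {s : SpaceKind} (Φ : Fin T.nElem → Idx d k → Eu p)
    (Φb : Fin T.nFacet → Idx d k → Eu p) (φ : DiscreteField T s k ℝ) :
    truncationError Φ Φb φ = ∑ K, ((∑ α, φ (T.dof s K α) • Φ K α) +
      ∑ f ∈ T.boundaryFacets K, ∑ α ∈ Finset.univ.filter (fun α => α.1 (T.side K f) = 0),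
        φ (T.dof s K α) • Φb f α) := by
  classical
  have key : ∀ (K : Fin T.nElem) (S : Finset (Idx d k)) (X : Idx d k → Eu p),
      ∑ σ, φ σ • ∑ α ∈ S.filter (fun α => T.dof s K α = σ), X α =
        ∑ α ∈ S, φ (T.dof s K α) • X α := by
    intro K S X
    rw [← Finset.sum_fiberwise S (T.dof s K)]
    refine Finset.sum_congr rfl fun σ _ => ?_
    rw [Finset.smul_sum]
    refine Finset.sum_congr rfl fun α hα => ?_
    rw [(Finset.mem_filter.1 hα).2]
  rw [truncationError, Finset.sum_add_distrib]
  simp only [smul_add, Finset.sum_add_distrib,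
    Finset.smul_sum (s := (Finset.univ : Finset (Fin T.nElem)))]
  congr 1
  · rw [Finset.sum_comm]
    refine Finset.sum_congr rfl fun K _ => ?_
    rw [← key K Finset.univ]
  · rw [Finset.sum_comm]
    refine Finset.sum_congr rfl fun K _ => ?_
    simp only [Finset.smul_sum (s := T.boundaryFacets K)]
    rw [Finset.sum_comm]
    refine Finset.sum_congr rfl fun f _ => ?_
    rw [← key K]
    refine Finset.sum_congr rfl fun σ _ => ?_
    congr 2
    ext α
    simp [and_comm]

variable {ι : Type} {T : ι → Mesh d Ω} {s : SpaceKind}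

/-- Only the total residual of an element sees the mean of the test function; the individual
residuals are tested against differences of coefficients, which gains one power of `h`. -/
lemma exists_element_sum_le (hd : 1 ≤ d) (hk : 1 ≤ k) (B : ShapeFunctions d k)
    (hT : IsRegularFamily T) {Φ : ∀ i, Fin (T i).nElem → Idx d k → Eu p}
    (hΦ : ∀ α, ElementO T (k + d - 1) fun i K => ‖Φ i K α‖)
    (hsum : ElementO T (k + d) fun i K => ‖∑ α, Φ i K α‖) :
    ∃ D, 0 ≤ D ∧ ∀ᶠ i in fineMeshes T, ∀ (φ : DiscreteField (T i) s k ℝ) K,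
      ‖∑ α, φ ((T i).dof s K α) • Φ i K α‖ ≤ D * (T i).diam K ^ k *
        ((∫ x in ((T i).elem K).carrier, |evalOn B φ K x|) +
          ∫ x in ((T i).elem K).carrier, ‖fderiv ℝ (evalOn B φ K) x‖) := by
  obtain ⟨κ, hκ, hreg⟩ := hT.exists_one_le
  have hκ0 : 0 < κ := by linarith
  obtain ⟨C₁, hC₁, hcoeff⟩ := B.exists_abs_coeff_le hκ0
  obtain ⟨C₂, hC₂, hsub⟩ := B.exists_abs_coeff_sub_le hκ0
  have hΦ' := fun α => (elementO_iff T).1 (hΦ α)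
  choose C hC hΦ using hΦ'
  obtain ⟨C', hC', hsum⟩ := (elementO_iff T).1 hsum
  have hCs : 0 ≤ ∑ α, C α := Finset.sum_nonneg fun α _ => hC α
  rcases isEmpty_or_nonempty (Idx d k) with hem | ⟨⟨α₀⟩⟩
  · refine ⟨0, le_rfl, Filter.Eventually.of_forall fun i φ K => ?_⟩
    simp
  refine ⟨(∑ α, C α) * C₂ + C' * C₁, by positivity, ?_⟩
  filter_upwards [hsum, Filter.eventually_all.2 hΦ] with i hsum hΦ φ K
  obtain ⟨x, hx⟩ := (hreg i).1 K
  set h := (T i).diam K with hh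
  have hh0 : 0 < h := ((T i).elem K).diam_pos hd
  set c : Idx d k → ℝ := fun α => φ ((T i).dof s K α) with hc
  have hev : evalOn B φ K = B.combOn ((T i).elem K) c := rfl
  rw [hev]
  set A := ∫ x in ((T i).elem K).carrier, |B.combOn ((T i).elem K) c x| with hA
  set G := ∫ x in ((T i).elem K).carrier, ‖fderiv ℝ (B.combOn ((T i).elem K) c) x‖ with hG
  have hA0 : 0 ≤ A := integral_nonneg fun _ => abs_nonneg _
  have hG0 : 0 ≤ G := integral_nonneg fun _ => norm_nonneg _
  have hsplit : ∑ α, c α • Φ i K α =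
      ∑ α, (c α - c α₀) • Φ i K α + c α₀ • ∑ α, Φ i K α := by
    simp only [sub_smul, Finset.sum_sub_distrib, Finset.smul_sum]
    abel
  have h1 : ∀ α, ‖(c α - c α₀) • Φ i K α‖ ≤ C α * (C₂ * h ^ k * G) := by
    intro α
    have hα := hΦ α K
    rw [abs_of_nonneg (norm_nonneg _)] at hα
    have hcα : |c α - c α₀| * h ^ d ≤ C₂ * h * G := hsub _ x hx c α α₀
    rw [norm_smul, Real.norm_eq_abs]
    calc |c α - c α₀| * ‖Φ i K α‖ ≤ |c α - c α₀| * (C α * h ^ (k + d - 1)) :=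
          mul_le_mul_of_nonneg_left hα (abs_nonneg _)
      _ = C α * h ^ (k - 1) * (|c α - c α₀| * h ^ d) := by
          have : k + d - 1 = (k - 1) + d := by omega
          rw [this, pow_add]
          ring
      _ ≤ C α * h ^ (k - 1) * (C₂ * h * G) :=
          mul_le_mul_of_nonneg_left hcα (mul_nonneg (hC α) (by positivity))
      _ = C α * (C₂ * h ^ k * G) := by
          have : h ^ k = h ^ (k - 1) * h := by
            rw [← pow_succ]
            congr 1
            omega
          rw [this]
          ring
  have h2 : ‖c α₀ • ∑ α, Φ i K α‖ ≤ C' * (C₁ * h ^ k * A) := by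
    have hα := hsum K
    rw [abs_of_nonneg (norm_nonneg _)] at hα
    have hcα : |c α₀| * h ^ d ≤ C₁ * A := hcoeff _ x hx c α₀
    rw [norm_smul, Real.norm_eq_abs]
    calc |c α₀| * ‖∑ α, Φ i K α‖ ≤ |c α₀| * (C' * h ^ (k + d)) :=
          mul_le_mul_of_nonneg_left hα (abs_nonneg _)
      _ = C' * h ^ k * (|c α₀| * h ^ d) := by
          rw [pow_add]
          ring
      _ ≤ C' * h ^ k * (C₁ * A) := mul_le_mul_of_nonneg_left hcα (by positivity)
      _ = C' * (C₁ * h ^ k * A) := by ring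
  change ‖∑ α, c α • Φ i K α‖ ≤ _
  rw [hsplit]
  refine (norm_add_le _ _).trans ((add_le_add ((norm_sum_le _ _).trans
    (Finset.sum_le_sum fun α _ => h1 α)) h2).trans ?_)
  rw [← Finset.sum_mul]
  have h3 : 0 ≤ (∑ α, C α) * C₂ * h ^ k * A := by positivity
  have h4 : 0 ≤ C' * C₁ * h ^ k * G := by positivity
  linarith

/-- On the boundary facets there is no cancellation, and the coefficients are controlled through the
trace of the test function. -/
lemma exists_boundary_sum_le (hd : 1 ≤ d) (B : ShapeFunctions d k)
    (hT : IsRegularFamily T) {Φb : ∀ i, Fin (T i).nFacet → Idx d k → Eu p}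
    (hΦb : ∀ α : Idx d k, BoundaryFacetO T (k + d - 1)
      fun i K f => if α.1 ((T i).side K f) = 0 then ‖Φb i f α‖ else 0) :
    ∃ D, 0 ≤ D ∧ ∀ᶠ i in fineMeshes T, ∀ (φ : DiscreteField (T i) s k ℝ) K,
      ‖∑ f ∈ (T i).boundaryFacets K,
          ∑ α ∈ Finset.univ.filter (fun α => α.1 ((T i).side K f) = 0),
            φ ((T i).dof s K α) • Φb i f α‖ ≤ D * (T i).diam K ^ k *
        ((∑ f ∈ (T i).boundaryFacets K, ∫ y in (T i).facet f, |evalOn B φ K y| ∂μHE[d - 1]) +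
          ∫ x in ((T i).elem K).carrier, ‖fderiv ℝ (evalOn B φ K) x‖) := by
  obtain ⟨κ, hκ, hreg⟩ := hT.exists_one_le
  have hκ0 : 0 < κ := by linarith
  obtain ⟨C₁, hC₁, hcoeff⟩ := B.exists_abs_coeff_le_trace hd hκ0
  have hΦ' := fun α => (hΦb α).exists_eventually
  choose C hC hΦ using hΦ'
  have hCs : 0 ≤ ∑ α, C α := Finset.sum_nonneg fun α _ => hC α
  refine ⟨(∑ α, C α) * C₁ * κ, by positivity, ?_⟩
  filter_upwards [Filter.eventually_all.2 hΦ] with i hΦ φ K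
  obtain ⟨x, hx⟩ := (hreg i).1 K
  set h := (T i).diam K with hh
  have hh0 : 0 < h := ((T i).elem K).diam_pos hd
  set c : Idx d k → ℝ := fun α => φ ((T i).dof s K α) with hc
  have hev : evalOn B φ K = B.combOn ((T i).elem K) c := rfl
  rw [hev]
  set G := ∫ x in ((T i).elem K).carrier, ‖fderiv ℝ (B.combOn ((T i).elem K) c) x‖ with hG
  have hG0 : 0 ≤ G := integral_nonneg fun _ => norm_nonneg _
  set I : Fin (T i).nFacet → ℝ := fun f =>
    ∫ y in (T i).facet f, |B.combOn ((T i).elem K) c y| ∂μHE[d - 1] with hI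
  have hI0 : ∀ f, 0 ≤ I f := fun f => integral_nonneg fun _ => abs_nonneg _
  have hone : ∀ f ∈ (T i).boundaryFacets K,
      ‖∑ α ∈ Finset.univ.filter (fun α : Idx d k => α.1 ((T i).side K f) = 0),
        c α • Φb i f α‖ ≤ (∑ α, C α) * (C₁ * h ^ k * (I f + G)) := by
    intro f hf
    have hα : ∀ α ∈ Finset.univ.filter (fun α : Idx d k => α.1 ((T i).side K f) = 0),
        ‖c α • Φb i f α‖ ≤ C α * (C₁ * h ^ k * (I f + G)) := by
      intro α hα
      have h1 := hΦ α K f hf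
      rw [if_pos (Finset.mem_filter.1 hα).2, abs_of_nonneg (norm_nonneg _)] at h1
      have h2 := hcoeff _ x hx c α ((T i).side K f)
      rw [← (T i).facet_eq_face_of_mem hf] at h2
      have h2' : |c α| * h ^ (d - 1) ≤ C₁ * (I f + G) := h2
      rw [norm_smul, Real.norm_eq_abs]
      calc |c α| * ‖Φb i f α‖ ≤ |c α| * (C α * h ^ (k + d - 1)) :=
            mul_le_mul_of_nonneg_left h1 (abs_nonneg _)
        _ = C α * h ^ k * (|c α| * h ^ (d - 1)) := by
            have : k + d - 1 = k + (d - 1) := by omega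
            rw [this, pow_add]
            ring
        _ ≤ C α * h ^ k * (C₁ * (I f + G)) :=
            mul_le_mul_of_nonneg_left h2' (mul_nonneg (hC α) (by positivity))
        _ = _ := by ring
    have h0 : 0 ≤ C₁ * h ^ k * (I f + G) :=
      mul_nonneg (by positivity) (add_nonneg (hI0 f) hG0)
    refine (norm_sum_le _ _).trans ((Finset.sum_le_sum hα).trans ?_)
    rw [← Finset.sum_mul]
    refine mul_le_mul_of_nonneg_right ?_ h0
    exact Finset.sum_le_sum_of_subset_of_nonneg (Finset.filter_subset _ _) fun α _ _ => hC α
  have hcard : (((T i).boundaryFacets K).card : ℝ) ≤ κ :=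
    le_trans (by exact_mod_cast Finset.card_le_card (Finset.filter_subset _ _)) ((hreg i).2.1 K)
  refine (norm_sum_le _ _).trans ((Finset.sum_le_sum hone).trans ?_)
  rw [← Finset.mul_sum, ← Finset.mul_sum, Finset.sum_add_distrib, Finset.sum_const, nsmul_eq_mul]
  have hIs : 0 ≤ ∑ f ∈ (T i).boundaryFacets K, I f := Finset.sum_nonneg fun f _ => hI0 f
  calc (∑ α, C α) * (C₁ * h ^ k * ((∑ f ∈ (T i).boundaryFacets K, I f) +
        (((T i).boundaryFacets K).card : ℝ) * G))
      ≤ (∑ α, C α) * (C₁ * h ^ k * (κ * (∑ f ∈ (T i).boundaryFacets K, I f) + κ * G)) := by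
        gcongr
        exact le_mul_of_one_le_left hIs hκ
    _ = _ := by ring

/-- Residuals of order `k + d - 1`, with element sums of order `k + d`, define a scheme of
order `k`. -/
theorem isOfOrder_of_residuals (hd : 1 ≤ d) (hk : 1 ≤ k) (hΩ : IsOpen Ω) (B : ShapeFunctions d k)
    (hT : IsRegularFamily T) {Φ : ∀ i, Fin (T i).nElem → Idx d k → Eu p}
    {Φb : ∀ i, Fin (T i).nFacet → Idx d k → Eu p}
    (hΦ : ∀ α, ElementO T (k + d - 1) fun i K => ‖Φ i K α‖)
    (hsum : ElementO T (k + d) fun i K => ‖∑ α, Φ i K α‖)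
    (hΦb : ∀ α : Idx d k, BoundaryFacetO T (k + d - 1)
      fun i K f => if α.1 ((T i).side K f) = 0 then ‖Φb i f α‖ else 0) :
    IsOfOrder (s := s) T B k Φ Φb := by
  rcases isEmpty_or_nonempty ι with hι | ⟨⟨i₀⟩⟩
  · exact ⟨0, 1, one_pos, fun i => (hι.false i).elim⟩
  obtain ⟨D₁, hD₁, h₁⟩ := exists_element_sum_le (s := s) hd hk B hT hΦ hsum
  obtain ⟨D₂, hD₂, h₂⟩ := exists_boundary_sum_le (s := s) hd B hT hΦb
  obtain ⟨Ct, hCt, htrace⟩ := Mesh.exists_trace_le hd hΩ (T i₀)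
  set v := √(2 * (volume : Measure (Eu d)).real (closure Ω)) with hv
  obtain ⟨h₀, hh₀, h⟩ := (eventually_fineMeshes T).1 (h₁.and h₂)
  refine ⟨(D₁ + D₂ * (Ct + 1)) * v, h₀, hh₀, fun i hi φ hφ => ?_⟩
  obtain ⟨h₁, h₂⟩ := h i hi
  set X : Fin (T i).nElem → ℝ := fun K =>
    (∫ x in ((T i).elem K).carrier, |evalOn B φ K x|) +
      ∫ x in ((T i).elem K).carrier, ‖fderiv ℝ (evalOn B φ K) x‖ with hX
  set Y : Fin (T i).nElem → ℝ := fun K =>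
    ∑ f ∈ (T i).boundaryFacets K, ∫ y in (T i).facet f, |evalOn B φ K y| ∂μHE[d - 1] with hY
  have hA0 : ∀ K, 0 ≤ ∫ x in ((T i).elem K).carrier, |evalOn B φ K x| := fun K =>
    integral_nonneg fun _ => abs_nonneg _
  have hX0 : ∀ K, 0 ≤ X K := fun K =>
    add_nonneg (hA0 K) (integral_nonneg fun _ => norm_nonneg _)
  have hY0 : ∀ K, 0 ≤ Y K := fun K => Finset.sum_nonneg fun f _ =>
    integral_nonneg fun _ => abs_nonneg _
  have hXY : ∑ K, Y K ≤ Ct * ∑ K, X K := htrace (T i) (evalOn B φ)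
    (fun K => B.contDiff_combOn ((T i).elem K) fun α => φ ((T i).dof s K α)) hφ
  have hpow : ∀ K, (T i).diam K ^ k ≤ (T i).size ^ k := fun K =>
    pow_le_pow_left₀ ((T i).diam_nonneg K) ((T i).diam_le_size K) k
  have hs0 : 0 ≤ (T i).size ^ k := pow_nonneg (T i).size_nonneg k
  have hK : ∀ K, ‖(∑ α, φ ((T i).dof s K α) • Φ i K α) +
      ∑ f ∈ (T i).boundaryFacets K,
        ∑ α ∈ Finset.univ.filter (fun α => α.1 ((T i).side K f) = 0),
          φ ((T i).dof s K α) • Φb i f α‖ ≤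
      (T i).size ^ k * (D₁ * X K + D₂ * (Y K + X K)) := by
    intro K
    refine (norm_add_le _ _).trans ((add_le_add (h₁ φ K) (h₂ φ K)).trans ?_)
    have hYX : 0 ≤ Y K + X K := add_nonneg (hY0 K) (hX0 K)
    have hGX : ∫ x in ((T i).elem K).carrier, ‖fderiv ℝ (evalOn B φ K) x‖ ≤ X K :=
      le_add_of_nonneg_left (hA0 K)
    have hX0K := hX0 K
    have hpowK := hpow K
    have hdK : 0 ≤ (T i).diam K ^ k := pow_nonneg ((T i).diam_nonneg K) k
    calc D₁ * (T i).diam K ^ k * X K + D₂ * (T i).diam K ^ k *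
          (Y K + ∫ x in ((T i).elem K).carrier, ‖fderiv ℝ (evalOn B φ K) x‖)
        ≤ D₁ * (T i).size ^ k * X K + D₂ * (T i).size ^ k * (Y K + X K) := by gcongr
      _ = _ := by ring
  rw [truncationError_eq]
  refine (norm_sum_le _ _).trans ((Finset.sum_le_sum fun K _ => hK K).trans ?_)
  calc ∑ K, (T i).size ^ k * (D₁ * X K + D₂ * (Y K + X K))
      = (T i).size ^ k * (D₁ * (∑ K, X K) + D₂ * ((∑ K, Y K) + ∑ K, X K)) := by
        simp only [Finset.mul_sum, Finset.sum_add_distrib, mul_add]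
    _ ≤ (T i).size ^ k * (D₁ * (∑ K, X K) + D₂ * (Ct * (∑ K, X K) + ∑ K, X K)) := by
        gcongr
    _ = (D₁ + D₂ * (Ct + 1)) * (T i).size ^ k * ∑ K, X K := by ring
    _ ≤ (D₁ + D₂ * (Ct + 1)) * (T i).size ^ k * (v * h1Norm B φ) :=
        mul_le_mul_of_nonneg_left (h1Norm_bound B φ) (by positivity)
    _ = _ := by ring

end TruncationError

end ResidualDistribution

theorem mainTheorem1 {d p k : ℕ} (hd : 1 ≤ d) (hk : 1 ≤ k)
    (sys : EntropySystem d p)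
    (Ω : Set (Eu d)) (hΩ : IsOpen Ω)
    (ub : Eu d → Eu p)
    (hub : ∀ x ∈ frontier Ω, ub x ∈ sys.D)
    -- consistent, Lipschitz numerical fluxes
    (fhat : NumFlux d p (Eu p))
    (hf : IsConsistent sys sys.normalFlux fhat)
    (hfL : IsLipschitzFlux sys fhat)
    (ghat : NumFlux d p ℝ)
    (hg : IsConsistent sys sys.normalEntropyFlux ghat)
    (hgL : IsLipschitzFlux sys ghat)
    -- a family of meshes with quadratures and residual schemes
    {ι : Type} (T : ι → Mesh d Ω)
    (s : SpaceKind)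
    (hs : s = .continuous → ∀ i, (T i).IsConformal)
    (B : ShapeFunctions d k)
    (Q : ∀ i, FacetQuadrature (T i))
    (S : ∀ i, ResidualScheme sys (T i) s B (Q i) fhat ub) :
    -- conservation of `u`
    (∀ i (V : DiscreteField (T i) s k (Eu p)),
      IsAdmissible sys B V → ∀ K,
        ∑ α, (S i).correctedRes ghat V K α =
          boundaryIntegral B (Q i) fhat V K) ∧
    -- conservation of the entropy
    (∀ i (V : DiscreteField (T i) s k (Eu p)),
      IsAdmissible sys B V → ∀ K,
        (∃ α β : Idx d k,
          V ((T i).dof s K α) ≠ V ((T i).dof s K β)) →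
        ∑ α, inner ℝ (V ((T i).dof s K α)) ((S i).correctedRes ghat V K α) =
          boundaryIntegral B (Q i) ghat V K) ∧
    -- accuracy for smooth steady solutions
    (IsRegularFamily T →
      IsQuadratureOfOrder T Q k →
      ∀ u : Eu d → Eu p,
      IsSmoothSteadySolution sys Ω (k + 1) u →
      ∀ Vh : ∀ i, DiscreteField (T i) s k (Eu p),
      (∃ h₀ : ℝ, 0 < h₀ ∧ ∀ i, (T i).size ≤ h₀ → IsAdmissible sys B (Vh i)) →
      IsApproximation T B (k + 1) (fun x => sys.entropyVar (u x)) Vh →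
      (∀ α, ElementO T (k + d) fun i K => ‖(S i).res (Vh i) K α‖) →
      (∀ α, BoundaryFacetO T (k + d - 1)
        fun i K f => if α.1 ((T i).side K f) = 0 then ‖(S i).bdryRes (Vh i) f α‖ else 0) →
      ElementO T (k + d) (fun i K => (S i).entropyDefect ghat (Vh i) K) ∧
      ((∀ x ∈ closure Ω, fderiv ℝ (fun y => sys.entropyVar (u y)) x ≠ 0) →
        (∃ c h₀ : ℝ, 0 < c ∧ 0 < h₀ ∧ ∀ i, (T i).size ≤ h₀ → ∀ K,
          c * (T i).diam K ^ 2 ≤ spread (Vh i) K) ∧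
        ElementO T (k + d - 2) (fun i K => (S i).coeff ghat (Vh i) K) ∧
        (∀ α, ElementO T (k + d - 1)
          fun i K => ‖(S i).correction ghat (Vh i) K α‖) ∧
        (∀ α, ElementO T (k + d - 1)
          fun i K => ‖(S i).correctedRes ghat (Vh i) K α‖) ∧
        IsOfOrder (s := s) T B k
          (fun i => (S i).correctedRes ghat (Vh i)) (fun i => (S i).bdryRes (Vh i)))) := by
  refine ⟨fun i V hV K => (S i).sum_correctedRes ghat hV K,
    fun i V _ K h => (S i).sum_inner_correctedRes ghat h, ?_⟩
  intro hT hQ u hu Vh hadm happ hres hbdry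
  have hadm' := (eventually_fineMeshes T).2 hadm
  have hE : ElementO T (k + d) fun i K => (S i).entropyDefect ghat (Vh i) K :=
    entropyDefect_elementO S
      (hu.boundaryIntegral_entropyFlux hd hT B hQ hg hgL hadm' happ)
      (happ.exists_norm_coeff_le hu.continuousOn_entropyVar) hres
  refine ⟨hE, fun hne => ?_⟩
  have hspread := happ.exists_spread_ge hk hT B hu.smooth_entropyVar hne
  have hcorr := correctedRes_elementO hd hk S hE hspread hres
  refine ⟨?_, coeff_elementO hd hk S hE hspread, correction_elementO hd hk S hE hspread, hcorr,
    isOfOrder_of_residuals hd hk hΩ B hT hcorr ?_ hbdry⟩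
  · obtain ⟨c, hc, h⟩ := hspread
    obtain ⟨h₀, hh₀, h⟩ := (eventually_fineMeshes T).1 h
    exact ⟨c, h₀, hc, hh₀, h⟩
  · -- the sum of the corrected residuals is a flux integral on the meshes where the data is
    -- admissible
    obtain ⟨C, hC, h⟩ := (elementO_iff T).1 (hu.boundaryIntegral_flux hd hT B hQ hf hfL hadm' happ)
    refine (elementO_iff T).2 ⟨C, hC, ?_⟩
    filter_upwards [hadm', h] with i hadm h K
    rw [(S i).sum_correctedRes ghat hadm K]
    exact h K
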